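/- Let $d\ge 1$, $1<p<\infty$, $0\le a<b<\infty$, and let $\Omega=\{x\in\mathbb R^d:|x|<b\}$ or $\Omega=\{x\in\mathbb R^d:a<|x|<b\}$. Let $w(x)=\eta(|x|)$, where $\eta\in L^1_{\rm loc}([0,\infty))$, $\eta\ge 0$ a.e., and $\eta=0$ outside $(a,b)$. Put $$I=\{r\in(a,b):\ \eta^{-1/(p-1)}\in L^1((r-\varepsilon,r+\varepsilon))\text{ for some }\varepsilon>0\},\qquad I_{\Omega,w}=\{x\in\Omega:|x|\in I\},$$ with $\eta^{-1/(p-1)}=+\infty$ where $\eta=0$. Assume that $\eta$ is finitely degenerate: the open set $I$ is nonempty and has finitely many connected components $(a_i,b_i)$, $1\le i\le N$. Put $m_i=\frac{a_i+b_i}2$ and, for $a_i\le s<t\le b_i$, $$J(s,t)=\int_{\{s<|y|<t\}}\big(|y|^{(d-1)p}\,w(y)\big)^{-\frac1{p-1}}\,dy .$$ Let $\hat w_p:\Omega\to[0,\infty)$ be the weight with $\hat w_p=0$ on $\Omega\setminus I_{\Omega,w}$ and, for $a_i<|x|<b_i$, $$\hat w_p(x)=\begin{cases} J(|x|,m_i)^{-1},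 & |x|\le\frac{3a_i+b_i}4,\\[2pt] J\big(\frac{3a_i+b_i}4,\frac{a_i+3b_i}4\big)^{-1}, & \frac{3a_i+b_i}4<|x|<\frac{a_i+3b_i}4,\\[2pt] J(m_i,|x|)^{-1}, & |x|\ge\frac{a_i+3b_i}4.\end{cases}$$ Let $X=L^p(\Omega,\hat w_p^{\,p-1}\,dx)$; its elements are functions on $I_{\Omega,w}$ modulo null sets. Let $$W=\Big\{u\in X:\ u(x)=v(|x|)\text{ a.e. in }I_{\Omega,w},\ v\in W^{1,1}_{\rm loc}(I),\ \int_I r^{d-1}|v'(r)|^p\eta(r)\,dr<\infty\Big\},$$ $$\mathcal D=\Big\{u\in X:\ u\in W^{1,1}_{\rm loc}(I_{\Omega,w}),\ \int_{I_{\Omega,w}}|\nabla u|^p\,w\,dx<\infty\Big\},$$ so that $\mathcal D$ also contains non-radial functions. Let $F:X\to[0,\infty]$ be given by $F(u)=\int_\Omega|\nabla u|^p\,w\,dx$ if $u(x)=v(|x|)$ with $v$ absolutely continuous on $(a,b)$ (infimum over all such $v$ representing $u$ a.e. in $I_{\Omega,w}$, with $\nabla u$ computed from $v$), and $F(u)=+\infty$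 otherwise. Let $\overline F(u)$ be, for $u\in W$, the value at $u$ of the lower semicontinuous envelope of $F$ in the norm topology of $X$; for $u\in\mathcal D\setminus W$ put $\overline F(u)=\int_{I_{\Omega,w}}|\nabla u|^p\,w\,dx$. Let $g\in X$ be radial and $$H(u)=\overline F(u)+\|u-g\|_{L^p(\Omega,\hat w_p^{\,p-1})} .$$ **Theorem.** $H$ has a unique minimizer $u_0$ over $W$. Moreover $u_0\in\mathcal D$ and $u_0$ also minimizes $H$ over the larger class $\mathcal D$, that is, $H(u_0)\le H(z)$ for all $z\in\mathcal D$, and it is the only minimizer of $H$ over $\mathcal D$. Hence the minimizer of $H$ over $\mathcal D$ is radial. -/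

import Mathlib

open MeasureTheory Set Topology
open scoped ENNReal ContDiff

noncomputable section

namespace RadialWeight

/-- `ℝ^d` with the Euclidean norm. -/
abbrev Space (d : ℕ) : Type := EuclideanSpace ℝ (Fin d)

instance factOneLe (p : ℝ) [hp : Fact (1 < p)] : Fact (1 ≤ ENNReal.ofReal p) :=
  ⟨by simpa using ENNReal.ofReal_le_ofReal hp.out.le⟩

/-- `η^{-1/(p-1)}` with values in `[0, ∞]`, equal to `∞` where `η` vanishes. -/
def invWeight (p : ℝ) (η : ℝ → ℝ) (s : ℝ) : ℝ≥0∞ :=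
  ENNReal.ofReal (η s) ^ (-(1 / (p - 1)))

/-- The set `I_{p, supp η}` of the points of the interval `(a, b)` carrying the weight near which
`η^{-1/(p-1)}` is summable. -/
def regularRadii (p a b : ℝ) (η : ℝ → ℝ) : Set ℝ :=
  {r | r ∈ Ioo a b ∧ ∃ ε > 0, ∫⁻ s in Ioo (r - ε) (r + ε), invWeight p η s < ⊤}

/-- `η` is finitely degenerate: the open set `I_{p, supp η}` has at least one and at most finitely
many connected components `(a_i, b_i)`. -/
def FinitelyDegenerate (p a b : ℝ) (η : ℝ → ℝ) : Prop :=
  (regularRadii p a b η).Nonempty ∧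
    (connectedComponentIn (regularRadii p a b η) '' regularRadii p a b η).Finite

/-- The left endpoint `a_i` of the component of `I_{p, supp η}` containing `t`. -/
def leftEnd (p a b : ℝ) (η : ℝ → ℝ) (t : ℝ) : ℝ :=
  sInf (connectedComponentIn (regularRadii p a b η) t)

/-- The right endpoint `b_i` of the component of `I_{p, supp η}` containing `t`. -/
def rightEnd (p a b : ℝ) (η : ℝ → ℝ) (t : ℝ) : ℝ :=
  sSup (connectedComponentIn (regularRadii p a b η) t)

/-- The set `I_{Ω, w}` of the points `x` of `Ω` with `|x|` in `I_{p, supp η}`. -/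
def regularSet {d : ℕ} (p a b : ℝ) (η : ℝ → ℝ) (Ω : Set (Space d)) : Set (Space d) :=
  {x | x ∈ Ω ∧ ‖x‖ ∈ regularRadii p a b η}

/-- The integral of `(|y|^{(d-1)p} w(y))^{-1/(p-1)}`, `w(y) = η(|y|)`, over the shell
`{y ∈ I_{Ω, w} : s < |y| < t}`. -/
def shellIntegral {d : ℕ} (p a b : ℝ) (η : ℝ → ℝ) (Ω : Set (Space d)) (s t : ℝ) : ℝ≥0∞ :=
  ∫⁻ y in {y | y ∈ regularSet p a b η Ω ∧ s < ‖y‖ ∧ ‖y‖ < t},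
    ENNReal.ofReal (‖y‖ ^ (((d : ℝ) - 1) * p) * η ‖y‖) ^ (-(1 / (p - 1)))

open Classical in
/-- The auxiliary weight `ŵ_p`. The boundary spheres `|x| = a_i` and `|x| = b_i` are Lebesgue null,
so its values there are immaterial; they are set to `0`. -/
def auxWeight {d : ℕ} (p a b : ℝ) (η : ℝ → ℝ) (Ω : Set (Space d)) (x : Space d) : ℝ≥0∞ :=
  let α := leftEnd p a b η ‖x‖
  let β := rightEnd p a b η ‖x‖
  if x ∈ regularSet p a b η Ω then
    if ‖x‖ ≤ (3 * α + β) / 4 then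
      (shellIntegral p a b η Ω ‖x‖ ((α + β) / 2))⁻¹
    else if ‖x‖ < (α + 3 * β) / 4 then
      (shellIntegral p a b η Ω ((3 * α + β) / 4) ((α + 3 * β) / 4))⁻¹
    else
      (shellIntegral p a b η Ω ((α + β) / 2) ‖x‖)⁻¹
  else 0

/-- The measure `(ŵ_p)^{p-1} dx` on `Ω`. -/
def auxMeasure {d : ℕ} (p a b : ℝ) (η : ℝ → ℝ) (Ω : Set (Space d)) : Measure (Space d) :=
  (volume.restrict Ω).withDensity fun x => auxWeight p a b η Ω x ^ (p - 1)

/-- The space `X = L^p(Ω, (ŵ_p)^{p-1})`. As `ŵ_p` is positive on `I_{Ω, w}` and vanishes elsewhere,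
its elements are functions on `I_{Ω, w}` up to Lebesgue null sets. -/
abbrev X {d : ℕ} (p a b : ℝ) (η : ℝ → ℝ) (Ω : Set (Space d)) : Type :=
  Lp ℝ (ENNReal.ofReal p) (auxMeasure p a b η Ω)

/-- `u ∈ W^{1,1}_loc(U)` with weak gradient `G`, for an open set `U`. -/
def HasWeakGradientOn {E : Type*} [NormedAddCommGroup E] [InnerProductSpace ℝ E] [MeasureSpace E]
    (U : Set E) (u : E → ℝ) (G : E → E) : Prop :=
  LocallyIntegrableOn u U ∧ LocallyIntegrableOn G U ∧
    ∀ φ : E → ℝ, ContDiff ℝ ∞ φ → HasCompactSupport φ → tsupport φ ⊆ U →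
      ∀ e : E, ∫ x, u x * fderiv ℝ φ x e = -∫ x, inner ℝ (G x) e * φ x

/-- `v ∈ Dom_η`: `v ∈ W^{1,1}_loc(I_{p, supp η})` and `∫ r^{d-1} |v'(r)|^p η(r) dr < ∞`. -/
def MemDomProfile (d : ℕ) (p a b : ℝ) (η : ℝ → ℝ) (v : ℝ → ℝ) : Prop :=
  ∃ G : ℝ → ℝ, HasWeakGradientOn (regularRadii p a b η) v G ∧
    ∫⁻ r in regularRadii p a b η,
      ENNReal.ofReal (r ^ (d - 1)) * ‖G r‖ₑ ^ p * ENNReal.ofReal (η r) < ⊤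

/-- The space `W = Dom_{r,w} ∩ L^p(Ω, (ŵ_p)^{p-1})` of radial functions `u(x) = v(|x|)`,
`v ∈ Dom_η`. -/
def W {d : ℕ} (p a b : ℝ) (η : ℝ → ℝ) (Ω : Set (Space d)) : Set (X p a b η Ω) :=
  {u | ∃ v : ℝ → ℝ, MemDomProfile d p a b η v ∧
    (u : Space d → ℝ) =ᵐ[volume.restrict (regularSet p a b η Ω)] fun x => v ‖x‖}

/-- The class of all, possibly non-radial, `u ∈ W^{1,1}_loc(I_{Ω, w})` with
`∫_{I_{Ω, w}} |∇u|^p w dx < ∞` that lie in `L^p(Ω, (ŵ_p)^{p-1})`. -/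
def domBar {d : ℕ} (p a b : ℝ) (η : ℝ → ℝ) (Ω : Set (Space d)) : Set (X p a b η Ω) :=
  {u | ∃ G : Space d → Space d, HasWeakGradientOn (regularSet p a b η Ω) u G ∧
    ∫⁻ x in regularSet p a b η Ω, ‖G x‖ₑ ^ p * ENNReal.ofReal (η ‖x‖) < ⊤}

/-- The integral `∫_{I_{Ω, w}} |∇u|^p w dx` of the (almost everywhere unique) weak gradient. -/
def weightedEnergy {d : ℕ} (p a b : ℝ) (η : ℝ → ℝ) (Ω : Set (Space d)) (u : X p a b η Ω) : ℝ≥0∞ :=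
  ⨅ (G : Space d → Space d) (_ : HasWeakGradientOn (regularSet p a b η Ω) u G),
    ∫⁻ x in regularSet p a b η Ω, ‖G x‖ₑ ^ p * ENNReal.ofReal (η ‖x‖)

/-- The functional `F` on `X`: `∫_Ω |∇u|^p w dx` if `u(x) = v(|x|)` with `v` absolutely continuous
on the interval `(a, b)` carrying the weight (such a `u` is automatically in
`W^{1,1}_loc(I_{Ω, w})`), and `∞` if there is no such `v`. The infimum is there because an element
of `X` determines `u` on `I_{Ω, w}` only. Absolutely continuous functions on the bounded interval
`(a, b)` are the restrictions of those on `[a, b]`. -/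
def F {d : ℕ} (p a b : ℝ) (η : ℝ → ℝ) (Ω : Set (Space d)) (u : X p a b η Ω) : ℝ≥0∞ :=
  ⨅ (v : ℝ → ℝ) (_ : AbsolutelyContinuousOnInterval v a b)
    (_ : (u : Space d → ℝ) =ᵐ[volume.restrict (regularSet p a b η Ω)] fun x => v ‖x‖),
    ∫⁻ x in Ω, ‖fderiv ℝ (fun y : Space d => v ‖y‖) x‖ₑ ^ p * ENNReal.ofReal (η ‖x‖)

/-- The lower semicontinuous envelope: the largest lower semicontinuous functional below `f`. -/
def lscEnvelope {Y : Type*} [TopologicalSpace Y] (f : Y → ℝ≥0∞) (y : Y) : ℝ≥0∞ :=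
  ⨆ (h : Y → ℝ≥0∞) (_ : LowerSemicontinuous h) (_ : ∀ z, h z ≤ f z), h y

open Classical in
/-- The relaxed functional: on the radial space `W` it is the lower semicontinuous envelope of `F`
in `X`; to other functions it is extended by the integral `∫_{I_{Ω, w}} |∇u|^p w dx`. -/
def FBar {d : ℕ} (p a b : ℝ) [Fact (1 < p)] (η : ℝ → ℝ) (Ω : Set (Space d))
    (u : X p a b η Ω) : ℝ≥0∞ :=
  if u ∈ W p a b η Ω then lscEnvelope (F p a b η Ω) u else weightedEnergy p a b η Ω u

/-- The functional `H(u) = F̄(u) + ‖u - g‖`, with the norm of `L^p(Ω, (ŵ_p)^{p-1})`. -/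
def H {d : ℕ} (p a b : ℝ) [Fact (1 < p)] (η : ℝ → ℝ) (Ω : Set (Space d))
    (g u : X p a b η Ω) : ℝ≥0∞ :=
  FBar p a b η Ω u + ‖u - g‖ₑ

end RadialWeight

end

/-! The relaxed functional turns out to be the Dirichlet energy E(u) of the weak gradient on
I_{Ω,w}, with E(u) = ∞ when there is no gradient of finite energy (`FBar_eq_weightedEnergy`). Hence
H(u) = E(u) + ‖u - g‖ on all of X, and the theorem follows from convexity and rotation invariance of
this functional.

Minimization. E(u) = ‖V‖^p, where V is the gradient regarded as an element of L^p(w dx), and the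
pairs (u, V) form a relation `gradGraph` that is closed and stable under midpoints. It is closed
because both weighted norms control L^1 on compact subsets of I_{Ω,w}: gradients by Hölder against
η^{-1/(p-1)}, functions by local lower bounds for ŵ_p. Uniform convexity takes the place of weak
compactness: nearly norm-minimal elements of a decreasing sequence of convex sets form a Cauchy
sequence (`Lp_exists_convergent_selection`). This gives lower semicontinuity of E and existence of a
minimizer. For uniqueness, strict convexity of ‖V‖^p forces two minimizers to have the same
gradient, hence the same distance to g, and strict convexity of the L^p norm then identifies them.

Radiality. Linear isometries preserve E, the norm of X and g. The unique minimizer is therefore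
invariant under all of them, hence radial (`exists_ae_eq_comp_norm`), and its profile is weakly
differentiable (`HasWeakGradientOn.exists_radial_profile`), so that it lies in W.

Relaxation. E is lower semicontinuous and E ≤ F, which gives one inequality. For the other, the
endpoints of the components of I are not regular: η^{-1/(p-1)} has infinite mass near them, so an
absolutely continuous profile can change by any given amount there at arbitrarily small cost
(`exists_bump`). A profile in W is first frozen near the ends of each component and the frozen
pieces are then connected through such cheap transitions. Having finitely many components keeps the
number of transitions finite and ŵ_p bounded. -/

set_option linter.unusedSectionVars false

/-! ### Quantitative convexity of p-th powers of norms, pointwise and in L^p -/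

section UniformConvexity

open Filter

variable {E : Type*} [NormedAddCommGroup E] [InnerProductSpace ℝ E]

lemma norm_midpoint_rpow_le {p : ℝ} (hp : 1 < p) (x y : E) :
    ‖(1 / 2 : ℝ) • (x + y)‖ ^ p ≤ (‖x‖ ^ p + ‖y‖ ^ p) / 2 := by
  have h1 : ‖(1 / 2 : ℝ) • (x + y)‖ ≤ (1 / 2 : ℝ) * ‖x‖ + (1 / 2 : ℝ) * ‖y‖ := by
    rw [norm_smul]
    have := norm_add_le x y
    norm_num
    linarith
  have h2 := (convexOn_rpow hp.le).2 (norm_nonneg x) (norm_nonneg y)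
    (show (0 : ℝ) ≤ 1 / 2 by norm_num) (show (0 : ℝ) ≤ 1 / 2 by norm_num) (by norm_num)
  simp only [smul_eq_mul] at h2
  calc _ ≤ ((1 / 2 : ℝ) * ‖x‖ + (1 / 2 : ℝ) * ‖y‖) ^ p := by gcongr
    _ ≤ _ := h2
    _ = _ := by ring

/-- Two sources of strictness: for equal norms, balls of an inner product space are strictly convex;
for different norms, t ↦ t^p is. -/
lemma norm_midpoint_rpow_lt {p : ℝ} (hp : 1 < p) {x y : E} (hxy : x ≠ y) :
    ‖(1 / 2 : ℝ) • (x + y)‖ ^ p < (‖x‖ ^ p + ‖y‖ ^ p) / 2 := by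
  have h1 : ‖(1 / 2 : ℝ) • (x + y)‖ ≤ (1 / 2 : ℝ) * ‖x‖ + (1 / 2 : ℝ) * ‖y‖ := by
    rw [norm_smul]
    have := norm_add_le x y
    norm_num
    linarith
  by_cases hn : ‖x‖ = ‖y‖
  · have h3 : ‖(1 / 2 : ℝ) • (x + y)‖ < ‖y‖ := by
      have := norm_combo_lt_of_ne (x := x) (y := y) (r := ‖y‖) hn.le le_rfl hxy
        (a := 1 / 2) (b := 1 / 2) (by norm_num) (by norm_num) (by norm_num)
      rwa [← smul_add] at this
    rw [hn]
    calc _ < ‖y‖ ^ p := by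
          apply Real.rpow_lt_rpow (norm_nonneg _) h3 (by linarith)
      _ = _ := by ring
  · have h2 := (strictConvexOn_rpow hp).2 (norm_nonneg x) (norm_nonneg y) hn
      (show (0 : ℝ) < 1 / 2 by norm_num) (show (0 : ℝ) < 1 / 2 by norm_num) (by norm_num)
    simp only [smul_eq_mul] at h2
    calc _ ≤ ((1 / 2 : ℝ) * ‖x‖ + (1 / 2 : ℝ) * ‖y‖) ^ p := by gcongr
      _ < _ := h2
      _ = _ := by ring

/-- A quantitative form of the strict convexity of `x ↦ ‖x‖ ^ p`, `1 < p`. -/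
lemma exists_norm_sub_rpow_le [FiniteDimensional ℝ E] {p : ℝ} (hp : 1 < p) {ε : ℝ} (hε : 0 < ε) :
    ∃ C : ℝ, 0 ≤ C ∧ ∀ x y : E, ‖x - y‖ ^ p + C * ‖(1 / 2 : ℝ) • (x + y)‖ ^ p ≤
      ε * (‖x‖ ^ p + ‖y‖ ^ p) + C * ((‖x‖ ^ p + ‖y‖ ^ p) / 2) := by
  have hp0 : 0 < p := by linarith
  -- By homogeneity it suffices to treat normalized pairs. Those with ‖x - y‖^p ≥ ε form a compact
  -- set, on which the convexity gap has a positive minimum c.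
  let K : Set (E × E) := {z | ‖z.1‖ ^ p + ‖z.2‖ ^ p = 1 ∧ ε ≤ ‖z.1 - z.2‖ ^ p}
  have hcont (f : E × E → E) (hf : Continuous f) : Continuous fun z => ‖f z‖ ^ p :=
    (hf.norm).rpow_const fun _ => Or.inr hp0.le
  have hbd : ∀ z : E × E, ‖z.1‖ ^ p + ‖z.2‖ ^ p = 1 → ‖z.1‖ ≤ 1 ∧ ‖z.2‖ ≤ 1 := by
    intro z hz
    have h1 : 0 ≤ ‖z.1‖ ^ p := by positivity
    have h2 : 0 ≤ ‖z.2‖ ^ p := by positivity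
    constructor
    · by_contra! h
      have := Real.one_lt_rpow h hp0
      linarith
    · by_contra! h
      have := Real.one_lt_rpow h hp0
      linarith
  have hK : IsCompact K := by
    refine Metric.isCompact_of_isClosed_isBounded ?_ ?_
    · refine IsClosed.and (isClosed_eq ?_ continuous_const) (isClosed_le continuous_const ?_)
      · exact (hcont _ continuous_fst).add (hcont _ continuous_snd)
      · exact hcont (fun z => z.1 - z.2) (continuous_fst.sub continuous_snd)
    · refine (Metric.isBounded_closedBall (x := (0 : E × E)) (r := 1)).subset ?_
      intro z hz
      have := hbd z hz.1
      simp only [mem_closedBall_zero_iff, Prod.norm_def]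
      exact max_le this.1 this.2
  obtain ⟨c, hc, hcK⟩ : ∃ c : ℝ, 0 < c ∧ ∀ z ∈ K,
      c ≤ (‖z.1‖ ^ p + ‖z.2‖ ^ p) / 2 - ‖(1 / 2 : ℝ) • (z.1 + z.2)‖ ^ p := by
    rcases K.eq_empty_or_nonempty with h | h
    · exact ⟨1, one_pos, by simp [h]⟩
    obtain ⟨z, hz, hmin⟩ := hK.exists_isMinOn h (f := fun z : E × E =>
      (‖z.1‖ ^ p + ‖z.2‖ ^ p) / 2 - ‖(1 / 2 : ℝ) • (z.1 + z.2)‖ ^ p)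
      (((((hcont _ continuous_fst).add (hcont _ continuous_snd)).div_const 2).sub
        (hcont _ ((continuous_fst.add continuous_snd).const_smul _))).continuousOn)
    refine ⟨_, ?_, fun w hw => hmin hw⟩
    have : z.1 ≠ z.2 := by
      intro h
      have := hz.2
      rw [h, sub_self, norm_zero, Real.zero_rpow hp0.ne'] at this
      linarith
    have := norm_midpoint_rpow_lt hp this
    simp only
    linarith
  -- On K the gap is at least c while ‖x - y‖^p ≤ 2^p, hence C = 2^p / c. Off K the ε-term alone
  -- bounds ‖x - y‖^p.
  refine ⟨2 ^ p / c, by positivity, fun x y => ?_⟩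
  have key : ∀ x y : E, ‖x‖ ^ p + ‖y‖ ^ p = 1 →
      ‖x - y‖ ^ p + 2 ^ p / c * ‖(1 / 2 : ℝ) • (x + y)‖ ^ p ≤
      ε * (‖x‖ ^ p + ‖y‖ ^ p) + 2 ^ p / c * ((‖x‖ ^ p + ‖y‖ ^ p) / 2) := by
    intro x y h
    by_cases hxy : ε ≤ ‖x - y‖ ^ p
    · have h1 := hcK (x, y) ⟨h, hxy⟩
      simp only at h1
      have h2 : ‖x - y‖ ^ p ≤ 2 ^ p := by
        have := hbd (x, y) h
        have h3 := norm_sub_le x y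
        gcongr
        simp only at this
        linarith
      have h3 : 2 ^ p / c * c ≤ 2 ^ p / c * ((‖x‖ ^ p + ‖y‖ ^ p) / 2
        - ‖(1 / 2 : ℝ) • (x + y)‖ ^ p) := by gcongr
      rw [div_mul_cancel₀ _ hc.ne'] at h3
      rw [h] at *
      linarith
    · have h1 := norm_midpoint_rpow_le hp x y
      have h3 : 2 ^ p / c * ‖(1 / 2 : ℝ) • (x + y)‖ ^ p ≤
        2 ^ p / c * ((‖x‖ ^ p + ‖y‖ ^ p) / 2) := by gcongr
      rw [h] at *
      linarith
  set t : ℝ := (‖x‖ ^ p + ‖y‖ ^ p) ^ (1 / p) with ht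
  have hs : 0 ≤ ‖x‖ ^ p + ‖y‖ ^ p := by positivity
  have htp : t ^ p = ‖x‖ ^ p + ‖y‖ ^ p := by
    rw [ht, ← Real.rpow_mul hs, one_div_mul_cancel hp0.ne', Real.rpow_one]
  rcases hs.eq_or_lt with h0 | h0
  · have hx : ‖x‖ ^ p = 0 := le_antisymm (by have : 0 ≤ ‖y‖ ^ p := by positivity
                                             linarith) (by positivity)
    have hy : ‖y‖ ^ p = 0 := by linarith
    rw [Real.rpow_eq_zero (norm_nonneg _) hp0.ne', norm_eq_zero] at hx hy
    simp [hx, hy, Real.zero_rpow hp0.ne']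
  · have ht0 : 0 < t := by rw [ht]; positivity
    have hsc : ∀ z : E, ‖z‖ ^ p = t ^ p * ‖t⁻¹ • z‖ ^ p := by
      intro z
      rw [← Real.mul_rpow ht0.le (norm_nonneg _), norm_smul, Real.norm_of_nonneg (by positivity),
        mul_inv_cancel_left₀ ht0.ne']
    have htp0 : 0 < t ^ p := by positivity
    have h1 := key (t⁻¹ • x) (t⁻¹ • y) (by
      have hx := hsc x
      have hy := hsc y
      have : t ^ p * (‖t⁻¹ • x‖ ^ p + ‖t⁻¹ • y‖ ^ p) = t ^ p * 1 := by
        rw [mul_add, ← hx, ← hy, htp, mul_one]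
      exact mul_left_cancel₀ htp0.ne' this)
    rw [← smul_sub, ← smul_add, smul_comm] at h1
    have h2 := mul_le_mul_of_nonneg_left h1 htp0.le
    rw [hsc x, hsc y, hsc (x - y), hsc ((1 / 2 : ℝ) • (x + y))]
    linarith

variable [FiniteDimensional ℝ E] {α : Type*} [MeasurableSpace α] {μ : Measure α} {p : ℝ}

lemma Lp_norm_rpow_eq_integral (hp : 1 < p) (f : Lp E (ENNReal.ofReal p) μ) :
    ‖f‖ ^ p = ∫ x, ‖f x‖ ^ p ∂μ := by
  have hp0 : 0 < p := by linarith
  rw [Lp.norm_def, MemLp.eLpNorm_eq_integral_rpow_norm (by simpa using hp0) (by simp) (Lp.memLp f),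
    ENNReal.toReal_ofReal hp0.le]
  have : 0 ≤ ∫ x, ‖f x‖ ^ p ∂μ := integral_nonneg fun x => by positivity
  rw [ENNReal.toReal_ofReal (by positivity), ← Real.rpow_mul this, inv_mul_cancel₀ hp0.ne',
    Real.rpow_one]

lemma Lp_integrable_norm_rpow (hp : 1 < p) (f : Lp E (ENNReal.ofReal p) μ) :
    Integrable (fun x => ‖f x‖ ^ p) μ := by
  have hp0 : 0 < p := by linarith
  simpa [ENNReal.toReal_ofReal hp0.le] using
    (Lp.memLp f).integrable_norm_rpow (by simpa using hp0) (by simp)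

/-- A quantitative form of the strict convexity of `f ↦ ‖f‖ ^ p` on `L^p`. -/
lemma Lp_exists_norm_sub_rpow_le (hp : 1 < p) {ε : ℝ} (hε : 0 < ε) :
    ∃ C : ℝ, 0 ≤ C ∧ ∀ f g : Lp E (ENNReal.ofReal p) μ,
      ‖f - g‖ ^ p + C * ‖(1 / 2 : ℝ) • (f + g)‖ ^ p ≤
      ε * (‖f‖ ^ p + ‖g‖ ^ p) + C * ((‖f‖ ^ p + ‖g‖ ^ p) / 2) := by
  -- C does not depend on the vectors, so the pointwise inequality can be integrated.
  obtain ⟨C, hC, h⟩ := exists_norm_sub_rpow_le (E := E) hp hε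
  refine ⟨C, hC, fun f g => ?_⟩
  have hi := Lp_integrable_norm_rpow (E := E) (μ := μ) hp
  simp only [Lp_norm_rpow_eq_integral hp]
  have hs : Integrable (fun x => ‖f x‖ ^ p + ‖g x‖ ^ p) μ := (hi f).add (hi g)
  rw [← integral_const_mul, ← integral_add (hi _) ((hi _).const_mul _),
    ← integral_add (hi f) (hi g), ← integral_const_mul, ← integral_div, ← integral_const_mul,
    ← integral_add (hs.const_mul _) ((hs.div_const 2).const_mul _)]
  refine integral_mono_ae ((hi _).add ((hi _).const_mul _))
    ((hs.const_mul _).add ((hs.div_const 2).const_mul _)) ?_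
  filter_upwards [Lp.coeFn_sub f g, Lp.coeFn_add f g, Lp.coeFn_smul (1 / 2 : ℝ) (f + g)]
    with x h1 h2 h3
  simp only [h1, h3, Pi.smul_apply, h2, Pi.add_apply, Pi.sub_apply]
  exact h _ _

/-- With no convexity gap, the terms with C cancel and ‖f - g‖^p ≤ ε (‖f‖^p + ‖g‖^p) remains for
every ε > 0. -/
lemma Lp_eq_of_norm_midpoint_rpow (hp : 1 < p) [Fact (1 ≤ ENNReal.ofReal p)]
    {f g : Lp E (ENNReal.ofReal p) μ}
    (h : (‖f‖ ^ p + ‖g‖ ^ p) / 2 ≤ ‖(1 / 2 : ℝ) • (f + g)‖ ^ p) : f = g := by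
  have hp0 : 0 < p := by linarith
  have h0 : ‖f - g‖ ^ p ≤ 0 := by
    refine le_of_forall_pos_le_add fun δ hδ => ?_
    have hs : 0 < ‖f‖ ^ p + ‖g‖ ^ p + 1 := by positivity
    obtain ⟨C, hC, hh⟩ := Lp_exists_norm_sub_rpow_le (E := E) (μ := μ) hp
      (div_pos hδ hs)
    have h1 := hh f g
    have h2 := mul_le_mul_of_nonneg_left h hC
    have h3 : δ / (‖f‖ ^ p + ‖g‖ ^ p + 1) * (‖f‖ ^ p + ‖g‖ ^ p) ≤ δ := by
      rw [div_mul_eq_mul_div, div_le_iff₀ hs]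
      nlinarith
    linarith
  have h1 : ‖f - g‖ ^ p = 0 := le_antisymm h0 (by positivity)
  rw [Real.rpow_eq_zero (norm_nonneg _) hp0.ne', norm_eq_zero] at h1
  exact sub_eq_zero.1 h1

/-- In `L^p`, from a decreasing sequence of midpoint convex sets which all meet a fixed ball one
can select a convergent sequence. -/
lemma Lp_exists_convergent_selection (hp : 1 < p) [Fact (1 ≤ ENNReal.ofReal p)]
    (C : ℕ → Set (Lp E (ENNReal.ofReal p) μ)) (hanti : Antitone C)
    (hmid : ∀ n, ∀ f ∈ C n, ∀ g ∈ C n, (1 / 2 : ℝ) • (f + g) ∈ C n) (R : ℝ)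
    (hR : ∀ n, ∃ f ∈ C n, ‖f‖ ≤ R) :
    ∃ y : ℕ → Lp E (ENNReal.ofReal p) μ, (∀ n, y n ∈ C n) ∧ ∃ l, Tendsto y atTop (𝓝 l) := by
  have hp0 : 0 < p := by linarith
  -- The infima r n increase with n and stay below R^p, so they converge. Almost minimizers y n form
  -- a Cauchy sequence: for n ≥ N the midpoint of y n and y N lies in C N, so its p-th power is at
  -- least r N and the convexity gap is small.
  let r : ℕ → ℝ := fun n => sInf ((fun f => ‖f‖ ^ p) '' C n)
  have hbdd : ∀ n, BddBelow ((fun f => ‖f‖ ^ p) '' C n) := fun n =>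
    ⟨0, by rintro _ ⟨f, -, rfl⟩; positivity⟩
  have hne : ∀ n, ((fun f => ‖f‖ ^ p) '' C n).Nonempty := fun n => by
    obtain ⟨f, hf, -⟩ := hR n
    exact ⟨_, f, hf, rfl⟩
  have hrle : ∀ n, ∀ f ∈ C n, r n ≤ ‖f‖ ^ p := fun n f hf => csInf_le (hbdd n) ⟨f, hf, rfl⟩
  have hmono : Monotone r := fun n m hnm =>
    csInf_le_csInf (hbdd n) (hne m) (image_mono (hanti hnm))
  have hrR : ∀ n, r n ≤ R ^ p := fun n => by
    obtain ⟨f, hf, hfR⟩ := hR n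
    exact (hrle n f hf).trans (by gcongr)
  have hr0 : ∀ n, 0 ≤ r n := fun n => le_csInf (hne n) (by rintro _ ⟨f, -, rfl⟩; positivity)
  have hchoose : ∀ n : ℕ, ∃ f ∈ C n, ‖f‖ ^ p < r n + 1 / ((n : ℝ) + 1) := fun n => by
    obtain ⟨_, ⟨f, hf, rfl⟩, h⟩ := exists_lt_of_csInf_lt (hne n)
      (show r n < r n + 1 / ((n : ℝ) + 1) by have : 0 < 1 / ((n : ℝ) + 1) := by positivity
                                             linarith)
    exact ⟨f, hf, h⟩
  choose y hyC hy using hchoose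
  refine ⟨y, hyC, ?_⟩
  obtain ⟨r₀, hr₀⟩ : ∃ r₀, Tendsto r atTop (𝓝 r₀) :=
    ⟨_, tendsto_atTop_ciSup hmono ⟨R ^ p, by rintro _ ⟨n, rfl⟩; exact hrR n⟩⟩
  have hrr₀ : ∀ n, r n ≤ r₀ := hmono.ge_of_tendsto hr₀
  have hlim : Tendsto (fun n : ℕ => r₀ - r n + 1 / ((n : ℝ) + 1)) atTop (𝓝 0) := by
    simpa using ((tendsto_const_nhds (x := r₀)).sub hr₀).add
      tendsto_one_div_add_atTop_nhds_zero_nat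
  refine cauchySeq_tendsto_of_complete (Metric.cauchySeq_iff'.2 fun δ hδ => ?_)
  -- B bounds ‖y n‖^p + ‖y N‖^p, so the choice ε = δ^p / (2B) makes the ε-term at most δ^p / 2. The
  -- gap term receives the other half; K + 1 is used because K may be zero.
  set B : ℝ := 2 * (r₀ + 1) with hB
  have hr₀0 : 0 ≤ r₀ := (hr0 0).trans (hrr₀ 0)
  have hB0 : 0 < B := by positivity
  have hδp : 0 < δ ^ p := by positivity
  obtain ⟨K, hK, hh⟩ := Lp_exists_norm_sub_rpow_le (E := E) (μ := μ) hp
    (show 0 < δ ^ p / (2 * B) by positivity)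
  obtain ⟨N, hN⟩ := (hlim.eventually (gt_mem_nhds
    (show 0 < δ ^ p / (2 * (K + 1)) by positivity))).exists
  refine ⟨N, fun n hn => ?_⟩
  have h1 := hh (y n) (y N)
  have h2 : r N ≤ ‖(1 / 2 : ℝ) • (y n + y N)‖ ^ p :=
    hrle N _ (hmid N _ (hanti hn (hyC n)) _ (hyC N))
  have h3 : 1 / ((n : ℝ) + 1) ≤ 1 / ((N : ℝ) + 1) := by
    have : (N : ℝ) ≤ n := by exact_mod_cast hn
    gcongr
  have h3' : 1 / ((N : ℝ) + 1) ≤ 1 := by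
    rw [div_le_one (by positivity)]
    have : (0 : ℝ) ≤ N := by positivity
    linarith
  have h4 := hy n
  have h5 := hy N
  have h6 : ‖y n‖ ^ p + ‖y N‖ ^ p ≤ B := by linarith [hrr₀ n, hrr₀ N]
  have h7 : (‖y n‖ ^ p + ‖y N‖ ^ p) / 2 ≤ r N + (r₀ - r N + 1 / ((N : ℝ) + 1)) := by
    linarith [hrr₀ n, hrr₀ N]
  have h8 : δ ^ p / (2 * B) * (‖y n‖ ^ p + ‖y N‖ ^ p) ≤ δ ^ p / 2 := by
    calc _ ≤ δ ^ p / (2 * B) * B := by gcongr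
      _ = _ := by field_simp
  have h9 : K * (r₀ - r N + 1 / ((N : ℝ) + 1)) < δ ^ p / 2 := by
    have : 0 < K + 1 := by positivity
    calc _ ≤ K * (δ ^ p / (2 * (K + 1))) := by gcongr
      _ < (K + 1) * (δ ^ p / (2 * (K + 1))) := by gcongr; linarith
      _ = _ := by field_simp
  have h10 := mul_le_mul_of_nonneg_left h7 hK
  have h11 := mul_le_mul_of_nonneg_left h2 hK
  have h12 : ‖y n - y N‖ ^ p < δ ^ p := by
    rw [mul_add] at h10
    linarith
  rw [dist_eq_norm]
  exact (Real.rpow_lt_rpow_iff (norm_nonneg _) hδ.le hp0).1 h12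

end UniformConvexity

/-! ### Polar coordinates for functions of the norm -/

section Polar

variable {E : Type*} [NormedAddCommGroup E] [NormedSpace ℝ E] [FiniteDimensional ℝ E]
  [Nontrivial E] [MeasurableSpace E] [BorelSpace E] (μ : Measure E) [μ.IsAddHaarMeasure]
  {F : Type*} [NormedAddCommGroup F] [NormedSpace ℝ F]

local notation "dim" => Module.finrank ℝ

lemma lintegral_fun_norm_addHaar_of_measurable {f : ℝ → ℝ≥0∞} (hf : Measurable f) :
    ∫⁻ x, f ‖x‖ ∂μ = μ.toSphere univ *
      ∫⁻ r in Ioi (0 : ℝ), ENNReal.ofReal (r ^ (dim E - 1)) * f r :=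
  calc
    ∫⁻ x, f ‖x‖ ∂μ = ∫⁻ x : ({(0)}ᶜ : Set E), f ‖x.1‖ ∂(μ.comap (↑)) := by
      rw [lintegral_subtype_comap (measurableSet_singleton _).compl fun x ↦ f ‖x‖,
        restrict_compl_singleton]
    _ = ∫⁻ x, f x.2 ∂μ.toSphere.prod (.volumeIoiPow (dim E - 1)) := by
      simpa using μ.measurePreserving_homeomorphUnitSphereProd.lintegral_comp_emb
        (Homeomorph.measurableEmbedding _) (f ∘ Subtype.val ∘ Prod.snd)
    _ = μ.toSphere univ * ∫⁻ x : Ioi (0 : ℝ), f x ∂.volumeIoiPow (dim E - 1) := by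
      rw [lintegral_prod _ (by fun_prop), mul_comm]
      simp only [lintegral_const]
    _ = _ := by
      rw [Measure.volumeIoiPow, lintegral_withDensity_eq_lintegral_mul _ (by fun_prop)
        (by fun_prop)]
      congr 1
      exact lintegral_subtype_comap measurableSet_Ioi
        fun r => ENNReal.ofReal (r ^ (dim E - 1)) * f r

/-- The norm pulls Lebesgue null sets of the half-line back to null sets. -/
lemma quasiMeasurePreserving_norm :
    Measure.QuasiMeasurePreserving (fun x : E => ‖x‖) μ (volume.restrict (Ioi (0 : ℝ))) := by
  refine ⟨measurable_norm, Measure.AbsolutelyContinuous.mk fun s hs h => ?_⟩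
  rw [Measure.map_apply measurable_norm hs]
  have h1 := lintegral_fun_norm_addHaar_of_measurable μ
    (f := s.indicator 1) (measurable_one.indicator hs)
  have h2 : ∫⁻ x : E, s.indicator (1 : ℝ → ℝ≥0∞) ‖x‖ ∂μ = μ ((fun x => ‖x‖) ⁻¹' s) := by
    rw [← lintegral_indicator_one (measurable_norm hs)]
    rfl
  have h3 : ∫⁻ r in Ioi (0 : ℝ), ENNReal.ofReal (r ^ (dim E - 1)) * s.indicator 1 r = 0 := by
    rw [lintegral_eq_zero_iff' (by fun_prop (disch := assumption))]
    have : ∀ᵐ r ∂volume.restrict (Ioi (0 : ℝ)), r ∉ s := by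
      rw [ae_iff]; simpa using h
    filter_upwards [this] with r hr
    simp [hr]
  rw [← h2, h1, h3, mul_zero]

lemma ae_norm_of_ae {P : ℝ → Prop} (h : ∀ᵐ r ∂volume.restrict (Ioi (0 : ℝ)), P r) :
    ∀ᵐ x : E ∂μ, P ‖x‖ :=
  (quasiMeasurePreserving_norm μ).ae h

lemma lintegral_fun_norm_addHaar {f : ℝ → ℝ≥0∞}
    (hf : AEMeasurable f (volume.restrict (Ioi (0 : ℝ)))) :
    ∫⁻ x, f ‖x‖ ∂μ = μ.toSphere univ *
      ∫⁻ r in Ioi (0 : ℝ), ENNReal.ofReal (r ^ (dim E - 1)) * f r := by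
  rw [lintegral_congr_ae (ae_norm_of_ae μ hf.ae_eq_mk),
    lintegral_fun_norm_addHaar_of_measurable μ hf.measurable_mk]
  congr 1
  refine lintegral_congr_ae ?_
  filter_upwards [hf.ae_eq_mk] with r hr
  rw [hr]

lemma setLIntegral_fun_norm_addHaar {A : Set ℝ} (hA : MeasurableSet A) (hA0 : A ⊆ Ioi 0)
    {f : ℝ → ℝ≥0∞} (hf : AEMeasurable f (volume.restrict A)) :
    ∫⁻ x in {x : E | ‖x‖ ∈ A}, f ‖x‖ ∂μ = μ.toSphere univ *
      ∫⁻ r in A, ENNReal.ofReal (r ^ (dim E - 1)) * f r := by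
  have h1 : AEMeasurable (A.indicator f) (volume.restrict (Ioi (0 : ℝ))) :=
    ((aemeasurable_indicator_iff hA).2 hf).restrict
  have h2 := lintegral_fun_norm_addHaar μ h1
  rw [← lintegral_indicator (show MeasurableSet {x : E | ‖x‖ ∈ A} from measurable_norm hA)]
  refine Eq.trans rfl (h2.trans ?_)
  congr 1
  rw [← inter_eq_self_of_subset_left hA0, ← Measure.restrict_restrict hA,
    ← lintegral_indicator hA]
  refine lintegral_congr fun r => ?_
  by_cases hr : r ∈ A
  · simp [hr, hA0 hr]
  · simp [hr]

lemma toSphere_univ_ne_top : μ.toSphere univ ≠ ⊤ := measure_ne_top _ _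

lemma toSphere_univ_ne_zero : μ.toSphere univ ≠ 0 := by
  rw [Measure.toSphere_apply_univ]
  simp only [ne_eq, mul_eq_zero, Nat.cast_eq_zero, not_or]
  exact ⟨Module.finrank_pos.ne', (Metric.measure_ball_pos μ 0 one_pos).ne'⟩

lemma integral_fun_norm_addHaar_toSphere (f : ℝ → F) :
    ∫ x, f ‖x‖ ∂μ = μ.toSphere.real univ • ∫ y in Ioi (0 : ℝ), y ^ (dim E - 1) • f y := by
  rw [integral_fun_norm_addHaar, μ.toSphere_real_apply_univ, ← Nat.cast_smul_eq_nsmul ℝ, smul_smul]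

lemma integrableOn_fun_norm_addHaar_iff {A : Set ℝ} (hA : MeasurableSet A) (hA0 : A ⊆ Ioi 0)
    {f : ℝ → F} :
    IntegrableOn (fun x : E => f ‖x‖) {x : E | ‖x‖ ∈ A} μ ↔
      IntegrableOn (fun y : ℝ => y ^ (dim E - 1) • f y) A := by
  have h1 := integrable_fun_norm_addHaar μ (f := A.indicator f)
  rw [← integrable_indicator_iff (show MeasurableSet {x : E | ‖x‖ ∈ A} from measurable_norm hA)]
  refine Iff.trans (Eq.to_iff ?_) (h1.trans ?_)
  · rfl
  rw [← integrable_indicator_iff hA, ← integrable_indicator_iff measurableSet_Ioi]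
  refine Eq.to_iff (congrArg (fun g => Integrable g volume) (funext fun r => ?_))
  by_cases hr : r ∈ A
  · simp [hr, hA0 hr]
  · simp [hr, indicator]

/-- Away from the origin the Jacobian r^(n-1) and its inverse are both bounded on compact sets. -/
lemma integrableOn_fun_norm_iff_of_isCompact {K : Set ℝ} (hK : IsCompact K) (hK0 : K ⊆ Ioi 0)
    {f : ℝ → F} :
    IntegrableOn (fun x : E => f ‖x‖) {x : E | ‖x‖ ∈ K} μ ↔ IntegrableOn f K := by
  rw [integrableOn_fun_norm_addHaar_iff μ hK.measurableSet hK0]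
  constructor
  · intro h
    have h1 := IntegrableOn.continuousOn_smul (f := fun y : ℝ => (y ^ (dim E - 1))⁻¹) h
      (ContinuousOn.inv₀ (by fun_prop) fun y hy => (pow_pos (hK0 hy) _).ne') hK
    refine h1.congr_fun (fun y hy => ?_) hK.measurableSet
    simp only [smul_smul]
    rw [inv_mul_cancel₀ (pow_pos (hK0 hy) _).ne', one_smul]
  · intro h
    exact h.continuousOn_smul (by fun_prop) hK

lemma isCompact_setOf_norm_mem {K : Set ℝ} (hK : IsCompact K) : IsCompact {x : E | ‖x‖ ∈ K} := by
  refine Metric.isCompact_of_isClosed_isBounded (hK.isClosed.preimage continuous_norm) ?_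
  obtain ⟨R, hR⟩ := hK.isBounded.subset_closedBall 0
  refine (Metric.isBounded_closedBall (x := (0 : E)) (r := R)).subset fun x hx => ?_
  have := hR hx
  simpa using this

lemma locallyIntegrableOn_fun_norm_iff {A : Set ℝ} (hA : IsOpen A) (hA0 : A ⊆ Ioi 0)
    {f : ℝ → F} :
    LocallyIntegrableOn (fun x : E => f ‖x‖) {x : E | ‖x‖ ∈ A} μ ↔ LocallyIntegrableOn f A := by
  rw [locallyIntegrableOn_iff
    (show IsLocallyClosed {x : E | ‖x‖ ∈ A} from (hA.preimage continuous_norm).isLocallyClosed),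
    locallyIntegrableOn_iff hA.isLocallyClosed]
  constructor
  · intro h K hKA hK
    rw [← integrableOn_fun_norm_iff_of_isCompact μ hK (hKA.trans hA0)]
    exact h _ (fun x hx => hKA hx) (isCompact_setOf_norm_mem hK)
  · intro h K hKA hK
    have hK' : IsCompact ((fun x : E => ‖x‖) '' K) := hK.image continuous_norm
    have hKA' : (fun x : E => ‖x‖) '' K ⊆ A := by
      rintro _ ⟨x, hx, rfl⟩
      exact hKA hx
    have h1 := (integrableOn_fun_norm_iff_of_isCompact μ hK' (hKA'.trans hA0)).2 (h _ hKA' hK')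
    exact h1.mono_set fun x hx => ⟨x, hx, rfl⟩

end Polar

/-! ### Calculus of weak gradients -/

namespace RadialWeight

section WeakGradient

open Filter

lemma integrable_smul_of_tsupport_subset {E F : Type*} [NormedAddCommGroup E]
    [NormedSpace ℝ E] [FiniteDimensional ℝ E] [MeasurableSpace E] [BorelSpace E]
    [NormedAddCommGroup F] [NormedSpace ℝ F] {μ : Measure E} {U : Set E} {f : E → F}
    (hf : LocallyIntegrableOn f U μ) {φ : E → ℝ} (hφ : Continuous φ) (hc : HasCompactSupport φ)
    (hs : tsupport φ ⊆ U) : Integrable (fun x => φ x • f x) μ := by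
  have h1 : IntegrableOn f (tsupport φ) μ := hf.integrableOn_compact_subset hs hc
  have h2 : IntegrableOn (fun x => φ x • f x) (tsupport φ) μ :=
    h1.continuousOn_smul hφ.continuousOn hc
  rwa [integrableOn_iff_integrable_of_support_subset] at h2
  intro x hx
  apply subset_tsupport
  intro h
  simp [h] at hx

variable {E : Type*} [NormedAddCommGroup E] [InnerProductSpace ℝ E] [FiniteDimensional ℝ E]
  [MeasureSpace E] [BorelSpace E] {U : Set E} {u u' : E → ℝ} {G G' : E → E}

lemma tsupport_fderiv_apply_subset {φ : E → ℝ} (e : E) :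
    tsupport (fun x => fderiv ℝ φ x e) ⊆ tsupport φ := by
  refine Subset.trans (closure_mono fun x hx => ?_) (tsupport_fderiv_subset ℝ (f := φ))
  intro h
  simp [h] at hx

lemma hasCompactSupport_fderiv_apply {φ : E → ℝ} (h : HasCompactSupport φ) (e : E) :
    HasCompactSupport (fun x => fderiv ℝ φ x e) :=
  h.of_isClosed_subset (isClosed_tsupport _) (tsupport_fderiv_apply_subset e)

lemma continuous_fderiv_apply_of_contDiff {φ : E → ℝ} (h : ContDiff ℝ ∞ φ) (e : E) :
    Continuous (fun x => fderiv ℝ φ x e) :=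
  (h.continuous_fderiv (by simp)).clm_apply continuous_const

lemma LocallyIntegrableOn.inner_const {μ : Measure E} (h : LocallyIntegrableOn G U μ) (e : E) :
    LocallyIntegrableOn (fun x => inner ℝ (G x) e) U μ := fun x hx => by
  obtain ⟨s, hs, h'⟩ := h x hx
  exact ⟨s, hs, h'.inner_const e⟩

lemma integrable_mul_fderiv (hu : LocallyIntegrableOn u U) {φ : E → ℝ} (hφ : ContDiff ℝ ∞ φ)
    (hc : HasCompactSupport φ) (hs : tsupport φ ⊆ U) (e : E) :
    Integrable fun x => u x * fderiv ℝ φ x e := by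
  have := integrable_smul_of_tsupport_subset hu (continuous_fderiv_apply_of_contDiff hφ e)
    (hasCompactSupport_fderiv_apply hc e) ((tsupport_fderiv_apply_subset e).trans hs)
  simpa [mul_comm] using this

lemma integrable_inner_mul (hG : LocallyIntegrableOn G U) {φ : E → ℝ} (hφ : Continuous φ)
    (hc : HasCompactSupport φ) (hs : tsupport φ ⊆ U) (e : E) :
    Integrable fun x => inner ℝ (G x) e * φ x := by
  have := integrable_smul_of_tsupport_subset (LocallyIntegrableOn.inner_const hG e) hφ hc hs
  simpa [mul_comm] using this

lemma integral_congr_of_ae_restrict {f g : E → ℝ} {φ : E → ℝ} (hU : MeasurableSet U)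
    (h : f =ᵐ[volume.restrict U] g) (hs : Function.support φ ⊆ U) :
    ∫ x, f x * φ x = ∫ x, g x * φ x := by
  refine integral_congr_ae ?_
  filter_upwards [(ae_restrict_iff' hU).1 h] with x hx
  by_cases hxU : x ∈ U
  · simp only [hx hxU]
  · have : φ x = 0 := by
      by_contra h
      exact hxU (hs h)
    simp [this]

lemma LocallyIntegrableOn.congr_ae_restrict {F : Type*} [NormedAddCommGroup F] {f g : E → F}
    (hU : IsOpen U) (hf : LocallyIntegrableOn f U) (hfg : f =ᵐ[volume.restrict U] g) :
    LocallyIntegrableOn g U := by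
  rw [locallyIntegrableOn_iff hU.isLocallyClosed] at hf ⊢
  intro K hK hKc
  exact (hf K hK hKc).congr (ae_restrict_of_ae_restrict_of_subset hK hfg)

lemma LocallyIntegrableOn.comp_isometry {F : Type*} [NormedAddCommGroup F] {f : E → F}
    (hU : IsOpen U) (R : E ≃ₗᵢ[ℝ] E) (hR : MeasurePreserving R) (hRU : R ⁻¹' U = U)
    (hf : LocallyIntegrableOn f U) : LocallyIntegrableOn (f ∘ R) U := by
  rw [locallyIntegrableOn_iff hU.isLocallyClosed] at hf ⊢
  intro K hK hKc
  have h1 := hf (R '' K) (by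
    rintro _ ⟨x, hx, rfl⟩
    have := hK hx
    rw [← hRU] at this
    exact this) (hKc.image R.continuous)
  rwa [← hR.integrableOn_image R.toHomeomorph.measurableEmbedding]

lemma HasWeakGradientOn.congr (hU : IsOpen U) (h : HasWeakGradientOn U u G)
    (hu : u =ᵐ[volume.restrict U] u') (hG : G =ᵐ[volume.restrict U] G') :
    HasWeakGradientOn U u' G' := by
  obtain ⟨h1, h2, h3⟩ := h
  refine ⟨LocallyIntegrableOn.congr_ae_restrict hU h1 hu,
    LocallyIntegrableOn.congr_ae_restrict hU h2 hG, fun φ hφ hc hs e => ?_⟩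
  have hsupp : Function.support φ ⊆ U := (subset_tsupport φ).trans hs
  have hsupp' : Function.support (fun x => fderiv ℝ φ x e) ⊆ U :=
    (subset_tsupport _).trans ((tsupport_fderiv_apply_subset e).trans hs)
  have h4 : (fun x => inner ℝ (G x) e) =ᵐ[volume.restrict U] fun x => inner ℝ (G' x) e := by
    filter_upwards [hG] with x hx
    rw [hx]
  rw [← integral_congr_of_ae_restrict hU.measurableSet hu hsupp', h3 φ hφ hc hs e,
    integral_congr_of_ae_restrict hU.measurableSet h4 hsupp]

lemma HasWeakGradientOn.add (h : HasWeakGradientOn U u G) (h' : HasWeakGradientOn U u' G') :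
    HasWeakGradientOn U (u + u') (G + G') := by
  refine ⟨h.1.add h'.1, h.2.1.add h'.2.1, fun φ hφ hc hs e => ?_⟩
  simp only [Pi.add_apply, add_mul, inner_add_left]
  rw [integral_add (integrable_mul_fderiv h.1 hφ hc hs e) (integrable_mul_fderiv h'.1 hφ hc hs e),
    integral_add (integrable_inner_mul h.2.1 hφ.continuous hc hs e)
      (integrable_inner_mul h'.2.1 hφ.continuous hc hs e),
    h.2.2 φ hφ hc hs e, h'.2.2 φ hφ hc hs e]
  ring

lemma HasWeakGradientOn.const_smul (c : ℝ) (h : HasWeakGradientOn U u G) :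
    HasWeakGradientOn U (c • u) (c • G) := by
  refine ⟨h.1.smul c, h.2.1.smul c, fun φ hφ hc hs e => ?_⟩
  simp only [Pi.smul_apply, smul_eq_mul, mul_assoc, inner_smul_left]
  rw [integral_const_mul, h.2.2 φ hφ hc hs e]
  simp only [conj_trivial]
  rw [integral_const_mul]
  ring

/-- The vector-valued fundamental lemma is applied to G - G'; the required vanishing of ∫ φ (G - G')
is checked after pairing with each direction e. -/
lemma HasWeakGradientOn.ae_unique (hU : IsOpen U) (h : HasWeakGradientOn U u G)
    (h' : HasWeakGradientOn U u G') : G =ᵐ[volume.restrict U] G' := by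
  have key := hU.ae_eq_zero_of_integral_contDiff_smul_eq_zero (h.2.1.sub h'.2.1)
    (fun φ hφ hc hs => by
      have hi := integrable_smul_of_tsupport_subset (h.2.1.sub h'.2.1) hφ.continuous hc hs
      refine ext_inner_right ℝ fun e => ?_
      rw [real_inner_comm, ← integral_inner hi, inner_zero_left]
      have h1 := h.2.2 φ hφ hc hs e
      rw [h'.2.2 φ hφ hc hs e, neg_inj] at h1
      have h2 := sub_eq_zero.2 h1.symm
      rw [← integral_sub (integrable_inner_mul h.2.1 hφ.continuous hc hs e)
        (integrable_inner_mul h'.2.1 hφ.continuous hc hs e)] at h2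
      rw [← h2]
      refine integral_congr_ae (Eventually.of_forall fun x => ?_)
      simp only [Pi.sub_apply, inner_smul_right, inner_sub_right]
      rw [real_inner_comm, real_inner_comm (G' x)]
      ring)
  rw [EventuallyEq, ae_restrict_iff' hU.measurableSet]
  filter_upwards [key] with x hx hxU
  exact sub_eq_zero.1 (hx hxU)

/-- Only the compact support of φ enters, and φ is bounded there. -/
lemma tendsto_integral_mul_of_tendsto_lintegral {f : ℕ → E → ℝ} {g : E → ℝ}
    (hf : ∀ n, LocallyIntegrableOn (f n) U) (hg : LocallyIntegrableOn g U)
    (hlim : ∀ K ⊆ U, IsCompact K → Tendsto (fun n => ∫⁻ x in K, ‖f n x - g x‖ₑ) atTop (𝓝 0))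
    {φ : E → ℝ} (hφ : Continuous φ) (hc : HasCompactSupport φ) (hs : tsupport φ ⊆ U) :
    Tendsto (fun n => ∫ x, f n x * φ x) atTop (𝓝 (∫ x, g x * φ x)) := by
  have hint {f : E → ℝ} (hf : LocallyIntegrableOn f U) : Integrable fun x => f x * φ x := by
    simpa [mul_comm] using integrable_smul_of_tsupport_subset hf hφ hc hs
  refine tendsto_integral_of_L1 _ (hint hg).aestronglyMeasurable
    (Eventually.of_forall fun n => hint (hf n)) ?_
  obtain ⟨C, hC⟩ := hc.exists_bound_of_continuous hφ
  have h1 := ENNReal.Tendsto.const_mul (a := ENNReal.ofReal C) (hlim _ hs hc)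
    (Or.inr ENNReal.ofReal_ne_top)
  rw [mul_zero] at h1
  refine tendsto_of_tendsto_of_tendsto_of_le_of_le tendsto_const_nhds h1
    (fun _ => zero_le) fun n => ?_
  simp only
  rw [← lintegral_const_mul' _ _ ENNReal.ofReal_ne_top,
    ← lintegral_indicator hc.isClosed.measurableSet]
  refine lintegral_mono fun x => ?_
  by_cases hx : x ∈ tsupport φ
  · rw [indicator_of_mem hx, ← sub_mul, enorm_mul, mul_comm]
    gcongr
    rw [← ofReal_norm]
    exact ENNReal.ofReal_le_ofReal (hC x)
  · simp [image_eq_zero_of_notMem_tsupport hx]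

/-- Weak gradients pass to limits in `L¹_loc`. -/
lemma HasWeakGradientOn.of_tendsto {v : ℕ → E → ℝ} {V : ℕ → E → E}
    (h : ∀ n, HasWeakGradientOn U (v n) (V n))
    (hu : LocallyIntegrableOn u U) (hG : LocallyIntegrableOn G U)
    (hv : ∀ K ⊆ U, IsCompact K → Tendsto (fun n => ∫⁻ x in K, ‖v n x - u x‖ₑ) atTop (𝓝 0))
    (hV : ∀ K ⊆ U, IsCompact K → Tendsto (fun n => ∫⁻ x in K, ‖V n x - G x‖ₑ) atTop (𝓝 0)) :
    HasWeakGradientOn U u G := by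
  refine ⟨hu, hG, fun φ hφ hc hs e => ?_⟩
  have h1 := tendsto_integral_mul_of_tendsto_lintegral (fun n => (h n).1) hu hv
    (continuous_fderiv_apply_of_contDiff hφ e) (hasCompactSupport_fderiv_apply hc e)
    ((tsupport_fderiv_apply_subset e).trans hs)
  have h2 := tendsto_integral_mul_of_tendsto_lintegral
    (fun n => LocallyIntegrableOn.inner_const (h n).2.1 e)
    (LocallyIntegrableOn.inner_const hG e) (fun K hK hKc => by
      have h1 := ENNReal.Tendsto.mul_const (b := ‖e‖ₑ) (hV K hK hKc) (Or.inr enorm_ne_top)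
      rw [zero_mul] at h1
      refine tendsto_of_tendsto_of_tendsto_of_le_of_le tendsto_const_nhds h1
        (fun _ => zero_le) fun n => ?_
      simp only
      rw [← lintegral_mul_const' _ _ enorm_ne_top]
      refine lintegral_mono fun x => ?_
      rw [← inner_sub_left]
      simp only [← ofReal_norm]
      rw [← ENNReal.ofReal_mul (norm_nonneg _)]
      exact ENNReal.ofReal_le_ofReal (norm_inner_le_norm _ _)) hφ.continuous hc hs
  refine tendsto_nhds_unique h1 (h2.neg.congr fun n => ?_)
  rw [(h n).2.2 φ hφ hc hs e]

/-- Change variables by R: testing u ∘ R with φ in direction e amounts to testing u with φ ∘ R⁻¹ in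
direction R e. -/
lemma HasWeakGradientOn.comp_isometry (hU : IsOpen U) (h : HasWeakGradientOn U u G) (R : E ≃ₗᵢ[ℝ] E)
    (hR : MeasurePreserving R) (hRU : R ⁻¹' U = U) :
    HasWeakGradientOn U (u ∘ R) (fun x => R.symm (G (R x))) := by
  have hemb : MeasurableEmbedding R := R.toHomeomorph.measurableEmbedding
  refine ⟨LocallyIntegrableOn.comp_isometry hU R hR hRU h.1, ?_, fun φ hφ hc hs e => ?_⟩
  · have h1 := LocallyIntegrableOn.comp_isometry hU R hR hRU h.2.1
    rw [locallyIntegrableOn_iff hU.isLocallyClosed] at h1 ⊢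
    intro K hK hKc
    exact R.symm.toContinuousLinearEquiv.toContinuousLinearMap.integrable_comp (h1 K hK hKc)
  · have h1 := h.2.2 (φ ∘ R.symm) (hφ.comp R.symm.contDiff)
      (hc.comp_homeomorph R.symm.toHomeomorph) (by
        have : tsupport (φ ∘ R.symm) = R.symm ⁻¹' tsupport φ :=
          tsupport_comp_eq_preimage φ R.symm.toHomeomorph
        rw [this]
        intro x hx
        have h2 : R.symm x ∈ U := hs hx
        rw [← hRU] at h2
        simpa using h2) (R e)
    rw [← hR.integral_comp hemb fun y => u y * fderiv ℝ (φ ∘ R.symm) y (R e),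
      ← hR.integral_comp hemb fun y => inner ℝ (G y) (R e) * (φ ∘ R.symm) y] at h1
    have h2 : ∀ x, fderiv ℝ (φ ∘ R.symm) (R x) (R e) = fderiv ℝ φ x e := by
      intro x
      rw [fderiv_comp _ (hφ.differentiable (by simp) _) R.symm.differentiableAt]
      have : fderiv ℝ (R.symm : E → E) (R x) = R.symm.toContinuousLinearEquiv :=
        R.symm.toContinuousLinearEquiv.fderiv
      simp [this]
    simp only [h2, Function.comp, R.symm_apply_apply] at h1 ⊢
    rw [h1]
    congr 1
    refine integral_congr_ae (Eventually.of_forall fun x => ?_)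
    simp only
    rw [← R.inner_map_map (R.symm (G (R x))) e, R.apply_symm_apply]

end WeakGradient

end RadialWeight

/-! ### Weakly differentiable functions of one variable -/

namespace RadialWeight

section OneDimensional

open Filter

lemma HasWeakGradientOn.mono {E : Type*} [NormedAddCommGroup E] [InnerProductSpace ℝ E]
    [MeasureSpace E] {U V : Set E} {u : E → ℝ} {G : E → E} (h : HasWeakGradientOn U u G)
    (hVU : V ⊆ U) : HasWeakGradientOn V u G :=
  ⟨h.1.mono_set hVU, h.2.1.mono_set hVU, fun φ hφ hc hs => h.2.2 φ hφ hc (hs.trans hVU)⟩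

lemma fderiv_apply_eq_deriv_mul (φ : ℝ → ℝ) (x e : ℝ) : fderiv ℝ φ x e = deriv φ x * e := by
  rw [← fderiv_apply_one_eq_deriv, mul_comm, ← smul_eq_mul, ← map_smul]
  simp

/-- An absolutely continuous function is weakly differentiable. -/
lemma hasWeakGradientOn_of_absolutelyContinuous {α β : ℝ} (hαβ : α ≤ β) {v : ℝ → ℝ}
    (hv : AbsolutelyContinuousOnInterval v α β) : HasWeakGradientOn (Ioo α β) v (deriv v) := by
  refine ⟨?_, ?_, fun φ hφ hc hs e => ?_⟩
  · have h1 := hv.continuousOn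
    rw [uIcc_of_le hαβ] at h1
    exact ((h1.integrableOn_Icc).mono_set Ioo_subset_Icc_self).locallyIntegrableOn
  · have h1 := (intervalIntegrable_iff_integrableOn_Ioc_of_le hαβ).1 hv.intervalIntegrable_deriv
    exact (h1.mono_set Ioo_subset_Ioc_self).locallyIntegrableOn
  · have hφac : AbsolutelyContinuousOnInterval φ α β :=
      (hφ.of_le (by simp)).contDiffOn.absolutelyContinuousOnInterval
    have hsub : tsupport φ ⊆ Ioc α β := hs.trans Ioo_subset_Ioc_self
    have h1 := hv.integral_mul_deriv_eq_deriv_mul hφac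
    have hα : φ α = 0 := image_eq_zero_of_notMem_tsupport fun h => lt_irrefl _ (hs h).1
    have hβ : φ β = 0 := image_eq_zero_of_notMem_tsupport fun h => lt_irrefl _ (hs h).2
    rw [hα, hβ, mul_zero, mul_zero, sub_zero, zero_sub,
      intervalIntegral.integral_eq_integral_of_support_subset,
      intervalIntegral.integral_eq_integral_of_support_subset] at h1
    · simp only [fderiv_apply_eq_deriv_mul, ← mul_assoc]
      rw [integral_mul_const, h1, neg_mul, ← integral_mul_const]
      congr 1
      refine integral_congr_ae (Eventually.of_forall fun x => ?_)
      simp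
      ring
    · intro x hx
      refine hsub (subset_tsupport _ fun h => ?_)
      simp [h] at hx
    · intro x hx
      have : x ∈ Function.support (deriv φ) := fun h => by simp [h] at hx
      exact hsub (support_deriv_subset this)

lemma exists_Icc_of_isCompact_subset_Ioo {α β : ℝ} (hαβ : α < β) {K : Set ℝ} (hK : IsCompact K)
    (h : K ⊆ Ioo α β) : ∃ γ δ, α < γ ∧ γ ≤ δ ∧ δ < β ∧ K ⊆ Icc γ δ := by
  rcases K.eq_empty_or_nonempty with rfl | hne
  · exact ⟨(α + β) / 2, (α + β) / 2, by linarith, le_rfl, by linarith, empty_subset _⟩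
  · have h1 := hK.sInf_mem hne
    have h2 := hK.sSup_mem hne
    exact ⟨sInf K, sSup K, (h h1).1, le_csSup hK.bddAbove h1, (h h2).2, fun x hx =>
      ⟨csInf_le hK.bddBelow hx, le_csSup hK.bddAbove hx⟩⟩

/-- The primitive starting to the left of the support vanishes again to its right because the total
mass is zero. -/
lemma exists_primitive_of_integral_eq_zero {α β : ℝ} (hαβ : α < β) {ψ : ℝ → ℝ}
    (hψ : ContDiff ℝ ∞ ψ) (hc : HasCompactSupport ψ) (hs : tsupport ψ ⊆ Ioo α β)
    (h0 : ∫ x, ψ x = 0) :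
    ∃ φ : ℝ → ℝ, ContDiff ℝ ∞ φ ∧ HasCompactSupport φ ∧ tsupport φ ⊆ Ioo α β ∧ deriv φ = ψ := by
  obtain ⟨γ, δ, hγ, hγδ, hδ, hK⟩ := exists_Icc_of_isCompact_subset_Ioo hαβ hc hs
  have hψ0 : ∀ x, x ∉ Icc γ δ → ψ x = 0 := fun x hx =>
    image_eq_zero_of_notMem_tsupport fun h => hx (hK h)
  have hderiv : ∀ x, HasDerivAt (fun x => ∫ t in γ..x, ψ t) (ψ x) x := fun x =>
    hψ.continuous.integral_hasStrictDerivAt γ x |>.hasDerivAt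
  have hd : deriv (fun x => ∫ t in γ..x, ψ t) = ψ := funext fun x => (hderiv x).deriv
  have hsupp : tsupport (fun x => ∫ t in γ..x, ψ t) ⊆ Icc γ δ := by
    refine closure_minimal (fun x hx => ?_) isClosed_Icc
    by_contra hxn
    apply hx
    simp only [mem_Icc, not_and_or, not_le] at hxn
    rcases hxn with hxn | hxn
    · refine (intervalIntegral.integral_congr_ae (g := fun _ => 0)
        (Eventually.of_forall fun t ht => ?_)).trans (by simp)
      rw [uIoc_of_ge hxn.le] at ht
      rcases ht.2.eq_or_lt with h | h
      -- The point γ may belong to the support interval; ψ vanishes there as a limit from the left.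
      · have : Tendsto ψ (𝓝[<] γ) (𝓝 (ψ γ)) := hψ.continuous.continuousWithinAt
        rw [h]
        refine tendsto_nhds_unique this (tendsto_const_nhds.congr' ?_)
        filter_upwards [self_mem_nhdsWithin] with y hy
        exact (hψ0 y fun h => not_lt_of_ge h.1 hy).symm
      · exact hψ0 t fun h' => not_lt_of_ge h'.1 h
    · show ∫ t in γ..x, ψ t = 0
      rw [intervalIntegral.integral_of_le (by linarith), ← h0, ← integral_Icc_eq_integral_Ioc]
      refine setIntegral_eq_integral_of_forall_compl_eq_zero fun t ht => hψ0 t fun h => ht ?_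
      exact ⟨h.1, h.2.trans hxn.le⟩
  refine ⟨fun x => ∫ t in γ..x, ψ t, ?_, isCompact_Icc.of_isClosed_subset (isClosed_tsupport _) hsupp,
    hsupp.trans (Icc_subset_Ioo hγ hδ), hd⟩
  rw [contDiff_infty_iff_deriv, hd]
  exact ⟨fun x => (hderiv x).differentiableAt, hψ⟩

/-- A function on an interval with vanishing weak derivative is constant. -/
lemma ae_eq_const_of_integral_mul_deriv_eq_zero {α β : ℝ} (hαβ : α < β) {f : ℝ → ℝ}
    (hf : LocallyIntegrableOn f (Ioo α β))
    (h : ∀ φ : ℝ → ℝ, ContDiff ℝ ∞ φ → HasCompactSupport φ → tsupport φ ⊆ Ioo α β →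
      ∫ x, f x * deriv φ x = 0) :
    ∃ c, ∀ᵐ x ∂volume.restrict (Ioo α β), f x = c := by
  -- A bump θ of unit mass inside the interval. For any test function φ, the function φ - (∫ φ) θ
  -- has mean zero and is thus the derivative of a test function, so that ∫ f φ = c ∫ φ with c = ∫ f
  -- θ.
  let B : ContDiffBump ((α + β) / 2) :=
    ⟨(β - α) / 8, (β - α) / 4, by linarith, by linarith⟩
  let θ : ℝ → ℝ := B.normed volume
  have hθ : ContDiff ℝ ∞ θ := B.contDiff_normed
  have hθc : HasCompactSupport θ := B.hasCompactSupport_normed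
  have hθs : tsupport θ ⊆ Ioo α β := by
    rw [show tsupport θ = _ from B.tsupport_normed_eq, Real.closedBall_eq_Icc]
    exact Icc_subset_Ioo (by simp only [B]; linarith) (by simp only [B]; linarith)
  have hθ1 : ∫ x, θ x = 1 := B.integral_normed
  set c : ℝ := ∫ x, f x * θ x with hcdef
  refine ⟨c, ?_⟩
  have hint {φ : ℝ → ℝ} (hφ : ContDiff ℝ ∞ φ) (hφc : HasCompactSupport φ)
      (hs : tsupport φ ⊆ Ioo α β) : Integrable fun x => f x * φ x := by
    simpa [mul_comm] using integrable_smul_of_tsupport_subset hf hφ.continuous hφc hs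
  have hcint : LocallyIntegrableOn (fun _ : ℝ => c) (Ioo α β) :=
    (locallyIntegrable_const c).locallyIntegrableOn _
  have key := isOpen_Ioo.ae_eq_zero_of_integral_contDiff_smul_eq_zero (hf.sub hcint)
    (fun φ hφ hφc hs => by
      have hφi : Integrable φ := hφ.continuous.integrable_of_hasCompactSupport hφc
      have hθi : Integrable θ := hθ.continuous.integrable_of_hasCompactSupport hθc
      have hψs : tsupport (fun x => φ x - (∫ y, φ y) * θ x) ⊆ tsupport φ ∪ tsupport θ := by
        refine closure_minimal (fun x hx => ?_)
          ((isClosed_tsupport _).union (isClosed_tsupport _))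
        by_contra hn
        rw [mem_union, not_or] at hn
        simp [image_eq_zero_of_notMem_tsupport hn.1, image_eq_zero_of_notMem_tsupport hn.2] at hx
      obtain ⟨Ψ, h1, h2, h3, h4⟩ := exists_primitive_of_integral_eq_zero hαβ
        (ψ := fun x => φ x - (∫ y, φ y) * θ x) (hφ.sub (contDiff_const.mul hθ))
        ((hφc.isCompact.union hθc.isCompact).of_isClosed_subset (isClosed_tsupport _) hψs)
        (hψs.trans (union_subset hs hθs))
        (by rw [integral_sub hφi (hθi.const_mul _), integral_const_mul, hθ1, mul_one, sub_self])
      have h5 := h Ψ h1 h2 h3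
      rw [h4] at h5
      have h6 : ∫ x, f x * (φ x - (∫ y, φ y) * θ x) = (∫ x, f x * φ x) - (∫ y, φ y) * c := by
        rw [hcdef, ← integral_const_mul, ← integral_sub (hint hφ hφc hs)
          ((hint hθ hθc hθs).const_mul _)]
        congr 1
        ext x
        ring
      have h7 : ∫ x, φ x • (f x - c) = (∫ x, f x * φ x) - (∫ y, φ y) * c := by
        rw [← integral_mul_const, ← integral_sub (hint hφ hφc hs) (hφi.mul_const _)]
        congr 1
        ext x
        simp only [smul_eq_mul]
        ring
      exact h7.trans (h6.symm.trans h5))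
  rw [ae_restrict_iff' measurableSet_Ioo]
  filter_upwards [key] with x hx hxU
  exact sub_eq_zero.1 (hx hxU)

/-- A weakly differentiable function on an interval is a primitive of its weak derivative. -/
lemma HasWeakGradientOn.exists_ae_eq_primitive {α β m : ℝ} (hm : m ∈ Ioo α β) {v G : ℝ → ℝ}
    (h : HasWeakGradientOn (Ioo α β) v G) :
    ∃ c, ∀ᵐ r ∂volume.restrict (Ioo α β), v r = c + ∫ t in m..r, G t := by
  have hαβ : α < β := hm.1.trans hm.2
  have hGi : ∀ γ δ, α < γ → δ < β → γ ≤ δ → IntervalIntegrable G volume γ δ := fun γ δ h1 h2 h3 => by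
    rw [intervalIntegrable_iff_integrableOn_Icc_of_le h3]
    exact h.2.1.integrableOn_compact_subset (Icc_subset_Ioo h1 h2) isCompact_Icc
  have hcont : ContinuousOn (fun r => ∫ t in m..r, G t) (Ioo α β) := by
    intro r hr
    obtain ⟨γ, hγ, hγ'⟩ := exists_between (lt_min hm.1 hr.1)
    obtain ⟨δ, hδ, hδ'⟩ := exists_between (max_lt hm.2 hr.2)
    rw [lt_min_iff] at hγ'
    rw [max_lt_iff] at hδ
    have h1 := (hGi γ δ hγ hδ' (by linarith)).absolutelyContinuousOnInterval_intervalIntegral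
      (c := m) (by rw [uIcc_of_le (by linarith)]; exact ⟨hγ'.1.le, hδ.1.le⟩)
    have h2 := h1.continuousOn
    rw [uIcc_of_le (by linarith)] at h2
    exact (h2.continuousAt (Icc_mem_nhds hγ'.2 hδ.2)).continuousWithinAt
  have hFint : LocallyIntegrableOn (fun r => ∫ t in m..r, G t) (Ioo α β) :=
    hcont.locallyIntegrableOn measurableSet_Ioo
  obtain ⟨c, hc⟩ := ae_eq_const_of_integral_mul_deriv_eq_zero hαβ (h.1.sub hFint)
    (fun φ hφ hφc hs => by
      obtain ⟨γ, δ, hγ, hγδ, hδ, hK⟩ := exists_Icc_of_isCompact_subset_Ioo hαβ hφc hs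
      -- G need not be integrable up to α and β. The primitive is therefore compared with v on a
      -- compact subinterval [γ', δ'] containing both m and the support of φ, where it is absolutely
      -- continuous.
      obtain ⟨γ', hγ₁, hγ₂⟩ := exists_between (lt_min hm.1 hγ)
      obtain ⟨δ', hδ₁, hδ₂⟩ := exists_between (max_lt hm.2 hδ)
      rw [lt_min_iff] at hγ₂
      rw [max_lt_iff] at hδ₁
      have hle : γ' ≤ δ' := by linarith
      have hi := hGi γ' δ' hγ₁ hδ₂ hle
      have hac := hi.absolutelyContinuousOnInterval_intervalIntegral
        (c := m) (by rw [uIcc_of_le hle]; exact ⟨hγ₂.1.le, hδ₁.1.le⟩)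
      have hs' : tsupport φ ⊆ Ioo γ' δ' := hK.trans (Icc_subset_Ioo hγ₂.2 hδ₁.2)
      have hw : HasWeakGradientOn (Ioo γ' δ') (fun r => ∫ t in m..r, G t) G := by
        refine HasWeakGradientOn.congr isOpen_Ioo (hasWeakGradientOn_of_absolutelyContinuous hle hac)
          EventuallyEq.rfl ?_
        rw [EventuallyEq, ae_restrict_iff' measurableSet_Ioo]
        filter_upwards [hi.ae_hasDerivAt_integral] with x hx hxm
        refine (hx ?_ m ?_).deriv
        · rw [uIcc_of_le hle]; exact Ioo_subset_Icc_self hxm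
        · rw [uIcc_of_le hle]; exact ⟨hγ₂.1.le, hδ₁.1.le⟩
      have h1 := hw.2.2 φ hφ hφc hs' 1
      have h2 := h.2.2 φ hφ hφc hs 1
      have e1 := integrable_mul_fderiv h.1 hφ hφc hs 1
      have e2 := integrable_mul_fderiv hw.1 hφ hφc hs' 1
      rw [← h1] at h2
      have h3 := sub_eq_zero.2 h2
      rw [← integral_sub e1 e2] at h3
      rw [← h3]
      congr 1
      ext x
      simp only [Pi.sub_apply, fderiv_apply_eq_deriv_mul]
      ring)
  refine ⟨c, ?_⟩
  filter_upwards [hc] with r hr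
  rw [← hr]
  simp

/-- A weakly differentiable function times a cutoff function is weakly differentiable on `ℝ`. -/
lemma HasWeakGradientOn.mul_cutoff {U : Set ℝ} {v G χ : ℝ → ℝ} (h : HasWeakGradientOn U v G)
    (hχ : ContDiff ℝ ∞ χ) (hc : HasCompactSupport χ) (hs : tsupport χ ⊆ U) :
    Integrable (fun r => χ r * v r) ∧ Integrable (fun r => deriv χ r * v r + χ r * G r) ∧
      HasWeakGradientOn univ (fun r => χ r * v r) (fun r => deriv χ r * v r + χ r * G r) := by
  have hχ' : ContDiff ℝ ∞ (deriv χ) := (contDiff_infty_iff_deriv.1 hχ).2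
  have hc' : HasCompactSupport (deriv χ) := hc.deriv
  have hs' : tsupport (deriv χ) ⊆ U := 
    (closure_minimal support_deriv_subset (isClosed_tsupport _)).trans hs
  have i1 : Integrable (fun r => χ r * v r) :=
    integrable_smul_of_tsupport_subset h.1 hχ.continuous hc hs
  have i2 : Integrable (fun r => deriv χ r * v r) :=
    integrable_smul_of_tsupport_subset h.1 hχ'.continuous hc' hs'
  have i3 : Integrable (fun r => χ r * G r) :=
    integrable_smul_of_tsupport_subset h.2.1 hχ.continuous hc hs
  refine ⟨i1, i2.add i3, i1.locallyIntegrable.locallyIntegrableOn _,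
    (i2.add i3).locallyIntegrable.locallyIntegrableOn _, fun φ hφ hφc _ e => ?_⟩
  have h1 := h.2.2 (fun x => χ x * φ x) (hχ.mul hφ) (hc.mul_right)
    ((tsupport_mul_subset_left).trans hs) e
  have hbd {f : ℝ → ℝ} (hf : Integrable f) {ψ : ℝ → ℝ} (hψ : Continuous ψ)
      (hψc : HasCompactSupport ψ) : Integrable fun x => f x * ψ x := by
    simpa [mul_comm] using integrable_smul_of_tsupport_subset
      (hf.locallyIntegrable.locallyIntegrableOn univ) hψ hψc (subset_univ _)
  have hd : ∀ x, fderiv ℝ (fun x => χ x * φ x) x e =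
      deriv χ x * φ x * e + χ x * fderiv ℝ φ x e := fun x => by
    rw [fderiv_apply_eq_deriv_mul, fderiv_apply_eq_deriv_mul,
      deriv_fun_mul (hχ.differentiable (by simp) x) (hφ.differentiable (by simp) x)]
    ring
  have e1 : ∫ x, v x * fderiv ℝ (fun x => χ x * φ x) x e =
      (∫ x, deriv χ x * v x * φ x * e) + ∫ x, χ x * v x * fderiv ℝ φ x e := by
    rw [← integral_add ((hbd i2 hφ.continuous hφc).mul_const e)
      (hbd i1 (continuous_fderiv_apply_of_contDiff hφ e) (hasCompactSupport_fderiv_apply hφc e))]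
    congr 1
    ext x
    rw [hd]
    ring
  have e2 : ∫ x, inner ℝ (deriv χ x * v x + χ x * G x) e * φ x =
      (∫ x, deriv χ x * v x * φ x * e) + ∫ x, inner ℝ (G x) e * (χ x * φ x) := by
    have i4 : Integrable fun x => inner ℝ (G x) e * (χ x * φ x) := by
      refine ((hbd i3 hφ.continuous hφc).mul_const e).congr (Eventually.of_forall fun x => ?_)
      simp
      ring
    rw [← integral_add ((hbd i2 hφ.continuous hφc).mul_const e) i4]
    congr 1
    ext x
    simp
    ring
  rw [e2]
  linarith

end OneDimensional

end RadialWeight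

/-! ### From weakly differentiable profiles to radial functions -/

namespace RadialWeight

section RadialLifting

open Filter

lemma exists_contDiff_cutoff {K U : Set ℝ} (hK : IsCompact K) (hU : IsOpen U) (hKU : K ⊆ U) :
    ∃ χ : ℝ → ℝ, ContDiff ℝ ∞ χ ∧ HasCompactSupport χ ∧ tsupport χ ⊆ U ∧
      ∀ᶠ x in 𝓝ˢ K, χ x = 1 := by
  obtain ⟨L, hL, hKL, hLU⟩ := exists_compact_between hK hU hKU
  obtain ⟨χ, h1, h0, -⟩ := exists_contMDiffMap_one_nhds_of_subset_interior (n := ⊤)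
    (modelWithCornersSelf ℝ ℝ) hK.isClosed hKL
  have hs : tsupport χ ⊆ L := closure_minimal (fun x hx => by
    by_contra h
    exact hx (h0 x h)) hL.isClosed
  exact ⟨χ, χ.contMDiff.contDiff, hL.of_isClosed_subset (isClosed_tsupport _) hs, hs.trans hLU, h1⟩

variable {E : Type*} [NormedAddCommGroup E] [InnerProductSpace ℝ E]

lemma hasFDerivAt_norm {x : E} (hx : x ≠ 0) :
    HasFDerivAt (fun y : E => ‖y‖) (‖x‖⁻¹ • innerSL ℝ x) x := by
  have h1 := (hasStrictFDerivAt_norm_sq x).hasFDerivAt.sqrt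
    (pow_ne_zero 2 (norm_ne_zero_iff.2 hx))
  simp only [Real.sqrt_sq (norm_nonneg _)] at h1
  convert h1 using 1
  rw [← Nat.cast_smul_eq_nsmul ℝ, smul_smul]
  congr 1
  have := norm_ne_zero_iff.2 hx
  push_cast
  field_simp

lemma hasFDerivAt_comp_norm {x : E} (hx : x ≠ 0) {f : ℝ → ℝ} {f' : ℝ} (hf : HasDerivAt f f' ‖x‖) :
    HasFDerivAt (fun y : E => f ‖y‖) ((f' / ‖x‖) • innerSL ℝ x) x := by
  have h1 := hf.comp_hasFDerivAt x (hasFDerivAt_norm hx)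
  rwa [smul_smul, ← div_eq_mul_inv] at h1

lemma norm_div_norm_smul_le (c : ℝ) (x : E) : ‖(c / ‖x‖) • x‖ ≤ ‖c‖ := by
  rw [norm_smul, norm_div, norm_norm]
  by_cases hx : ‖x‖ = 0
  · simp [hx]
  · rw [div_mul_cancel₀ _ hx]

lemma norm_div_norm_smul (c : ℝ) {x : E} (hx : x ≠ 0) : ‖(c / ‖x‖) • x‖ = ‖c‖ := by
  rw [norm_smul, norm_div, norm_norm, div_mul_cancel₀ _ (norm_ne_zero_iff.2 hx)]

variable [FiniteDimensional ℝ E] [Nontrivial E] [MeasureSpace E] [BorelSpace E]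
  [(volume : Measure E).IsAddHaarMeasure]

lemma isOpen_setOf_norm_mem {A : Set ℝ} (hA : IsOpen A) : IsOpen {x : E | ‖x‖ ∈ A} :=
  hA.preimage continuous_norm

lemma locallyIntegrableOn_radialField {A : Set ℝ} (hA : IsOpen A) (hA0 : A ⊆ Ioi 0) {g : ℝ → ℝ}
    (hg : LocallyIntegrableOn g A) :
    LocallyIntegrableOn (fun x : E => (g ‖x‖ / ‖x‖) • x) {x | ‖x‖ ∈ A} := by
  have h1 := (locallyIntegrableOn_fun_norm_iff (volume : Measure E) hA hA0).2 hg
  rw [locallyIntegrableOn_iff (isOpen_setOf_norm_mem hA).isLocallyClosed] at h1 ⊢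
  intro K hK hKc
  have h2 := (h1 K hK hKc).smul_continuousOn (g := fun x : E => ‖x‖⁻¹ • x)
    (ContinuousOn.smul (ContinuousOn.inv₀ (by fun_prop) fun x hx => ne_of_gt (hA0 (hK hx)))
      continuousOn_id) hKc
  refine h2.congr_fun (fun x hx => ?_) hKc.measurableSet
  simp only [smul_smul, div_eq_mul_inv]

/-- For a C^1 profile the composition is classically differentiable on the support of a test
function, which avoids the origin, and ordinary integration by parts applies. -/
lemma hasWeakGradientOn_comp_norm_of_continuous {f h : ℝ → ℝ} (hh : Continuous h)
    (hf : ∀ r, HasDerivAt f (h r) r) :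
    HasWeakGradientOn {x : E | ‖x‖ ∈ Ioi 0} (fun x => f ‖x‖) (fun x => (h ‖x‖ / ‖x‖) • x) := by
  have hfc : Continuous f := continuous_iff_continuousAt.2 fun r => (hf r).continuousAt
  have l1 : LocallyIntegrableOn (fun x : E => f ‖x‖) {x : E | ‖x‖ ∈ Ioi 0} :=
    (hfc.comp continuous_norm).locallyIntegrable.locallyIntegrableOn _
  have l2 : LocallyIntegrableOn (fun x : E => (h ‖x‖ / ‖x‖) • x) {x : E | ‖x‖ ∈ Ioi 0} :=
    locallyIntegrableOn_radialField isOpen_Ioi subset_rfl (hh.locallyIntegrable.locallyIntegrableOn _)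
  refine ⟨l1, l2, fun φ hφ hc hs e => ?_⟩
  have hd : ∀ x : E, x ∈ tsupport φ → HasFDerivAt (fun y : E => f ‖y‖)
      ((h ‖x‖ / ‖x‖) • innerSL ℝ x) x := fun x hx =>
    hasFDerivAt_comp_norm (norm_pos_iff.1 (hs hx)) (hf _)
  have hd' : ∀ x, fderiv ℝ (fun y : E => f ‖y‖) x e * φ x =
      inner ℝ ((h ‖x‖ / ‖x‖) • x) e * φ x := by
    intro x
    by_cases hx : x ∈ tsupport φ
    · rw [(hd x hx).fderiv]
      simp [inner_smul_left]
    · simp [image_eq_zero_of_notMem_tsupport hx]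
  have i1 := integrable_inner_mul l2 hφ.continuous hc hs e
  rw [integral_mul_fderiv_eq_neg_fderiv_mul_of_integrable]
  · simp only [hd']
  · simpa only [hd'] using i1
  · exact integrable_mul_fderiv l1 hφ hc hs e
  · simpa [mul_comm] using integrable_smul_of_tsupport_subset l1 hφ.continuous hc hs
  · exact fun x hx => (hd x hx).differentiableAt
  · exact fun x _ => hφ.differentiable (by simp) x

/-- Approximate h in L^1 by continuous functions. The primitives converge uniformly on the
half-line, and the radial fields converge in L^1 on compact sets, where the Jacobian is bounded. -/
lemma hasWeakGradientOn_comp_norm_of_integrable {h : ℝ → ℝ} (hh : Integrable h) (c : ℝ) :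
    HasWeakGradientOn {x : E | ‖x‖ ∈ Ioi 0} (fun x => c + ∫ t in (0 : ℝ)..‖x‖, h t)
      (fun x => (h ‖x‖ / ‖x‖) • x) := by
  have happ : ∀ n : ℕ, ∃ g : ℝ → ℝ, HasCompactSupport g ∧
      ∫⁻ x, ‖h x - g x‖ₑ ≤ ENNReal.ofReal (1 / ((n : ℝ) + 1)) ∧ Continuous g ∧ Integrable g :=
    fun n => hh.exists_hasCompactSupport_lintegral_sub_le
      (by have : 0 < 1 / ((n : ℝ) + 1) := by positivity
          simpa using this)
  choose g _ hgn hgc hgi using happ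
  have hlim : Tendsto (fun n : ℕ => ENNReal.ofReal (1 / ((n : ℝ) + 1))) atTop (𝓝 0) := by
    rw [← ENNReal.ofReal_zero]
    exact ENNReal.tendsto_ofReal tendsto_one_div_add_atTop_nhds_zero_nat
  have hF : Continuous fun r => c + ∫ t in (0 : ℝ)..r, h t :=
    continuous_const.add (intervalIntegral.continuous_primitive
      (fun a b => hh.intervalIntegrable) 0)
  refine HasWeakGradientOn.of_tendsto
    (v := fun n x => c + ∫ t in (0 : ℝ)..‖x‖, g n t) (V := fun n x => (g n ‖x‖ / ‖x‖) • x)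
    (fun n => hasWeakGradientOn_comp_norm_of_continuous (hgc n)
      (f := fun r => c + ∫ t in (0 : ℝ)..r, g n t) fun r =>
      ((hgc n).integral_hasStrictDerivAt 0 r).hasDerivAt.const_add c)
    ((hF.comp continuous_norm).locallyIntegrable.locallyIntegrableOn _)
    (locallyIntegrableOn_radialField isOpen_Ioi subset_rfl
      (hh.locallyIntegrable.locallyIntegrableOn _)) ?_ ?_
  · intro K hK hKc
    have h1 := ENNReal.Tendsto.mul_const (b := volume K) hlim (Or.inr hKc.measure_ne_top)
    rw [zero_mul] at h1
    refine tendsto_of_tendsto_of_tendsto_of_le_of_le tendsto_const_nhds h1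
      (fun _ => zero_le) fun n => ?_
    refine (lintegral_mono fun x => ?_).trans (setLIntegral_const K _).le
    rw [add_sub_add_left_eq_sub, ← intervalIntegral.integral_sub (hgi n).intervalIntegrable
      hh.intervalIntegrable, intervalIntegral.integral_of_le (norm_nonneg x)]
    refine (enorm_integral_le_lintegral_enorm _).trans ((setLIntegral_le_lintegral _ _).trans ?_)
    simpa only [enorm_sub_rev] using hgn n
  · intro K hK hKc
    have hK' : IsCompact ((fun x : E => ‖x‖) '' K) := hKc.image continuous_norm
    have hK0 : (fun x : E => ‖x‖) '' K ⊆ Ioi 0 := by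
      rintro _ ⟨x, hx, rfl⟩
      exact hK hx
    obtain ⟨R, hR⟩ := hK'.isBounded.exists_norm_le
    set B : ℝ≥0∞ := (volume : Measure E).toSphere univ *
      ENNReal.ofReal (R ^ (Module.finrank ℝ E - 1)) with hB
    have hBtop : B ≠ ⊤ := ENNReal.mul_ne_top (toSphere_univ_ne_top _) ENNReal.ofReal_ne_top
    have h1 := ENNReal.Tendsto.const_mul (a := B) hlim (Or.inr hBtop)
    rw [mul_zero] at h1
    refine tendsto_of_tendsto_of_tendsto_of_le_of_le tendsto_const_nhds h1
      (fun _ => zero_le) fun n => ?_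
    have hm : AEMeasurable (fun r => ‖h r - g n r‖ₑ) :=
      (hh.sub (hgi n)).aestronglyMeasurable.enorm
    calc ∫⁻ x in K, ‖(g n ‖x‖ / ‖x‖) • x - (h ‖x‖ / ‖x‖) • x‖ₑ
        ≤ ∫⁻ x in {x : E | ‖x‖ ∈ (fun x : E => ‖x‖) '' K}, ‖h ‖x‖ - g n ‖x‖‖ₑ := by
          refine (lintegral_mono fun x => ?_).trans
            (lintegral_mono_set fun x hx => ⟨x, hx, rfl⟩)
          rw [← sub_smul, ← sub_div, ← enorm_neg, ← neg_smul, ← neg_div, neg_sub,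
            enorm_le_iff_norm_le]
          exact norm_div_norm_smul_le _ x
      _ = (volume : Measure E).toSphere univ * ∫⁻ r in (fun x : E => ‖x‖) '' K,
            ENNReal.ofReal (r ^ (Module.finrank ℝ E - 1)) * ‖h r - g n r‖ₑ :=
          setLIntegral_fun_norm_addHaar volume hK'.measurableSet hK0
            (f := fun r => ‖h r - g n r‖ₑ) hm.restrict
      _ ≤ (volume : Measure E).toSphere univ * ∫⁻ r in (fun x : E => ‖x‖) '' K,
            ENNReal.ofReal (R ^ (Module.finrank ℝ E - 1)) * ‖h r - g n r‖ₑ := by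
          gcongr 1
          refine setLIntegral_mono_ae' hK'.measurableSet (Eventually.of_forall fun r hr => ?_)
          have h2 := hR r hr
          have h3 : 0 < r := hK0 hr
          rw [Real.norm_of_nonneg h3.le] at h2
          gcongr
      _ ≤ B * ENNReal.ofReal (1 / ((n : ℝ) + 1)) := by
          rw [lintegral_const_mul' _ _ ENNReal.ofReal_ne_top, ← mul_assoc]
          gcongr
          exact (setLIntegral_le_lintegral _ _).trans (hgn n)

/-- If `v` is weakly differentiable, so is the radial function `x ↦ v ‖x‖`. -/
lemma HasWeakGradientOn.comp_norm {A : Set ℝ} (hA : IsOpen A) (hA0 : A ⊆ Ioi 0) {v G : ℝ → ℝ}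
    (h : HasWeakGradientOn A v G) :
    HasWeakGradientOn {x : E | ‖x‖ ∈ A} (fun x => v ‖x‖) (fun x => (G ‖x‖ / ‖x‖) • x) := by
  refine ⟨(locallyIntegrableOn_fun_norm_iff volume hA hA0).2 h.1,
    locallyIntegrableOn_radialField hA hA0 h.2.1, fun φ hφ hc hs e => ?_⟩
  set K : Set ℝ := (fun x : E => ‖x‖) '' tsupport φ with hKdef
  have hK : IsCompact K := hc.isCompact.image continuous_norm
  have hKA : K ⊆ A := by
    rintro _ ⟨x, hx, rfl⟩
    exact hs hx
  -- Multiplying v by a cutoff equal to 1 near the norms of points in the support of φ yields a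
  -- primitive of an integrable function on the line, to which the preceding case applies.
  obtain ⟨χ, hχ, hχc, hχs, hχ1⟩ := exists_contDiff_cutoff hK hA hKA
  obtain ⟨-, hi, hw⟩ := h.mul_cutoff hχ hχc hχs
  obtain ⟨R, hR⟩ := hK.isBounded.exists_norm_le
  have hR' : ∀ r ∈ K, r ∈ Ioo (-(|R| + 1)) (|R| + 1) := fun r hr => by
    have := hR r hr
    rw [Real.norm_eq_abs] at this
    rw [mem_Ioo, ← abs_lt]
    linarith [le_abs_self R]
  obtain ⟨c, hc'⟩ := (hw.mono (subset_univ (Ioo (-(|R| + 1)) (|R| + 1)))).exists_ae_eq_primitive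
    (m := 0) ⟨by linarith [abs_nonneg R], by linarith [abs_nonneg R]⟩
  have hL := (hasWeakGradientOn_comp_norm_of_integrable (E := E) hi c).2.2 φ hφ hc
    (fun x hx => hA0 (hs hx)) e
  have hae : ∀ᵐ x : E, ‖x‖ ∈ K → v ‖x‖ = c + ∫ t in (0 : ℝ)..‖x‖, (deriv χ t * v t + χ t * G t) := by
    refine ae_norm_of_ae (E := E) volume 
      (P := fun r => r ∈ K → v r = c + ∫ t in (0 : ℝ)..r, (deriv χ t * v t + χ t * G t)) ?_
    refine ae_restrict_of_ae ?_
    rw [ae_restrict_iff' measurableSet_Ioo] at hc'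
    filter_upwards [hc'] with r hr hrK
    rw [← hr (hR' r hrK), hχ1.self_of_nhdsSet r hrK, one_mul]
  have e1 : ∫ x, v ‖x‖ * fderiv ℝ φ x e =
      ∫ x : E, (c + ∫ t in (0 : ℝ)..‖x‖, (deriv χ t * v t + χ t * G t)) * fderiv ℝ φ x e := by
    refine integral_congr_ae ?_
    filter_upwards [hae] with x hx
    by_cases hxs : x ∈ tsupport φ
    · rw [hx ⟨x, hxs, rfl⟩]
    · rw [image_eq_zero_of_notMem_tsupport
        fun h => hxs (tsupport_fderiv_apply_subset e h), mul_zero, mul_zero]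
  rw [e1, hL]
  congr 1
  refine integral_congr_ae (Eventually.of_forall fun x => ?_)
  by_cases hxs : x ∈ tsupport φ
  -- Since χ is 1 on a neighbourhood, and not merely at the point, the term with its derivative
  -- disappears.
  · have h1 : ∀ᶠ r in 𝓝 ‖x‖, χ r = 1 := (eventually_nhdsSet_iff_forall.1 hχ1) _ ⟨x, hxs, rfl⟩
    have h2 : deriv χ ‖x‖ = 0 := by
      rw [EventuallyEq.deriv_eq (f := fun _ => (1 : ℝ)) h1, deriv_const]
    simp only [h2, h1.self_of_nhds, zero_mul, one_mul, zero_add]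
  · simp [image_eq_zero_of_notMem_tsupport hxs]

end RadialLifting

end RadialWeight

/-! ### From rotation invariant functions to profiles -/

namespace RadialWeight

section RadialDescent

open Filter

variable {d : ℕ}

lemma measurePreserving_isometry (R : Space d ≃ₗᵢ[ℝ] Space d) : MeasurePreserving R :=
  R.measurePreserving

lemma setAverage_closedBall_isometry {R : Space d ≃ₗᵢ[ℝ] Space d} {g : Space d → ℝ}
    (hg : g ∘ R =ᵐ[volume] g) (x : Space d) (δ : ℝ) :
    ⨍ y in Metric.closedBall x δ, g y = ⨍ y in Metric.closedBall (R x) δ, g y := by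
  have hm : MeasurePreserving R := measurePreserving_isometry R
  have hemb : MeasurableEmbedding R := R.toHomeomorph.measurableEmbedding
  have hpre : R ⁻¹' Metric.closedBall (R x) δ = Metric.closedBall x δ :=
    R.isometry.preimage_closedBall x δ
  have h1 : volume (Metric.closedBall x δ) = volume (Metric.closedBall (R x) δ) := by
    rw [← hm.measure_preimage_emb hemb (Metric.closedBall (R x) δ), hpre]
  have h2 : ∫ y in Metric.closedBall x δ, g y = ∫ y in Metric.closedBall (R x) δ, g y := by
    rw [← hm.setIntegral_preimage_emb hemb g (Metric.closedBall (R x) δ), hpre]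
    exact setIntegral_congr_ae Metric.isClosed_closedBall.measurableSet
      (hg.mono fun z hz _ => hz.symm)
  rw [setAverage_eq, setAverage_eq, h2, measureReal_def, measureReal_def, h1]

/-- A function invariant under all linear isometries is radial. -/
lemma exists_ae_eq_comp_norm {A : Set ℝ} (hA : MeasurableSet A) {f : Space d → ℝ}
    (hf : AEStronglyMeasurable f (volume.restrict {x | ‖x‖ ∈ A}))
    (hinv : ∀ R : Space d ≃ₗᵢ[ℝ] Space d, f ∘ R =ᵐ[volume.restrict {x | ‖x‖ ∈ A}] f) :
    ∃ v : ℝ → ℝ, f =ᵐ[volume.restrict {x | ‖x‖ ∈ A}] fun x => v ‖x‖ := by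
  have hU : MeasurableSet {x : Space d | ‖x‖ ∈ A} := measurable_norm hA
  -- Passing to arctan f makes the function bounded, hence locally integrable, so Lebesgue
  -- differentiation is available without integrability of f.
  set g : Space d → ℝ := {x : Space d | ‖x‖ ∈ A}.indicator fun x => Real.arctan (f x) with hg
  have hgm : AEStronglyMeasurable g volume :=
    (aestronglyMeasurable_indicator_iff hU).2 (Real.continuous_arctan.comp_aestronglyMeasurable hf)
  have hgb : ∀ x, ‖g x‖ ≤ Real.pi / 2 := fun x => by
    rw [hg, indicator]
    split_ifs
    · rw [Real.norm_eq_abs, abs_le]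
      exact ⟨(Real.neg_pi_div_two_lt_arctan _).le, (Real.arctan_lt_pi_div_two _).le⟩
    · rw [norm_zero]; positivity
  have hgl : LocallyIntegrable g volume := by
    refine (locallyIntegrable_const (Real.pi / 2)).mono hgm (Eventually.of_forall fun x => ?_)
    rw [Real.norm_of_nonneg (by positivity : 0 ≤ Real.pi / 2)]
    exact hgb x
  have hginv : ∀ R : Space d ≃ₗᵢ[ℝ] Space d, g ∘ R =ᵐ[volume] g := fun R => by
    have := (ae_restrict_iff' hU).1 (hinv R)
    filter_upwards [this] with x hx
    have hR : R x ∈ {x : Space d | ‖x‖ ∈ A} ↔ x ∈ {x : Space d | ‖x‖ ∈ A} := by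
      change ‖R x‖ ∈ A ↔ ‖x‖ ∈ A
      rw [R.norm_map]
    by_cases h : x ∈ {x : Space d | ‖x‖ ∈ A}
    · rw [hg, Function.comp, indicator_of_mem h, indicator_of_mem (hR.2 h), ← hx h, Function.comp]
    · rw [hg, Function.comp, indicator_of_notMem h, indicator_of_notMem (fun h' => h (hR.1 h'))]
  -- Ball averages of g are invariant at every point, not just almost everywhere, so they depend on
  -- the norm only. Their limits recover g almost everywhere.
  let avg : Space d → ℕ → ℝ := fun x n => ⨍ y in Metric.closedBall x (1 / ((n : ℝ) + 1)), g y
  have havg : ∀ x y : Space d, ‖x‖ = ‖y‖ → avg x = avg y := fun x y hxy => by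
    obtain ⟨R, hRx⟩ : ∃ R : Space d ≃ₗᵢ[ℝ] Space d, R x = y :=
      -- The reflection in the hyperplane orthogonal to x - y exchanges two points of equal norm.
      ⟨(ℝ ∙ (x - y))ᗮ.reflection, Submodule.reflection_sub hxy⟩
    rw [← hRx]
    exact funext fun n => setAverage_closedBall_isometry (hginv R) x _
  have hδ : Tendsto (fun n : ℕ => 1 / ((n : ℝ) + 1)) atTop (𝓝[>] 0) := by
    refine tendsto_nhdsWithin_iff.2 ⟨tendsto_one_div_add_atTop_nhds_zero_nat,
      Eventually.of_forall fun n => ?_⟩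
    simp only [mem_Ioi]
    positivity
  have hlim : ∀ᵐ x : Space d, Tendsto (avg x) atTop (𝓝 (g x)) := by
    filter_upwards [IsUnifLocDoublingMeasure.ae_tendsto_average (μ := volume) hgl 1] with x hx
    exact hx (fun _ => x) (fun n : ℕ => 1 / ((n : ℝ) + 1)) hδ (Eventually.of_forall fun n =>
      Metric.mem_closedBall_self (by positivity))
  classical
  let pt : ℝ → Space d := fun r => if h : ∃ x : Space d, ‖x‖ = r then h.choose else 0
  have hpt : ∀ x : Space d, ‖pt ‖x‖‖ = ‖x‖ := fun x => by
    have h : ∃ y : Space d, ‖y‖ = ‖x‖ := ⟨x, rfl⟩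
    simp only [pt, dif_pos h]
    exact h.choose_spec
  refine ⟨fun r => Real.tan (limUnder atTop (avg (pt r))), ?_⟩
  rw [EventuallyEq, ae_restrict_iff' hU]
  filter_upwards [hlim] with x hx hxA
  rw [havg _ _ (hpt x), hx.limUnder_eq, hg,
    indicator_of_mem (show x ∈ {x : Space d | ‖x‖ ∈ A} from hxA), Real.tan_arctan]

lemma contDiff_mul_inv_pow {A : Set ℝ} (hA0 : A ⊆ Ioi 0) {φ : ℝ → ℝ} (hφ : ContDiff ℝ ∞ φ)
    (hs : tsupport φ ⊆ A) (n : ℕ) : ContDiff ℝ ∞ fun r => φ r * (r ^ n)⁻¹ := by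
  rw [contDiff_iff_contDiffAt]
  intro r
  by_cases hr : r = 0
  · have h0 : (0 : ℝ) ∉ tsupport φ := fun h => lt_irrefl (0 : ℝ) (hA0 (hs h))
    have : (fun r => φ r * (r ^ n)⁻¹) =ᶠ[𝓝 r] fun _ => 0 := by
      rw [hr]
      filter_upwards [(isClosed_tsupport φ).isOpen_compl.mem_nhds h0] with s hs
      rw [image_eq_zero_of_notMem_tsupport hs, zero_mul]
    exact contDiffAt_const.congr_of_eventuallyEq this
  · exact hφ.contDiffAt.mul ((contDiffAt_id.pow n).inv (pow_ne_zero _ hr))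

/-- If a radial function is weakly differentiable then so is its profile, and the derivative of
the profile is the radial component of the gradient. -/
lemma HasWeakGradientOn.exists_radial_profile [Nontrivial (Space d)] {A : Set ℝ} (hA : IsOpen A)
    (hA0 : A ⊆ Ioi 0) {u : Space d → ℝ} {G : Space d → Space d} {v : ℝ → ℝ}
    (h : HasWeakGradientOn {x : Space d | ‖x‖ ∈ A} u G)
    (hv : u =ᵐ[volume.restrict {x | ‖x‖ ∈ A}] fun x => v ‖x‖) :
    ∃ q : ℝ → ℝ, HasWeakGradientOn A v q ∧
      ∀ᵐ x ∂volume.restrict {x : Space d | ‖x‖ ∈ A}, ‖q ‖x‖‖ ≤ ‖G x‖ := by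
  set S : Set (Space d) := {x | ‖x‖ ∈ A} with hSdef
  have hS : IsOpen S := isOpen_setOf_norm_mem hA
  have hSR : ∀ R : Space d ≃ₗᵢ[ℝ] Space d, R ⁻¹' S = S := fun R => by
    ext x
    simp [hSdef, R.norm_map]
  -- Since u is radial, the rotated field is another weak gradient of u. By uniqueness G is
  -- equivariant, and its radial component ⟨G, x⟩ / |x| is rotation invariant and defines q.
  have hGinv : ∀ R : Space d ≃ₗᵢ[ℝ] Space d,
      (fun x => R.symm (G (R x))) =ᵐ[volume.restrict S] G := fun R => by
    have hm := measurePreserving_isometry R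
    have h1 := h.comp_isometry hS R hm (hSR R)
    have h2 : u ∘ R =ᵐ[volume.restrict S] u := by
      have h3 : MeasurePreserving R (volume.restrict S) (volume.restrict S) := by
        have := hm.restrict_preimage hS.measurableSet
        rwa [hSR] at this
      filter_upwards [h3.quasiMeasurePreserving.ae hv, hv] with x hx hx'
      simp only [Function.comp, hx, hx', R.norm_map]
    exact (h1.congr hS h2 EventuallyEq.rfl).ae_unique hS h
  have hGm : AEStronglyMeasurable G (volume.restrict S) := h.2.1.aestronglyMeasurable
  have hqm : AEStronglyMeasurable (fun x => inner ℝ (G x) x / ‖x‖) (volume.restrict S) :=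
    (hGm.inner aestronglyMeasurable_id).div₀ (by fun_prop)
  obtain ⟨q, hq⟩ := exists_ae_eq_comp_norm hA.measurableSet hqm (fun R => by
    filter_upwards [hGinv R] with x hx
    simp only [Function.comp, R.norm_map]
    rw [← hx]
    rw [← R.inner_map_map (R.symm (G (R x))) x, R.apply_symm_apply])
  have hqG : ∀ᵐ x ∂volume.restrict S, ‖q ‖x‖‖ ≤ ‖G x‖ := by
    filter_upwards [hq] with x hx
    rw [← hx, norm_div, norm_norm]
    exact div_le_of_le_mul₀ (norm_nonneg _) (norm_nonneg _) (norm_inner_le_norm _ _)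
  have hvl : LocallyIntegrableOn v A :=
    (locallyIntegrableOn_fun_norm_iff (volume : Measure (Space d)) hA hA0).1
      (LocallyIntegrableOn.congr_ae_restrict hS h.1 hv)
  have hql : LocallyIntegrableOn q A := by
    rw [← locallyIntegrableOn_fun_norm_iff (volume : Measure (Space d)) hA hA0,
      locallyIntegrableOn_iff (isOpen_setOf_norm_mem hA).isLocallyClosed]
    intro K hK hKc
    exact Integrable.mono (h.2.1.integrableOn_compact_subset hK hKc)
      ((hqm.congr hq).mono_measure (Measure.restrict_mono hK le_rfl))
      (ae_restrict_of_ae_restrict_of_subset hK hqG)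
  refine ⟨q, ⟨hvl, hql, fun φ hφ hc hs e => ?_⟩, hqG⟩
  set n := Module.finrank ℝ (Space d) with hn
  have hn0 : 0 < n := Module.finrank_pos
  -- The test field is φ(|x|) |x|^(-n) x, whose divergence is φ'(|x|) |x|^(1-n). The power cancels
  -- the Jacobian of polar coordinates, so testing u with its components Ψ i produces exactly the
  -- one-dimensional identity for v.
  set a : ℝ → ℝ := fun r => φ r * (r ^ n)⁻¹ with ha
  have hac : ContDiff ℝ ∞ a := contDiff_mul_inv_pow hA0 hφ hs n
  have has : Function.support a ⊆ Function.support φ := fun r hr h0 => hr (by simp [ha, h0])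
  have hats : tsupport a ⊆ tsupport φ := closure_mono has
  have hacomp : ContDiff ℝ ∞ fun x : Space d => a ‖x‖ := by
    rw [contDiff_iff_contDiffAt]
    intro x
    by_cases hx : x = 0
    · have h0 : ‖x‖ ∉ tsupport a := fun h => by
        have := hA0 (hs (hats h))
        simp [hx] at this
      have : (fun x : Space d => a ‖x‖) =ᶠ[𝓝 x] fun _ => 0 := by
        filter_upwards [continuous_norm.continuousAt.preimage_mem_nhds
          ((isClosed_tsupport a).isOpen_compl.mem_nhds h0)] with y hy
        exact image_eq_zero_of_notMem_tsupport hy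
      exact contDiffAt_const.congr_of_eventuallyEq this
    · exact hac.contDiffAt.comp x (contDiffAt_norm ℝ hx)
  have hcK : IsCompact {x : Space d | ‖x‖ ∈ tsupport φ} := isCompact_setOf_norm_mem hc
  set b := stdOrthonormalBasis ℝ (Space d)
  set Ψ : Fin n → Space d → ℝ := fun i x => a ‖x‖ * inner ℝ (b i) x with hΨ
  have hΨc : ∀ i, ContDiff ℝ ∞ (Ψ i) := fun i => hacomp.mul (contDiff_const.inner ℝ contDiff_id)
  have hΨs : ∀ i, tsupport (Ψ i) ⊆ {x : Space d | ‖x‖ ∈ tsupport φ} := fun i => by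
    refine closure_minimal (fun x hx => ?_) hcK.isClosed
    refine subset_tsupport _ (has fun h0 => hx ?_)
    simp only [hΨ, h0, zero_mul]
  have hΨcs : ∀ i, HasCompactSupport (Ψ i) := fun i =>
    hcK.of_isClosed_subset (isClosed_tsupport _) (hΨs i)
  have hΨS : ∀ i, tsupport (Ψ i) ⊆ S := fun i => (hΨs i).trans fun x hx => hs hx
  have hdiv : ∀ x ∈ S, ∑ i, fderiv ℝ (Ψ i) x (b i) = deriv φ ‖x‖ * (‖x‖ ^ (n - 1))⁻¹ := by
    intro x hx
    have hx0 : 0 < ‖x‖ := hA0 hx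
    have hxne : x ≠ 0 := norm_pos_iff.1 hx0
    have had : HasDerivAt a (deriv φ ‖x‖ * (‖x‖ ^ n)⁻¹ +
        φ ‖x‖ * (-(n * ‖x‖ ^ (n - 1)) / (‖x‖ ^ n) ^ 2)) ‖x‖ :=
      ((hφ.differentiable (by simp) _).hasDerivAt).mul
        ((hasDerivAt_pow n ‖x‖).inv (pow_ne_zero _ hx0.ne'))
    set a' := deriv φ ‖x‖ * (‖x‖ ^ n)⁻¹ + φ ‖x‖ * (-(n * ‖x‖ ^ (n - 1)) / (‖x‖ ^ n) ^ 2)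
    have h1 : ∀ i, fderiv ℝ (Ψ i) x (b i) = a ‖x‖ + a' / ‖x‖ * inner ℝ (b i) x ^ 2 := by
      intro i
      have h2 : HasFDerivAt (fun y : Space d => inner ℝ (b i) y) (innerSL ℝ (b i)) x :=
        (innerSL ℝ (b i)).hasFDerivAt
      have h3 : HasFDerivAt (Ψ i) _ x := (hasFDerivAt_comp_norm hxne had).mul h2
      rw [h3.fderiv]
      have : inner ℝ (b i) (b i) = (1 : ℝ) := by
        rw [real_inner_self_eq_norm_sq, b.norm_eq_one, one_pow]
      simp [real_inner_comm]
      ring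
    simp only [h1, Finset.sum_add_distrib, ← Finset.mul_sum]
    rw [show ∑ i : Fin n, inner ℝ (b i) x ^ 2 = ‖x‖ ^ 2 from b.sum_sq_inner_right x]
    simp only [Finset.sum_const, Finset.card_univ, Fintype.card_fin, nsmul_eq_mul, ha, a']
    obtain ⟨m, hm⟩ : ∃ m, n = m + 1 := ⟨n - 1, by omega⟩
    rw [hm]
    simp only [Nat.add_sub_cancel]
    push_cast
    field_simp
    ring
  have hsum : ∑ i, ∫ x, u x * fderiv ℝ (Ψ i) x (b i) =
      -∑ i, ∫ x, inner ℝ (G x) (b i) * Ψ i x := by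
    rw [← Finset.sum_neg_distrib]
    exact Finset.sum_congr rfl fun i _ => h.2.2 (Ψ i) (hΨc i) (hΨcs i) (hΨS i) (b i)
  rw [← integral_finsetSum _ fun i _ => integrable_mul_fderiv h.1 (hΨc i) (hΨcs i) (hΨS i) (b i),
    ← integral_finsetSum _ fun i _ => integrable_inner_mul h.2.1 (hΨc i).continuous (hΨcs i)
      (hΨS i) (b i)] at hsum
  have hκ : (volume : Measure (Space d)).toSphere.real univ ≠ 0 := by
    rw [measureReal_def]
    exact ENNReal.toReal_ne_zero.2 ⟨toSphere_univ_ne_zero _, toSphere_univ_ne_top _⟩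
  have hpolar : ∀ f ψ : ℝ → ℝ, Function.support ψ ⊆ A →
      ∫ x : Space d, f ‖x‖ * (ψ ‖x‖ * (‖x‖ ^ (n - 1))⁻¹) =
      (volume : Measure (Space d)).toSphere.real univ * ∫ r, f r * ψ r := by
    intro f ψ hψ
    rw [integral_fun_norm_addHaar_toSphere volume (fun r => f r * (ψ r * (r ^ (n - 1))⁻¹)),
      smul_eq_mul]
    congr 1
    rw [← setIntegral_eq_integral_of_forall_compl_eq_zero (s := Ioi 0) (f := fun r => f r * ψ r)]
    · refine setIntegral_congr_fun measurableSet_Ioi fun r hr => ?_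
      have : r ^ (n - 1) ≠ 0 := pow_ne_zero _ (ne_of_gt hr)
      simp only [smul_eq_mul, ← hn]
      field_simp
    · intro r hr
      have : ψ r = 0 := by
        by_contra h0
        exact hr (hA0 (hψ h0))
      rw [this, mul_zero]
  have hL : ∫ x, ∑ i, u x * fderiv ℝ (Ψ i) x (b i) =
      ∫ x : Space d, v ‖x‖ * (deriv φ ‖x‖ * (‖x‖ ^ (n - 1))⁻¹) := by
    refine integral_congr_ae ?_
    filter_upwards [(ae_restrict_iff' hS.measurableSet).1 hv] with x hx
    by_cases hxS : x ∈ S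
    · rw [← Finset.mul_sum, hdiv x hxS, hx hxS]
    · have h1 : ∀ i, fderiv ℝ (Ψ i) x (b i) = 0 := fun i =>
        image_eq_zero_of_notMem_tsupport (f := fun x => fderiv ℝ (Ψ i) x (b i)) fun h' =>
          hxS (hΨS i (tsupport_fderiv_apply_subset _ h'))
      have h2 : deriv φ ‖x‖ = 0 := by
        by_contra h0
        exact hxS (hs (support_deriv_subset h0))
      simp [h1, h2]
  have hRt : ∫ x, ∑ i, inner ℝ (G x) (b i) * Ψ i x =
      ∫ x : Space d, q ‖x‖ * (φ ‖x‖ * (‖x‖ ^ (n - 1))⁻¹) := by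
    refine integral_congr_ae ?_
    filter_upwards [(ae_restrict_iff' hS.measurableSet).1 hq] with x hx
    have h1 : ∑ i, inner ℝ (G x) (b i) * Ψ i x = a ‖x‖ * inner ℝ (G x) x := by
      rw [← b.sum_inner_mul_inner (G x) x, Finset.mul_sum]
      refine Finset.sum_congr rfl fun i _ => ?_
      simp only [hΨ]
      ring
    rw [h1]
    by_cases hxS : x ∈ S
    · have hx0 : 0 < ‖x‖ := hA0 hxS
      rw [← hx hxS]
      simp only [ha]
      obtain ⟨m, hm⟩ : ∃ m, n = m + 1 := ⟨n - 1, by omega⟩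
      rw [hm]
      simp only [Nat.add_sub_cancel]
      field_simp
      ring
    · have h2 : φ ‖x‖ = 0 := by
        by_contra h0
        exact hxS (hs (subset_tsupport _ h0))
      simp [ha, h2]
  rw [hL, hRt, hpolar v (deriv φ) fun r hr => hs (support_deriv_subset hr),
    hpolar q φ fun r hr => hs (subset_tsupport _ hr), ← mul_neg] at hsum
  have hfin := mul_left_cancel₀ hκ hsum
  simp only [fderiv_apply_eq_deriv_mul, ← mul_assoc]
  rw [integral_mul_const, hfin, neg_mul, ← integral_mul_const]
  congr 1
  refine integral_congr_ae (Eventually.of_forall fun x => ?_)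
  simp
  ring

end RadialDescent

end RadialWeight

/-! ### Regular radii and their components -/

namespace RadialWeight

open Filter

/-- The standing assumptions on the weight and the domain. -/
structure Setting (d : ℕ) (p a b : ℝ) (η : ℝ → ℝ) (Ω : Set (Space d)) : Prop where
  one_le : 1 ≤ d
  one_lt : 1 < p
  nonneg : 0 ≤ a
  lt : a < b
  aemeasurable : AEMeasurable η (volume.restrict (Ioi 0))
  support_subset : Function.support η ⊆ Ioo a b
  degenerate : FinitelyDegenerate p a b η
  domain : Ω = {x | ‖x‖ < b} ∨ Ω = {x | a < ‖x‖ ∧ ‖x‖ < b}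

namespace Setting

variable {d : ℕ} {p a b : ℝ} {η : ℝ → ℝ} {Ω : Set (Space d)} (h : Setting d p a b η Ω)

section Radii

include h

lemma nontrivial_space : Nontrivial (Space d) := by
  have : Nonempty (Fin d) := ⟨⟨0, h.one_le⟩⟩
  infer_instance

lemma exponent_pos : 0 < 1 / (p - 1) := by
  have := h.one_lt
  apply one_div_pos.2
  linarith

omit h in
lemma regularRadii_subset_Ioo : regularRadii p a b η ⊆ Ioo a b := fun _ hr => hr.1

lemma regularRadii_subset_Ioi : regularRadii p a b η ⊆ Ioi 0 := fun _ hr =>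
  h.nonneg.trans_lt hr.1.1

omit h in
lemma isOpen_regularRadii : IsOpen (regularRadii p a b η) := by
  rw [isOpen_iff_mem_nhds]
  rintro r ⟨hr, ε, hε, hfin⟩
  filter_upwards [isOpen_Ioo.mem_nhds hr, Ioo_mem_nhds (show r - ε / 2 < r by linarith)
    (show r < r + ε / 2 by linarith)] with s hs hs'
  refine ⟨hs, ε / 2, by linarith, lt_of_le_of_lt (lintegral_mono_set ?_) hfin⟩
  exact Ioo_subset_Ioo (by linarith [hs'.1]) (by linarith [hs'.2])

lemma invWeight_eq_top {s : ℝ} (hs : s ∉ Ioo a b) : invWeight p η s = ⊤ := by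
  have : η s = 0 := by
    by_contra hne
    exact hs (h.support_subset hne)
  rw [invWeight, this, ENNReal.ofReal_zero, ENNReal.zero_rpow_of_neg (by linarith [h.exponent_pos])]

/-- Away from the regular radii, and also outside `(a, b)`, `η^{-1/(p-1)}` has infinite mass on
each neighbourhood. -/
lemma lintegral_invWeight_eq_top {c : ℝ} (hc : c ∉ regularRadii p a b η) {ε : ℝ} (hε : 0 < ε) :
    ∫⁻ s in Ioo (c - ε) (c + ε), invWeight p η s = ⊤ := by
  by_cases hcab : c ∈ Ioo a b
  · by_contra hne
    exact hc ⟨hcab, ε, hε, lt_top_iff_ne_top.2 hne⟩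
  -- If c lies outside (a, b), then one half of the neighbourhood misses (a, b) altogether, and
  -- there the integrand is identically ∞.
  · have key : ∀ s t : ℝ, s < t → Ioo s t ⊆ Ioo (c - ε) (c + ε) →
        (∀ r ∈ Ioo s t, r ∉ Ioo a b) → ∫⁻ s in Ioo (c - ε) (c + ε), invWeight p η s = ⊤ := by
      intro s t hst hsub hout
      refine eq_top_iff.2 (le_trans ?_ (lintegral_mono_set hsub))
      rw [setLIntegral_congr_fun measurableSet_Ioo (g := fun _ => ⊤)
        (fun r hr => h.invWeight_eq_top (hout r hr)), setLIntegral_const, Real.volume_Ioo,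
        ENNReal.top_mul]
      simpa using hst
    rw [mem_Ioo, not_and_or, not_lt, not_lt] at hcab
    rcases hcab with hca | hcb
    · exact key (c - ε) c (by linarith) (Ioo_subset_Ioo le_rfl (by linarith)) fun r hr hr' =>
        absurd hr'.1 (not_lt.2 (hr.2.le.trans hca))
    · exact key c (c + ε) (by linarith) (Ioo_subset_Ioo (by linarith) le_rfl) fun r hr hr' =>
        absurd hr'.2 (not_lt.2 (hcb.trans hr.1.le))

omit h in
lemma lintegral_invWeight_lt_top {K : Set ℝ} (hK : IsCompact K)
    (hKI : K ⊆ regularRadii p a b η) : ∫⁻ s in K, invWeight p η s < ⊤ := by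
  refine hK.induction_on (p := fun K => ∫⁻ s in K, invWeight p η s < ⊤) (by simp)
    (fun s t hst ht => (lintegral_mono_set hst).trans_lt ht)
    (fun s t hs ht => (lintegral_union_le _ _ _).trans_lt (ENNReal.add_lt_top.2 ⟨hs, ht⟩))
    fun r hr => ?_
  obtain ⟨-, ε, hε, hfin⟩ := hKI hr
  exact ⟨_, mem_nhdsWithin_of_mem_nhds (Ioo_mem_nhds (by linarith) (by linarith)), hfin⟩

lemma aemeasurable_invWeight : AEMeasurable (invWeight p η) (volume.restrict (Ioi 0)) :=
  h.aemeasurable.ennreal_ofReal.pow_const _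

lemma ae_invWeight_lt_top : ∀ᵐ r ∂volume.restrict (regularRadii p a b η), invWeight p η r < ⊤ := by
  rw [ae_restrict_iff' isOpen_regularRadii.measurableSet, ae_iff]
  refine measure_null_of_locally_null _ fun r hr => ?_
  rw [mem_ofPred_eq, Classical.not_imp] at hr
  obtain ⟨-, ε, hε, hfin⟩ := hr.1
  refine ⟨_, inter_mem_nhdsWithin _ (Ioo_mem_nhds (show r - ε < r by linarith)
    (show r < r + ε by linarith)), ?_⟩
  have h1 : AEMeasurable (invWeight p η)
      (volume.restrict (Ioo (r - ε) (r + ε) ∩ regularRadii p a b η)) :=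
    h.aemeasurable_invWeight.mono_measure (Measure.restrict_mono
      (inter_subset_right.trans h.regularRadii_subset_Ioi) le_rfl)
  have h2 := ae_lt_top' h1 ((lintegral_mono_set inter_subset_left).trans_lt hfin).ne
  rw [ae_restrict_iff' (measurableSet_Ioo.inter isOpen_regularRadii.measurableSet), ae_iff] at h2
  refine measure_mono_null (fun s hs => ?_) h2
  have hs1 := hs.1
  rw [mem_ofPred_eq, Classical.not_imp] at hs1 ⊢
  exact ⟨⟨hs.2, hs1.1⟩, hs1.2⟩

lemma ae_weight_pos : ∀ᵐ r ∂volume.restrict (regularRadii p a b η), 0 < η r := by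
  filter_upwards [h.ae_invWeight_lt_top] with r hr
  by_contra! hle
  rw [invWeight, ENNReal.ofReal_of_nonpos hle,
    ENNReal.zero_rpow_of_neg (by linarith [h.exponent_pos])] at hr
  exact lt_irrefl _ hr

end Radii

section Components

omit h in
-- A nonempty bounded connected set contains the open interval between its infimum and supremum, and
-- openness of the component excludes these two points.
lemma connectedComponentIn_eq_Ioo {r : ℝ} (hr : r ∈ regularRadii p a b η) :
    connectedComponentIn (regularRadii p a b η) r =
      Ioo (leftEnd p a b η r) (rightEnd p a b η r) := by
  set C := connectedComponentIn (regularRadii p a b η) r with hC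
  have hCsub : C ⊆ Ioo a b := (connectedComponentIn_subset _ _).trans regularRadii_subset_Ioo
  have hne : C.Nonempty := ⟨r, mem_connectedComponentIn hr⟩
  have hbb : BddBelow C := bddBelow_Ioo.mono hCsub
  have hba : BddAbove C := bddAbove_Ioo.mono hCsub
  have hopen : IsOpen C := isOpen_regularRadii.connectedComponentIn
  refine Subset.antisymm (fun s hs => ?_)
    ((show IsConnected C from ⟨hne, isPreconnected_connectedComponentIn⟩).Ioo_csInf_csSup_subset
      hbb hba)
  obtain ⟨ε, hε, hball⟩ := Metric.isOpen_iff.1 hopen s hs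
  rw [Real.ball_eq_Ioo] at hball
  have h1 : sInf C ≤ s - ε / 2 := csInf_le hbb (hball ⟨by linarith, by linarith⟩)
  have h2 : s + ε / 2 ≤ sSup C := le_csSup hba (hball ⟨by linarith, by linarith⟩)
  exact ⟨show sInf C < s by linarith, show s < sSup C by linarith⟩

omit h in
lemma mem_Ioo_ends {r : ℝ} (hr : r ∈ regularRadii p a b η) :
    r ∈ Ioo (leftEnd p a b η r) (rightEnd p a b η r) := by
  rw [← connectedComponentIn_eq_Ioo hr]
  exact mem_connectedComponentIn hr

omit h in
lemma Ioo_ends_subset {r : ℝ} (hr : r ∈ regularRadii p a b η) :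
    Ioo (leftEnd p a b η r) (rightEnd p a b η r) ⊆ regularRadii p a b η := by
  rw [← connectedComponentIn_eq_Ioo hr]
  exact connectedComponentIn_subset _ _

omit h in
-- A regular left endpoint could be adjoined to the component without losing connectedness,
-- contradicting that the component is an open interval.
lemma leftEnd_notMem {r : ℝ} (hr : r ∈ regularRadii p a b η) :
    leftEnd p a b η r ∉ regularRadii p a b η := fun hmem => by
  have hlr := mem_Ioo_ends hr
  have h1 : Icc (leftEnd p a b η r) r ⊆ regularRadii p a b η := fun s hs => by
    rcases hs.1.eq_or_lt with heq | hlt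
    · rwa [← heq]
    · exact Ioo_ends_subset hr ⟨hlt, hs.2.trans_lt hlr.2⟩
  have h2 := isPreconnected_Icc.subset_connectedComponentIn (right_mem_Icc.2 hlr.1.le) h1
    (left_mem_Icc.2 hlr.1.le)
  rw [connectedComponentIn_eq_Ioo hr] at h2
  exact lt_irrefl _ h2.1

omit h in
lemma rightEnd_notMem {r : ℝ} (hr : r ∈ regularRadii p a b η) :
    rightEnd p a b η r ∉ regularRadii p a b η := fun hmem => by
  have hlr := mem_Ioo_ends hr
  have h1 : Icc r (rightEnd p a b η r) ⊆ regularRadii p a b η := fun s hs => by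
    rcases hs.2.eq_or_lt with heq | hlt
    · rwa [heq]
    · exact Ioo_ends_subset hr ⟨hlr.1.trans_le hs.1, hlt⟩
  have h2 := isPreconnected_Icc.subset_connectedComponentIn (left_mem_Icc.2 hlr.2.le) h1
    (right_mem_Icc.2 hlr.2.le)
  rw [connectedComponentIn_eq_Ioo hr] at h2
  exact lt_irrefl _ h2.2

include h in
/-- The regular radii form a finite union of open intervals with irregular endpoints. -/
lemma exists_finset_components : ∃ T : Finset (ℝ × ℝ),
    (∀ z ∈ T, z.1 < z.2 ∧ z.1 ∉ regularRadii p a b η ∧ z.2 ∉ regularRadii p a b η ∧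
      Ioo z.1 z.2 ⊆ regularRadii p a b η) ∧
    ∀ r ∈ regularRadii p a b η, (leftEnd p a b η r, rightEnd p a b η r) ∈ T := by
  have hfin : ((fun C : Set ℝ => (sInf C, sSup C)) ''
      (connectedComponentIn (regularRadii p a b η) '' regularRadii p a b η)).Finite :=
    h.degenerate.2.image _
  refine ⟨hfin.toFinset, ?_, fun r hr => ?_⟩
  · intro z hz
    rw [Finite.mem_toFinset] at hz
    obtain ⟨_, ⟨r, hr, rfl⟩, rfl⟩ := hz
    exact ⟨(mem_Ioo_ends hr).1.trans (mem_Ioo_ends hr).2, leftEnd_notMem hr, rightEnd_notMem hr,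
      Ioo_ends_subset hr⟩
  · rw [Finite.mem_toFinset]
    exact ⟨_, ⟨r, hr, rfl⟩, rfl⟩

omit h in
-- If two overlapping intervals differed, an endpoint of one would lie inside the other, hence in I.
-- This is the disjointness of the components.
lemma eq_of_mem_Ioo_of_notMem {I : Set ℝ} {z z' : ℝ × ℝ} {r : ℝ} (hr : r ∈ Ioo z.1 z.2)
    (hr' : r ∈ Ioo z'.1 z'.2) (h1 : z.1 ∉ I) (h2 : z.2 ∉ I) (h1' : z'.1 ∉ I) (h2' : z'.2 ∉ I)
    (hs : Ioo z.1 z.2 ⊆ I) (hs' : Ioo z'.1 z'.2 ⊆ I) : z = z' := by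
  refine Prod.ext (le_antisymm ?_ ?_) (le_antisymm ?_ ?_) <;> by_contra! hlt
  · exact h1 (hs' ⟨hlt, hr.1.trans hr'.2⟩)
  · exact h1' (hs ⟨hlt, hr'.1.trans hr.2⟩)
  · exact h2' (hs ⟨hr.1.trans hr'.2, hlt⟩)
  · exact h2 (hs' ⟨hr'.1.trans hr.2, hlt⟩)

end Components

end Setting

end RadialWeight

/-! ### The domain, shell integrals and the auxiliary measure -/

namespace RadialWeight

open Filter

namespace Setting

variable {d : ℕ} {p a b : ℝ} {η : ℝ → ℝ} {Ω : Set (Space d)} (h : Setting d p a b η Ω)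

include h

section Domain

lemma regularSet_eq : regularSet p a b η Ω = {x | ‖x‖ ∈ regularRadii p a b η} := by
  ext x
  refine ⟨fun hx => hx.2, fun hx => ⟨?_, hx⟩⟩
  have := hx.1
  rcases h.domain with hΩ | hΩ
  · rw [hΩ]; exact this.2
  · rw [hΩ]; exact this

lemma regularSet_subset : regularSet p a b η Ω ⊆ Ω := fun _ hx => hx.1

lemma isOpen_regularSet : IsOpen (regularSet p a b η Ω) := by
  rw [h.regularSet_eq]
  exact isOpen_regularRadii.preimage continuous_norm

lemma isOpen_domain : IsOpen Ω := by
  rcases h.domain with hΩ | hΩ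
  · rw [hΩ]; exact isOpen_lt continuous_norm continuous_const
  · rw [hΩ]
    exact (isOpen_lt continuous_const continuous_norm).inter
      (isOpen_lt continuous_norm continuous_const)

lemma domain_subset_ball : Ω ⊆ Metric.ball 0 b := fun x hx => by
  rw [mem_ball_zero_iff]
  rcases h.domain with hΩ | hΩ
  · rw [hΩ] at hx; exact hx
  · rw [hΩ] at hx; exact hx.2

lemma volume_domain_lt_top : volume Ω < ⊤ :=
  (measure_mono h.domain_subset_ball).trans_lt measure_ball_lt_top

lemma norm_isometry_mem_domain (R : Space d ≃ₗᵢ[ℝ] Space d) : R ⁻¹' Ω = Ω := by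
  ext x
  rcases h.domain with hΩ | hΩ <;> simp [hΩ, R.norm_map]

lemma preimage_isometry_regularSet (R : Space d ≃ₗᵢ[ℝ] Space d) :
    R ⁻¹' regularSet p a b η Ω = regularSet p a b η Ω := by
  ext x
  simp [h.regularSet_eq, R.norm_map]

lemma ae_norm {P : ℝ → Prop} (hP : ∀ᵐ r ∂volume.restrict (Ioi (0 : ℝ)), P r) :
    ∀ᵐ x : Space d, P ‖x‖ := by
  have := h.nontrivial_space
  exact ae_norm_of_ae volume hP

lemma ae_regularSet {P : ℝ → Prop} (hP : ∀ᵐ r ∂volume.restrict (regularRadii p a b η), P r) :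
    ∀ᵐ x ∂volume.restrict (regularSet p a b η Ω), P ‖x‖ := by
  rw [ae_restrict_iff' isOpen_regularRadii.measurableSet] at hP
  rw [ae_restrict_iff' h.isOpen_regularSet.measurableSet, h.regularSet_eq]
  exact h.ae_norm (P := fun r => r ∈ regularRadii p a b η → P r) (ae_restrict_of_ae hP)

lemma aemeasurable_comp_norm {β : Type*} [MeasurableSpace β] {f : ℝ → β}
    (hf : AEMeasurable f (volume.restrict (Ioi 0))) :
    AEMeasurable (fun x : Space d => f ‖x‖) volume := by
  have := h.nontrivial_space
  exact hf.comp_quasiMeasurePreserving (quasiMeasurePreserving_norm volume)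

lemma aemeasurable_weight : AEMeasurable (fun x : Space d => ENNReal.ofReal (η ‖x‖)) volume :=
  (h.aemeasurable_comp_norm h.aemeasurable).ennreal_ofReal

lemma ae_weight_norm_pos : ∀ᵐ x ∂volume.restrict (regularSet p a b η Ω), 0 < η ‖x‖ :=
  h.ae_regularSet h.ae_weight_pos

lemma finrank_space : Module.finrank ℝ (Space d) = d := by simp

/-- The compact subsets of `I_{Ω, w}` carry a finite amount of `η^{-1/(p-1)}`. -/
lemma lintegral_invWeight_norm_lt_top {K : Set (Space d)} (hK : IsCompact K)
    (hKS : K ⊆ regularSet p a b η Ω) : ∫⁻ x in K, invWeight p η ‖x‖ < ⊤ := by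
  have := h.nontrivial_space
  set L : Set ℝ := (fun x : Space d => ‖x‖) '' K with hL
  have hLc : IsCompact L := hK.image continuous_norm
  have hLI : L ⊆ regularRadii p a b η := by
    rintro _ ⟨x, hx, rfl⟩
    exact (hKS hx).2
  have hL0 := hLI.trans h.regularRadii_subset_Ioi
  refine (lintegral_mono_set (fun x hx => show x ∈ {x : Space d | ‖x‖ ∈ L} from
    ⟨x, hx, rfl⟩)).trans_lt ?_
  rw [setLIntegral_fun_norm_addHaar volume hLc.measurableSet hL0
    (h.aemeasurable_invWeight.mono_measure (Measure.restrict_mono hL0 le_rfl))]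
  refine ENNReal.mul_lt_top (toSphere_univ_ne_top _).lt_top ?_
  refine lt_of_le_of_lt (setLIntegral_mono_ae' (g := fun r => ENNReal.ofReal (b ^ (Module.finrank ℝ
    (Space d) - 1)) * invWeight p η r) hLc.measurableSet (Eventually.of_forall fun r hr => ?_)) ?_
  · have h1 : 0 < r := hL0 hr
    have h2 : r < b := (hLI hr).1.2
    gcongr
  · rw [lintegral_const_mul' _ _ ENNReal.ofReal_ne_top]
    exact ENNReal.mul_lt_top ENNReal.ofReal_lt_top (lintegral_invWeight_lt_top hLc hLI)

end Domain

section ShellIntegral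

omit h in
lemma shellIntegral_mono {s t s' t' : ℝ} (hs : s' ≤ s) (ht : t ≤ t') :
    shellIntegral p a b η Ω s t ≤ shellIntegral p a b η Ω s' t' :=
  lintegral_mono_set fun _ hy => ⟨hy.1, hs.trans_lt hy.2.1, hy.2.2.trans_le ht⟩

/-- The integrand is a negative power of a finite quantity, so it vanishes nowhere, and the shell is
a nonempty open set. -/
lemma shellIntegral_pos {s t : ℝ} (hst : s < t) (hI : Ioo s t ⊆ regularRadii p a b η) :
    0 < shellIntegral p a b η Ω s t := by
  have := h.nontrivial_space
  have hset : {y : Space d | y ∈ regularSet p a b η Ω ∧ s < ‖y‖ ∧ ‖y‖ < t} =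
      {y : Space d | ‖y‖ ∈ Ioo s t} := by
    ext y
    refine ⟨fun hy => hy.2, fun hy => ⟨?_, hy⟩⟩
    rw [h.regularSet_eq]
    exact hI hy
  rw [shellIntegral, hset, pos_iff_ne_zero]
  intro h0
  have hopen : IsOpen {y : Space d | ‖y‖ ∈ Ioo s t} := isOpen_Ioo.preimage continuous_norm
  have hm : AEMeasurable (fun y : Space d =>
      ENNReal.ofReal (‖y‖ ^ (((d : ℝ) - 1) * p) * η ‖y‖) ^ (-(1 / (p - 1))))
      (volume.restrict {y : Space d | ‖y‖ ∈ Ioo s t}) := by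
    refine AEMeasurable.restrict (AEMeasurable.pow_const (AEMeasurable.ennreal_ofReal ?_) _)
    exact (measurable_norm.pow_const _).aemeasurable.mul (h.aemeasurable_comp_norm h.aemeasurable)
  rw [lintegral_eq_zero_iff' hm, EventuallyEq, ae_restrict_iff' hopen.measurableSet] at h0
  have hnull : volume {y : Space d | ‖y‖ ∈ Ioo s t} = 0 := by
    refine measure_mono_null (fun y hy => ?_) (ae_iff.1 h0)
    rw [mem_ofPred_eq, Classical.not_imp]
    refine ⟨hy, fun h1 => ?_⟩
    rw [Pi.zero_apply, ENNReal.rpow_eq_zero_iff] at h1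
    rcases h1 with h1 | h1
    · linarith [h.exponent_pos, h1.2]
    · exact ENNReal.ofReal_ne_top h1.1
  refine (hopen.measure_pos volume ?_).ne' hnull
  have hm : (s + t) / 2 ∈ Ioo s t := ⟨by linarith, by linarith⟩
  obtain ⟨y, hy⟩ := _root_.exists_norm_eq (Space d) (h.regularRadii_subset_Ioi (hI hm)).le
  exact ⟨y, show ‖y‖ ∈ Ioo s t by rwa [hy]⟩

/-- On a closed shell |y| is bounded below by s > 0, so the integrand is at most a constant times
η^{-1/(p-1)}, which is summable over compact sets of regular radii. -/
lemma shellIntegral_lt_top {s t : ℝ} (hI : Icc s t ⊆ regularRadii p a b η) :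
    shellIntegral p a b η Ω s t < ⊤ := by
  have := h.nontrivial_space
  rcases lt_or_ge t s with hts | hst
  · have : {y : Space d | y ∈ regularSet p a b η Ω ∧ s < ‖y‖ ∧ ‖y‖ < t} = ∅ := by
      ext y
      simp only [mem_ofPred_eq, mem_empty_iff_false, iff_false, not_and]
      intro _ h1 h2
      linarith
    simp [shellIntegral, this]
  have hs0 : 0 < s := h.regularRadii_subset_Ioi (hI (left_mem_Icc.2 hst))
  have hKc : IsCompact {y : Space d | ‖y‖ ∈ Icc s t} := isCompact_setOf_norm_mem isCompact_Icc
  have hKS : {y : Space d | ‖y‖ ∈ Icc s t} ⊆ regularSet p a b η Ω := by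
    rw [h.regularSet_eq]
    exact fun y hy => hI hy
  have hexp : 0 ≤ ((d : ℝ) - 1) * p := by
    have h1 : (1 : ℝ) ≤ d := by exact_mod_cast h.one_le
    have := h.one_lt
    exact mul_nonneg (by linarith) (by linarith)
  set m : ℝ := s ^ (((d : ℝ) - 1) * p) with hm
  have hm0 : 0 < m := Real.rpow_pos_of_pos hs0 _
  refine (lintegral_mono_set (fun y hy => show y ∈ {y : Space d | ‖y‖ ∈ Icc s t} from
    ⟨hy.2.1.le, hy.2.2.le⟩)).trans_lt ?_
  refine lt_of_le_of_lt (setLIntegral_mono_ae' (g := fun y : Space d =>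
    ENNReal.ofReal m ^ (-(1 / (p - 1))) * invWeight p η ‖y‖) hKc.measurableSet
    (Eventually.of_forall fun y hy => ?_)) ?_
  · rw [invWeight, ← ENNReal.mul_rpow_of_ne_top ENNReal.ofReal_ne_top ENNReal.ofReal_ne_top,
      ENNReal.ofReal_mul (by positivity)]
    rw [ENNReal.rpow_neg, ENNReal.rpow_neg]
    refine ENNReal.inv_le_inv.2 (ENNReal.rpow_le_rpow ?_ h.exponent_pos.le)
    gcongr
    exact Real.rpow_le_rpow hs0.le hy.1 hexp
  · have htop : ENNReal.ofReal m ^ (-(1 / (p - 1))) ≠ ⊤ :=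
      ENNReal.rpow_ne_top_of_ne_zero (by simpa using hm0) ENNReal.ofReal_ne_top
    rw [lintegral_const_mul' _ _ htop]
    exact ENNReal.mul_lt_top htop.lt_top (h.lintegral_invWeight_norm_lt_top hKc hKS)

end ShellIntegral

section AuxMeasure

omit h in
lemma auxWeight_of_notMem {x : Space d} (hx : x ∉ regularSet p a b η Ω) :
    auxWeight p a b η Ω x = 0 := by
  simp only [auxWeight, if_neg hx]

lemma auxWeight_isometry (R : Space d ≃ₗᵢ[ℝ] Space d) (x : Space d) :
    auxWeight p a b η Ω (R x) = auxWeight p a b η Ω x := by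
  have : R x ∈ regularSet p a b η Ω ↔ x ∈ regularSet p a b η Ω := by
    rw [← mem_preimage, h.preimage_isometry_regularSet]
  by_cases hx : x ∈ regularSet p a b η Ω
  · simp only [auxWeight, R.norm_map, if_pos hx, if_pos (this.2 hx)]
  · simp only [auxWeight, if_neg hx, if_neg fun hx' => hx (this.1 hx')]

/-- The weight depends on |x| only and isometries preserve Lebesgue measure. Composition with R
thereby acts on X without changing norms. -/
lemma measurePreserving_auxMeasure (R : Space d ≃ₗᵢ[ℝ] Space d) :
    MeasurePreserving R (auxMeasure p a b η Ω) (auxMeasure p a b η Ω) := by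
  have hR : MeasurePreserving R (volume.restrict Ω) (volume.restrict Ω) := by
    have := (measurePreserving_isometry R).restrict_preimage h.isOpen_domain.measurableSet
    rwa [h.norm_isometry_mem_domain] at this
  have hemb : MeasurableEmbedding R := R.toHomeomorph.measurableEmbedding
  refine ⟨R.continuous.measurable, Measure.ext fun s hs => ?_⟩
  rw [Measure.map_apply R.continuous.measurable hs, auxMeasure, withDensity_apply _ hs,
    withDensity_apply _ (R.continuous.measurable hs), ← hR.setLIntegral_comp_preimage_emb hemb
      (fun x => auxWeight p a b η Ω x ^ (p - 1)) s]
  simp only [h.auxWeight_isometry]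

/-- In each of the three cases the shell contains a fixed one with endpoints among the midpoint and
quarter points of the component, so its reciprocal is bounded on that component. Finiteness of the
number of components makes the bound uniform; the sum over components serves as a maximum. -/
lemma exists_auxWeight_le : ∃ M : ℝ≥0∞, M ≠ ⊤ ∧ ∀ x, auxWeight p a b η Ω x ≤ M := by
  obtain ⟨T, hT, hmem⟩ := h.exists_finset_components
  let B : ℝ × ℝ → ℝ≥0∞ := fun z =>
    (shellIntegral p a b η Ω ((3 * z.1 + z.2) / 4) ((z.1 + z.2) / 2))⁻¹ +
    (shellIntegral p a b η Ω ((3 * z.1 + z.2) / 4) ((z.1 + 3 * z.2) / 4))⁻¹ +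
    (shellIntegral p a b η Ω ((z.1 + z.2) / 2) ((z.1 + 3 * z.2) / 4))⁻¹
  have hB : ∀ z ∈ T, B z ≠ ⊤ := by
    intro z hz
    obtain ⟨hlt, -, -, hsub⟩ := hT z hz
    have key : ∀ s t, z.1 ≤ s → s < t → t ≤ z.2 → (shellIntegral p a b η Ω s t)⁻¹ ≠ ⊤ :=
      fun s t h1 h2 h3 => ENNReal.inv_ne_top.2
        (h.shellIntegral_pos h2 ((Ioo_subset_Ioo h1 h3).trans hsub)).ne'
    refine ENNReal.add_ne_top.2 ⟨ENNReal.add_ne_top.2 ⟨key _ _ ?_ ?_ ?_, key _ _ ?_ ?_ ?_⟩,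
      key _ _ ?_ ?_ ?_⟩ <;> linarith
  refine ⟨∑ z ∈ T, B z, ENNReal.sum_ne_top.2 hB, fun x => ?_⟩
  by_cases hx : x ∈ regularSet p a b η Ω
  swap
  · rw [auxWeight_of_notMem hx]; exact zero_le
  refine le_trans ?_ (Finset.single_le_sum (f := B) (fun _ _ => zero_le) (hmem ‖x‖ hx.2))
  have hlr := (mem_Ioo_ends hx.2).1.trans (mem_Ioo_ends hx.2).2
  simp only [auxWeight, if_pos hx, B]
  split_ifs with h1 h2
  · refine le_trans (ENNReal.inv_le_inv.2 (shellIntegral_mono h1 le_rfl)) ?_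
    rw [add_assoc]
    exact le_self_add
  · rw [add_right_comm]
    exact le_add_self
  · rw [not_lt] at h2
    exact le_trans (ENNReal.inv_le_inv.2 (shellIntegral_mono le_rfl h2)) le_add_self

/-- The auxiliary measure is dominated by Lebesgue measure on `I_{Ω, w}`. -/
lemma exists_auxMeasure_le : ∃ C : ℝ≥0∞, C ≠ ⊤ ∧
    auxMeasure p a b η Ω ≤ C • volume.restrict (regularSet p a b η Ω) := by
  obtain ⟨M, hM, hle⟩ := h.exists_auxWeight_le
  have hp : 0 < p - 1 := by linarith [h.one_lt]
  refine ⟨M ^ (p - 1), ENNReal.rpow_ne_top_of_nonneg hp.le hM, ?_⟩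
  refine Measure.le_iff.2 fun s hs => ?_
  have hS := h.isOpen_regularSet.measurableSet
  rw [auxMeasure, withDensity_apply _ hs, Measure.smul_apply, Measure.restrict_apply hs, smul_eq_mul]
  calc ∫⁻ x in s, auxWeight p a b η Ω x ^ (p - 1) ∂volume.restrict Ω
      ≤ ∫⁻ x in s, (regularSet p a b η Ω).indicator (fun _ => M ^ (p - 1)) x ∂volume.restrict Ω := by
        refine lintegral_mono fun x => ?_
        by_cases hx : x ∈ regularSet p a b η Ω
        · rw [indicator_of_mem hx]
          gcongr
          exact hle x
        · simp only [indicator_of_notMem hx]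
          rw [auxWeight_of_notMem hx, ENNReal.zero_rpow_of_pos hp]
    _ ≤ ∫⁻ x in s, (regularSet p a b η Ω).indicator (fun _ => M ^ (p - 1)) x :=
        lintegral_mono' (Measure.restrict_mono' (ae_of_all _ fun _ hx => hx) Measure.restrict_le_self)
          le_rfl
    _ = M ^ (p - 1) * volume (s ∩ regularSet p a b η Ω) := by
        rw [lintegral_indicator hS, setLIntegral_const, Measure.restrict_apply hS, inter_comm]

lemma isFiniteMeasure_auxMeasure : IsFiniteMeasure (auxMeasure p a b η Ω) := by
  obtain ⟨C, hC, hle⟩ := h.exists_auxMeasure_le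
  refine ⟨(hle univ).trans_lt ?_⟩
  rw [Measure.smul_apply, Measure.restrict_apply_univ, smul_eq_mul]
  exact ENNReal.mul_lt_top hC.lt_top
    ((measure_mono h.regularSet_subset).trans_lt h.volume_domain_lt_top)

lemma auxMeasure_absolutelyContinuous :
    auxMeasure p a b η Ω ≪ volume.restrict (regularSet p a b η Ω) := by
  obtain ⟨C, hC, hle⟩ := h.exists_auxMeasure_le
  exact (Measure.absolutelyContinuous_of_le hle).trans Measure.smul_absolutelyContinuous

/-- For |x| near r, all three shells lie in one slightly larger shell (s₁, t₁) that stays away from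
the ends of the component. Its integral is finite, and the reciprocal is the lower bound. -/
lemma exists_le_auxWeight {r : ℝ} (hr : r ∈ regularRadii p a b η) :
    ∃ c : ℝ≥0∞, c ≠ 0 ∧ c ≠ ⊤ ∧ ∃ s t : ℝ, r ∈ Ioo s t ∧ Ioo s t ⊆ regularRadii p a b η ∧
      ∀ x : Space d, ‖x‖ ∈ Ioo s t → c ≤ auxWeight p a b η Ω x := by
  set α := leftEnd p a b η r with hα
  set β := rightEnd p a b η r with hβ
  have hlr : r ∈ Ioo α β := mem_Ioo_ends hr
  have hsub : Ioo α β ⊆ regularRadii p a b η := Ioo_ends_subset hr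
  have hαβ : α < β := hlr.1.trans hlr.2
  set s := (α + r) / 2
  set t := (r + β) / 2
  set s₁ := min s ((3 * α + β) / 4)
  set t₁ := max t ((α + 3 * β) / 4)
  have hs₁ : α < s₁ := lt_min (by simp only [s]; linarith [hlr.1]) (by linarith)
  have ht₁ : t₁ < β := max_lt (by simp only [t]; linarith [hlr.2]) (by linarith)
  have hst : Ioo s t ⊆ Ioo α β := Ioo_subset_Ioo (by simp only [s]; linarith [hlr.1])
    (by simp only [t]; linarith [hlr.2])
  have hs₁t₁ : s₁ < t₁ := calc
    s₁ ≤ s := min_le_left _ _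
    _ < t := by simp only [s, t]; linarith [hlr.1, hlr.2]
    _ ≤ t₁ := le_max_left _ _
  refine ⟨(shellIntegral p a b η Ω s₁ t₁)⁻¹, ENNReal.inv_ne_zero.2
    (h.shellIntegral_lt_top ((Icc_subset_Ioo hs₁ ht₁).trans hsub)).ne, ENNReal.inv_ne_top.2
    (h.shellIntegral_pos hs₁t₁ ((Ioo_subset_Ioo hs₁.le ht₁.le).trans hsub)).ne', s, t,
    ⟨by simp only [s]; linarith [hlr.1], by simp only [t]; linarith [hlr.2]⟩, hst.trans hsub,
    fun x hx => ?_⟩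
  have hxI := hsub (hst hx)
  have hxS : x ∈ regularSet p a b η Ω := by
    rw [h.regularSet_eq]
    exact hxI
  have hends : (leftEnd p a b η ‖x‖, rightEnd p a b η ‖x‖) = (α, β) :=
    eq_of_mem_Ioo_of_notMem (mem_Ioo_ends hxI) (hst hx) (leftEnd_notMem hxI) (rightEnd_notMem hxI)
      (leftEnd_notMem hr) (rightEnd_notMem hr) (Ioo_ends_subset hxI) hsub
  rw [Prod.mk.injEq] at hends
  have e1 : s₁ ≤ s := min_le_left _ _
  have e2 : s₁ ≤ (3 * α + β) / 4 := min_le_right _ _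
  have e3 : t ≤ t₁ := le_max_left _ _
  have e4 : (α + 3 * β) / 4 ≤ t₁ := le_max_right _ _
  simp only [auxWeight, if_pos hxS, hends.1, hends.2]
  split_ifs with h1 h2 <;> refine ENNReal.inv_le_inv.2 (shellIntegral_mono ?_ ?_) <;>
    linarith [hx.1, hx.2]

/-- Lebesgue measure on compact subsets of `I_{Ω, w}` is dominated by the auxiliary measure. -/
lemma exists_restrict_le_auxMeasure {K : Set (Space d)} (hK : IsCompact K)
    (hKS : K ⊆ regularSet p a b η Ω) :
    ∃ C : ℝ≥0∞, C ≠ ⊤ ∧ volume.restrict K ≤ C • auxMeasure p a b η Ω := by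
  refine hK.induction_on
    (p := fun K => ∃ C : ℝ≥0∞, C ≠ ⊤ ∧ volume.restrict K ≤ C • auxMeasure p a b η Ω)
    ⟨0, by simp, by simp⟩ (fun s t hst ⟨C, hC, hle⟩ =>
      ⟨C, hC, (Measure.restrict_mono hst le_rfl).trans hle⟩) ?_ fun x hx => ?_
  · rintro s t ⟨C, hC, hle⟩ ⟨C', hC', hle'⟩
    refine ⟨C + C', ENNReal.add_ne_top.2 ⟨hC, hC'⟩, (Measure.restrict_union_le s t).trans ?_⟩
    rw [add_smul]
    exact add_le_add hle hle'
  · obtain ⟨c, hc, hctop, s, t, hr, hst, hle⟩ := h.exists_le_auxWeight (hKS hx).2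
    have hp : 0 < p - 1 := by linarith [h.one_lt]
    have hopen : IsOpen {x : Space d | ‖x‖ ∈ Ioo s t} := isOpen_Ioo.preimage continuous_norm
    refine ⟨_, mem_nhdsWithin_of_mem_nhds (hopen.mem_nhds hr), (c ^ (p - 1))⁻¹, ?_, ?_⟩
    · rw [ENNReal.inv_ne_top]
      exact (ENNReal.rpow_pos_of_nonneg (pos_iff_ne_zero.2 hc) hp.le).ne'
    · have hsubΩ : {x : Space d | ‖x‖ ∈ Ioo s t} ⊆ Ω := fun y hy => by
        refine h.regularSet_subset ?_
        rw [h.regularSet_eq]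
        exact hst hy
      refine Measure.le_iff.2 fun A hA => ?_
      rw [Measure.smul_apply, smul_eq_mul, Measure.restrict_apply hA, auxMeasure,
        withDensity_apply _ hA, mul_comm, ← div_eq_mul_inv]
      rw [ENNReal.le_div_iff_mul_le (Or.inl (ENNReal.rpow_pos_of_nonneg (pos_iff_ne_zero.2 hc)
        hp.le).ne') (Or.inl (ENNReal.rpow_ne_top_of_nonneg hp.le hctop)), mul_comm]
      calc c ^ (p - 1) * volume (A ∩ {x : Space d | ‖x‖ ∈ Ioo s t})
          = ∫⁻ _ in A ∩ {x : Space d | ‖x‖ ∈ Ioo s t}, c ^ (p - 1) := by rw [setLIntegral_const]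
        _ ≤ ∫⁻ x in A ∩ {x : Space d | ‖x‖ ∈ Ioo s t}, auxWeight p a b η Ω x ^ (p - 1) := by
            refine setLIntegral_mono_ae' (hA.inter hopen.measurableSet)
              (Eventually.of_forall fun x hx => ?_)
            gcongr
            exact hle x hx.2
        _ ≤ ∫⁻ x in A, auxWeight p a b η Ω x ^ (p - 1) ∂volume.restrict Ω := by
            rw [Measure.restrict_restrict hA]
            exact lintegral_mono_set (inter_subset_inter_right _ hsubΩ)

end AuxMeasure

end Setting

end RadialWeight

open Filter

/-! ### Minimization over closed convex relations -/

section ClosedRelation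

variable {E : Type*} [NormedAddCommGroup E] [InnerProductSpace ℝ E] [FiniteDimensional ℝ E]
  {α : Type*} [MeasurableSpace α] {μ ν : Measure α} {p : ℝ} [Fact (1 ≤ ENNReal.ofReal p)]
  {Γ : Set (Lp ℝ (ENNReal.ofReal p) μ × Lp E (ENNReal.ofReal p) ν)}

lemma norm_midpoint_le {F : Type*} [SeminormedAddCommGroup F] [NormedSpace ℝ F] (x y : F) :
    ‖(1 / 2 : ℝ) • (x + y)‖ ≤ (‖x‖ + ‖y‖) / 2 := by
  rw [norm_smul]
  have := norm_add_le x y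
  norm_num
  linarith

lemma Lp_norm_midpoint_rpow_le (hp : 1 < p) (f g : Lp E (ENNReal.ofReal p) ν) :
    ‖(1 / 2 : ℝ) • (f + g)‖ ^ p ≤ (‖f‖ ^ p + ‖g‖ ^ p) / 2 := by
  have h1 := norm_midpoint_le f g
  have h2 := norm_midpoint_rpow_le hp ‖f‖ ‖g‖
  rw [norm_norm, norm_norm] at h2
  refine le_trans (Real.rpow_le_rpow (norm_nonneg _) ?_ (by linarith)) h2
  rw [Real.norm_of_nonneg (by positivity), smul_eq_mul]
  linarith

lemma midpoint_sub_eq {F : Type*} [AddCommGroup F] [Module ℝ F] (x y z : F) :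
    (1 / 2 : ℝ) • (x + y) - z = (1 / 2 : ℝ) • ((x - z) + (y - z)) := by
  have : z = (1 / 2 : ℝ) • (z + z) := by
    rw [← two_smul ℝ z, smul_smul]; norm_num
  conv_lhs => rw [this]
  rw [← smul_sub]
  congr 1
  abel

/-- A substitute for weak closedness. The V of norm at most R that are related to some y within
1/(n+1) of u form decreasing midpoint convex sets. A convergent selection from them brings along
first components tending to u, and closedness of Γ applies to the limit. -/
lemma exists_mem_of_tendsto_of_norm_le (hp : 1 < p) (hΓ : IsClosed Γ)
    (hmid : ∀ x ∈ Γ, ∀ y ∈ Γ, (1 / 2 : ℝ) • (x + y) ∈ Γ) {R : ℝ}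
    {z : ℕ → Lp ℝ (ENNReal.ofReal p) μ} {u : Lp ℝ (ENNReal.ofReal p) μ}
    (hz : Tendsto z atTop (𝓝 u)) (hR : ∀ᶠ n in atTop, ∃ V, (z n, V) ∈ Γ ∧ ‖V‖ ≤ R) :
    ∃ V, (u, V) ∈ Γ ∧ ‖V‖ ≤ R := by
  let C : ℕ → Set (Lp E (ENNReal.ofReal p) ν) := fun n =>
    {V | ∃ y, ‖y - u‖ ≤ 1 / ((n : ℝ) + 1) ∧ (y, V) ∈ Γ ∧ ‖V‖ ≤ R}
  obtain ⟨V, hV, l, hl⟩ := Lp_exists_convergent_selection hp C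
    (fun m n hmn V ⟨y, hy, h⟩ => ⟨y, hy.trans (by gcongr), h⟩)
    (fun n f ⟨y, hy, hyΓ, hf⟩ g ⟨y', hy', hyΓ', hg⟩ => by
      refine ⟨(1 / 2 : ℝ) • (y + y'), ?_, hmid _ hyΓ _ hyΓ', ?_⟩
      · rw [midpoint_sub_eq]
        linarith [norm_midpoint_le (y - u) (y' - u)]
      · linarith [norm_midpoint_le f g]) R
    (fun n => by
      have h1 : ∀ᶠ k in atTop, ‖z k - u‖ < 1 / ((n : ℝ) + 1) := by
        have := tendsto_iff_norm_sub_tendsto_zero.1 hz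
        exact this.eventually (gt_mem_nhds (by positivity))
      obtain ⟨k, hk, V, hV, hVR⟩ := (h1.and hR).exists
      exact ⟨V, ⟨z k, hk.le, hV, hVR⟩, hVR⟩)
  choose y hy hyΓ hVR using hV
  have hyu : Tendsto y atTop (𝓝 u) := by
    rw [tendsto_iff_norm_sub_tendsto_zero]
    exact squeeze_zero (fun _ => norm_nonneg _) hy tendsto_one_div_add_atTop_nhds_zero_nat
  exact ⟨l, hΓ.mem_of_tendsto (hyu.prodMk_nhds hl) (Eventually.of_forall hyΓ),
    le_of_tendsto hl.norm (Eventually.of_forall hVR)⟩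

/-- Existence for the problem of minimizing `‖V‖ ^ p + ‖u - g‖` over a closed convex relation. -/
lemma exists_forall_norm_rpow_add_norm_sub_le (hp : 1 < p) (hΓ : IsClosed Γ) (hne : Γ.Nonempty)
    (hmid : ∀ x ∈ Γ, ∀ y ∈ Γ, (1 / 2 : ℝ) • (x + y) ∈ Γ)
    (huniq : ∀ u V V', (u, V) ∈ Γ → (u, V') ∈ Γ → V = V') (g : Lp ℝ (ENNReal.ofReal p) μ) :
    ∃ x ∈ Γ, ∀ y ∈ Γ, ‖x.2‖ ^ p + ‖x.1 - g‖ ≤ ‖y.2‖ ^ p + ‖y.1 - g‖ := by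
  have hp0 : 0 < p := by linarith
  set J : Lp ℝ (ENNReal.ofReal p) μ × Lp E (ENNReal.ofReal p) ν → ℝ :=
    fun x => ‖x.2‖ ^ p + ‖x.1 - g‖ with hJ
  have hJ0 : ∀ x, 0 ≤ J x := fun x => by positivity
  set m := sInf (J '' Γ) with hm
  have hbdd : BddBelow (J '' Γ) := ⟨0, by rintro _ ⟨x, -, rfl⟩; exact hJ0 x⟩
  have hmle : ∀ x ∈ Γ, m ≤ J x := fun x hx => csInf_le hbdd ⟨x, hx, rfl⟩
  have hm0 : 0 ≤ m := le_csInf (hne.image J) (by rintro _ ⟨x, -, rfl⟩; exact hJ0 x)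
  -- The selection is made among first components of almost minimizers. They are bounded because the
  -- functional contains ‖u - g‖.
  let D : ℕ → Set (Lp ℝ (ENNReal.ofReal p) μ) := fun n =>
    {u | ∃ V, (u, V) ∈ Γ ∧ J (u, V) ≤ m + 1 / ((n : ℝ) + 1)}
  obtain ⟨u, hu, l, hl⟩ := Lp_exists_convergent_selection hp D
    (fun k n hkn u ⟨V, hV, h⟩ => ⟨V, hV, h.trans (by gcongr)⟩)
    (fun n f ⟨V, hV, hf⟩ f' ⟨V', hV', hf'⟩ => by
      refine ⟨(1 / 2 : ℝ) • (V + V'), hmid _ hV _ hV', ?_⟩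
      simp only [hJ, midpoint_sub_eq] at hf hf' ⊢
      linarith [norm_midpoint_le (f - g) (f' - g), Lp_norm_midpoint_rpow_le hp V V'])
    (m + 1 + ‖g‖)
    (fun n => by
      obtain ⟨_, ⟨x, hx, rfl⟩, hlt⟩ := exists_lt_of_csInf_lt (hne.image J)
        (show sInf (J '' Γ) < m + 1 / ((n : ℝ) + 1) from lt_add_of_pos_right _ (by positivity))
      refine ⟨x.1, ⟨x.2, hx, hlt.le⟩, ?_⟩
      have h1 : 1 / ((n : ℝ) + 1) ≤ 1 := by
        rw [div_le_one (by positivity)]; linarith [n.cast_nonneg (α := ℝ)]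
      have h2 : ‖x.1‖ ≤ ‖x.1 - g‖ + ‖g‖ := by
        simpa using norm_add_le (x.1 - g) g
      have h3 : 0 ≤ ‖x.2‖ ^ p := by positivity
      simp only [hJ] at hlt
      linarith)
  choose V hV hVm using hu
  -- Along the selection ‖V n‖^p is eventually at most m + δ - ‖l - g‖, and the bound passes to some
  -- W related to l. A priori W depends on δ; `huniq` makes it the same for all δ, so δ can tend to
  -- zero.
  have hlim : ∀ δ > 0, ∃ W, (l, W) ∈ Γ ∧ ‖W‖ ≤ (m + δ - ‖l - g‖) ^ (1 / p) ∧
      0 ≤ m + δ - ‖l - g‖ := by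
    intro δ hδ
    have h1 : ∀ᶠ n : ℕ in atTop, 1 / ((n : ℝ) + 1) < δ / 2 :=
      tendsto_one_div_add_atTop_nhds_zero_nat.eventually (gt_mem_nhds (by positivity))
    have h2 : ∀ᶠ n in atTop, ‖l - g‖ - δ / 2 < ‖u n - g‖ :=
      (hl.sub_const g).norm.eventually (lt_mem_nhds (by linarith))
    have h3 : ∀ᶠ n in atTop, ‖V n‖ ^ p ≤ m + δ - ‖l - g‖ := by
      filter_upwards [h1, h2] with n hn hn'
      have := hVm n
      simp only [hJ] at this
      linarith
    have h0 : 0 ≤ m + δ - ‖l - g‖ := by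
      obtain ⟨n, hn⟩ := h3.exists
      exact le_trans (by positivity) hn
    obtain ⟨W, hW, hW'⟩ := exists_mem_of_tendsto_of_norm_le hp hΓ hmid
      (R := (m + δ - ‖l - g‖) ^ (1 / p)) hl (h3.mono fun n hn => ⟨V n, hV n, by
        rw [one_div, Real.le_rpow_inv_iff_of_pos (norm_nonneg _) h0 hp0]
        exact hn⟩)
    exact ⟨W, hW, hW', h0⟩
  obtain ⟨W, hW, -⟩ := hlim 1 one_pos
  refine ⟨(l, W), hW, fun y hy => le_trans ?_ (hmle y hy)⟩
  refine le_of_forall_pos_le_add fun δ hδ => ?_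
  obtain ⟨W', hW', hle, h0⟩ := hlim δ hδ
  rw [huniq l W W' hW hW']
  rw [one_div, Real.le_rpow_inv_iff_of_pos (norm_nonneg _) h0 hp0] at hle
  simp only
  linarith

/-- Uniqueness for the problem of minimizing `‖V‖ ^ p + ‖u - g‖` over a convex relation. -/
lemma eq_of_forall_norm_rpow_add_norm_sub_le (hp : 1 < p)
    (hmid : ∀ x ∈ Γ, ∀ y ∈ Γ, (1 / 2 : ℝ) • (x + y) ∈ Γ) (g : Lp ℝ (ENNReal.ofReal p) μ)
    {x x' : Lp ℝ (ENNReal.ofReal p) μ × Lp E (ENNReal.ofReal p) ν} (hx : x ∈ Γ) (hx' : x' ∈ Γ)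
    (hmin : ∀ y ∈ Γ, ‖x.2‖ ^ p + ‖x.1 - g‖ ≤ ‖y.2‖ ^ p + ‖y.1 - g‖)
    (hmin' : ∀ y ∈ Γ, ‖x'.2‖ ^ p + ‖x'.1 - g‖ ≤ ‖y.2‖ ^ p + ‖y.1 - g‖) : x.1 = x'.1 := by
  have h1 := hmin x' hx'
  have h2 := hmin' x hx
  have h3 := hmin _ (hmid x hx x' hx')
  simp only [Prod.smul_snd, Prod.snd_add, Prod.smul_fst, Prod.fst_add, midpoint_sub_eq] at h3
  have h4 := Lp_norm_midpoint_rpow_le hp x.2 x'.2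
  have h5 := norm_midpoint_le (x.1 - g) (x'.1 - g)
  -- Minimality at the midpoint leaves no convexity gap in the p-th power term, so the second
  -- components agree. The distances to g are then equal, and the midpoint is no closer to g, which
  -- is the equality case of strict convexity for the first components.
  have h6 : x.2 = x'.2 := Lp_eq_of_norm_midpoint_rpow hp (by linarith)
  have h7 : ‖x.1 - g‖ = ‖x'.1 - g‖ := by rw [h6] at h1 h2; linarith
  have h8 : ‖x.1 - g‖ ≤ ‖(1 / 2 : ℝ) • ((x.1 - g) + (x'.1 - g))‖ := by linarith
  have h9 : x.1 - g = x'.1 - g := Lp_eq_of_norm_midpoint_rpow hp (by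
    rw [← h7]
    have := Real.rpow_le_rpow (norm_nonneg _) h8 (show 0 ≤ p by linarith)
    linarith)
  exact sub_left_injective h9

end ClosedRelation

/-! ### The graph of the weighted gradient -/

namespace RadialWeight

open Filter

/-- The measure `w dx` on `I_{Ω, w}`. -/
noncomputable def gradMeasure {d : ℕ} (p a b : ℝ) (η : ℝ → ℝ) (Ω : Set (Space d)) :
    Measure (Space d) :=
  (volume.restrict (regularSet p a b η Ω)).withDensity fun x => ENNReal.ofReal (η ‖x‖)

/-- The space `L^p(I_{Ω, w}, w dx)` of vector fields. -/
abbrev GradSpace {d : ℕ} (p a b : ℝ) (η : ℝ → ℝ) (Ω : Set (Space d)) : Type :=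
  Lp (Space d) (ENNReal.ofReal p) (gradMeasure p a b η Ω)

/-- The pairs `(u, ∇u)` of finite energy. -/
def gradGraph {d : ℕ} (p a b : ℝ) (η : ℝ → ℝ) (Ω : Set (Space d)) :
    Set (X p a b η Ω × GradSpace p a b η Ω) :=
  {z | HasWeakGradientOn (regularSet p a b η Ω) z.1 z.2}

namespace Setting

variable {d : ℕ} {p a b : ℝ} {η : ℝ → ℝ} {Ω : Set (Space d)} (h : Setting d p a b η Ω)

section Measures

include h

lemma lintegral_gradMeasure (f : Space d → ℝ≥0∞) :
    ∫⁻ x, f x ∂gradMeasure p a b η Ω =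
      ∫⁻ x in regularSet p a b η Ω, f x * ENNReal.ofReal (η ‖x‖) := by
  rw [gradMeasure, lintegral_withDensity_eq_lintegral_mul_non_measurable₀ _
    h.aemeasurable_weight.restrict (ae_of_all _ fun _ => ENNReal.ofReal_lt_top)]
  simp only [Pi.mul_apply, mul_comm]

lemma absolutelyContinuous_gradMeasure :
    volume.restrict (regularSet p a b η Ω) ≪ gradMeasure p a b η Ω := by
  refine withDensity_absolutelyContinuous' h.aemeasurable_weight.restrict ?_
  filter_upwards [h.ae_weight_norm_pos] with x hx
  simpa using hx

/-- Locally, on compact subsets of I_{Ω,w}, Lebesgue measure is dominated by the auxiliary measure.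
Together with the converse, both measures have the same null sets there. -/
lemma absolutelyContinuous_auxMeasure :
    volume.restrict (regularSet p a b η Ω) ≪ auxMeasure p a b η Ω := by
  intro s hs
  rw [Measure.restrict_apply' h.isOpen_regularSet.measurableSet]
  refine measure_null_of_locally_null _ fun x hx => ?_
  obtain ⟨K, hK, hxK, hKS⟩ := exists_compact_subset h.isOpen_regularSet hx.2
  obtain ⟨C, hC, hle⟩ := h.exists_restrict_le_auxMeasure hK hKS
  refine ⟨s ∩ K, ?_, ?_⟩
  · exact mem_of_superset (inter_mem_nhdsWithin _ (mem_interior_iff_mem_nhds.1 hxK))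
      (inter_subset_inter_left _ inter_subset_left)
  · have := hle s
    rw [Measure.restrict_apply' hK.measurableSet, Measure.smul_apply, hs, smul_zero] at this
    exact le_antisymm this zero_le

lemma ae_auxMeasure_iff {P : Space d → Prop} :
    (∀ᵐ x ∂auxMeasure p a b η Ω, P x) ↔ ∀ᵐ x ∂volume.restrict (regularSet p a b η Ω), P x :=
  ⟨fun hP => h.absolutelyContinuous_auxMeasure.ae_le hP,
    fun hP => h.auxMeasure_absolutelyContinuous.ae_le hP⟩

lemma aestronglyMeasurable_of_aux {F : Type*} [TopologicalSpace F] {u : Space d → F}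
    (hu : AEStronglyMeasurable u (auxMeasure p a b η Ω)) :
    AEStronglyMeasurable u (volume.restrict (regularSet p a b η Ω)) :=
  hu.mono_ac h.absolutelyContinuous_auxMeasure

lemma one_le_ofReal : 1 ≤ ENNReal.ofReal p := by
  simpa using ENNReal.ofReal_le_ofReal h.one_lt.le

/-- Local integrability of the elements of `X`, with bounds. -/
lemma exists_lintegral_enorm_le {K : Set (Space d)} (hK : IsCompact K)
    (hKS : K ⊆ regularSet p a b η Ω) :
    ∃ C : ℝ≥0∞, C ≠ ⊤ ∧ ∀ u : Space d → ℝ, AEStronglyMeasurable u (auxMeasure p a b η Ω) →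
      ∫⁻ x in K, ‖u x‖ₑ ≤ C * eLpNorm u (ENNReal.ofReal p) (auxMeasure p a b η Ω) := by
  obtain ⟨C, hC, hle⟩ := h.exists_restrict_le_auxMeasure hK hKS
  have := h.isFiniteMeasure_auxMeasure
  have hp := h.one_lt
  have hexp : 0 ≤ 1 / (1 : ℝ≥0∞).toReal - 1 / (ENNReal.ofReal p).toReal := by
    rw [ENNReal.toReal_ofReal (by linarith), ENNReal.toReal_one, div_one, sub_nonneg,
      div_le_one (by linarith)]
    exact hp.le
  refine ⟨C * (auxMeasure p a b η Ω) univ ^ (1 / (1 : ℝ≥0∞).toReal - 1 / (ENNReal.ofReal p).toReal),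
    ENNReal.mul_ne_top hC (ENNReal.rpow_ne_top_of_nonneg hexp (measure_ne_top _ _)), fun u hu => ?_⟩
  calc ∫⁻ x in K, ‖u x‖ₑ ≤ C * ∫⁻ x, ‖u x‖ₑ ∂auxMeasure p a b η Ω := by
        refine (lintegral_mono' hle le_rfl).trans ?_
        rw [lintegral_smul_measure, smul_eq_mul]
    _ ≤ _ := by
        rw [← eLpNorm_one_eq_lintegral_enorm, mul_assoc]
        gcongr
        rw [mul_comm]
        exact eLpNorm_le_eLpNorm_mul_rpow_measure_univ h.one_le_ofReal hu

/-- Local integrability of the elements of `L^p(I_{Ω, w}, w dx)`, with bounds. -/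
lemma exists_lintegral_enorm_le_gradMeasure {K : Set (Space d)} (hK : IsCompact K)
    (hKS : K ⊆ regularSet p a b η Ω) :
    ∃ C : ℝ≥0∞, C ≠ ⊤ ∧ ∀ G : Space d → Space d,
      AEStronglyMeasurable G (volume.restrict (regularSet p a b η Ω)) →
      ∫⁻ x in K, ‖G x‖ₑ ≤ C * eLpNorm G (ENNReal.ofReal p) (gradMeasure p a b η Ω) := by
  have hp := h.one_lt
  have hp0 : 0 < p := by linarith
  have hp1 : p - 1 ≠ 0 := by linarith
  have hpq := Real.HolderConjugate.conjExponent hp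
  set q := p.conjExponent with hq
  have hq0 : 0 < q := hpq.symm.pos
  refine ⟨(∫⁻ x in K, invWeight p η ‖x‖) ^ (1 / q), ENNReal.rpow_ne_top_of_nonneg (by positivity)
    (h.lintegral_invWeight_norm_lt_top hK hKS).ne, fun G hG => ?_⟩
  have hGK : AEStronglyMeasurable G (volume.restrict K) :=
    hG.mono_measure (Measure.restrict_mono_set _ hKS)
  have hw : AEMeasurable (fun x : Space d => ENNReal.ofReal (η ‖x‖)) (volume.restrict K) :=
    h.aemeasurable_weight.restrict
  -- Hölder for |G| = (|G| η^{1/p}) η^{-1/p}. As q/p = 1/(p-1), the second factor contributes the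
  -- integral of η^{-1/(p-1)}, finite over K.
  have key := ENNReal.lintegral_mul_le_Lp_mul_Lq (volume.restrict K) hpq
    (f := fun x => ‖G x‖ₑ * ENNReal.ofReal (η ‖x‖) ^ (1 / p))
    (g := fun x => ENNReal.ofReal (η ‖x‖) ^ (-(1 / p)))
    (hGK.enorm.mul (hw.pow_const _)) (hw.pow_const _)
  have h1 : ∫⁻ x in K, ‖G x‖ₑ = ∫⁻ x in K, ((fun x : Space d => ‖G x‖ₑ * ENNReal.ofReal (η ‖x‖) ^ (1 / p)) *
      (fun x : Space d => ENNReal.ofReal (η ‖x‖) ^ (-(1 / p)))) x := by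
    refine lintegral_congr_ae ?_
    filter_upwards [ae_restrict_of_ae_restrict_of_subset hKS h.ae_weight_norm_pos] with x hx
    have hx0 : ENNReal.ofReal (η ‖x‖) ≠ 0 := by simpa using hx
    rw [Pi.mul_apply, mul_assoc, ← ENNReal.rpow_add _ _ hx0 ENNReal.ofReal_ne_top, add_neg_cancel,
      ENNReal.rpow_zero, mul_one]
  have h2 : ∀ x : Space d, (ENNReal.ofReal (η ‖x‖) ^ (-(1 / p))) ^ q = invWeight p η ‖x‖ := by
    intro x
    rw [← ENNReal.rpow_mul, invWeight]
    congr 1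
    rw [hq, Real.conjExponent]
    field_simp
  have h3 : ∀ x : Space d, (‖G x‖ₑ * ENNReal.ofReal (η ‖x‖) ^ (1 / p)) ^ p =
      ‖G x‖ₑ ^ p * ENNReal.ofReal (η ‖x‖) := by
    intro x
    rw [ENNReal.mul_rpow_of_nonneg _ _ hp0.le, ← ENNReal.rpow_mul, one_div_mul_cancel hp0.ne',
      ENNReal.rpow_one]
  rw [h1]
  refine key.trans ?_
  simp only [h2, h3]
  rw [mul_comm]
  gcongr
  rw [eLpNorm_eq_lintegral_rpow_enorm_toReal (by simpa using hp0) ENNReal.ofReal_ne_top,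
    ENNReal.toReal_ofReal hp0.le, h.lintegral_gradMeasure]
  gcongr

lemma locallyIntegrableOn_coeFn (u : X p a b η Ω) :
    LocallyIntegrableOn u (regularSet p a b η Ω) := by
  rw [locallyIntegrableOn_iff h.isOpen_regularSet.isLocallyClosed]
  intro K hKS hK
  obtain ⟨C, hC, hle⟩ := h.exists_lintegral_enorm_le hK hKS
  refine ⟨(h.aestronglyMeasurable_of_aux (Lp.aestronglyMeasurable u)).mono_measure
    (Measure.restrict_mono_set _ hKS), (hle u (Lp.aestronglyMeasurable u)).trans_lt ?_⟩
  exact ENNReal.mul_lt_top hC.lt_top (Lp.eLpNorm_lt_top u)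

lemma aestronglyMeasurable_gradSpace (V : GradSpace p a b η Ω) :
    AEStronglyMeasurable V (volume.restrict (regularSet p a b η Ω)) :=
  (Lp.aestronglyMeasurable V).mono_ac h.absolutelyContinuous_gradMeasure

lemma locallyIntegrableOn_gradSpace (V : GradSpace p a b η Ω) :
    LocallyIntegrableOn V (regularSet p a b η Ω) := by
  rw [locallyIntegrableOn_iff h.isOpen_regularSet.isLocallyClosed]
  intro K hKS hK
  obtain ⟨C, hC, hle⟩ := h.exists_lintegral_enorm_le_gradMeasure hK hKS
  refine ⟨(h.aestronglyMeasurable_gradSpace V).mono_measure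
    (Measure.restrict_mono_set _ hKS), (hle V (h.aestronglyMeasurable_gradSpace V)).trans_lt ?_⟩
  exact ENNReal.mul_lt_top hC.lt_top (Lp.eLpNorm_lt_top V)

omit h in
lemma gradMeasure_absolutelyContinuous :
    gradMeasure p a b η Ω ≪ volume.restrict (regularSet p a b η Ω) :=
  withDensity_absolutelyContinuous _ _

lemma enorm_rpow_gradSpace (V : GradSpace p a b η Ω) [Fact (1 ≤ ENNReal.ofReal p)] :
    ‖V‖ₑ ^ p = ∫⁻ x in regularSet p a b η Ω, ‖V x‖ₑ ^ p * ENNReal.ofReal (η ‖x‖) := by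
  have hp0 : 0 < p := by linarith [h.one_lt]
  rw [Lp.enorm_def, eLpNorm_eq_lintegral_rpow_enorm_toReal (by simpa using hp0)
    ENNReal.ofReal_ne_top, ENNReal.toReal_ofReal hp0.le, ← ENNReal.rpow_mul,
    one_div_mul_cancel hp0.ne', ENNReal.rpow_one, h.lintegral_gradMeasure]

/-- A gradient field of finite energy is an element of `L^p(I_{Ω, w}, w dx)`. -/
lemma exists_gradSpace_ae_eq {G : Space d → Space d}
    (hG : AEStronglyMeasurable G (volume.restrict (regularSet p a b η Ω)))
    (hfin : ∫⁻ x in regularSet p a b η Ω, ‖G x‖ₑ ^ p * ENNReal.ofReal (η ‖x‖) < ⊤) :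
    ∃ V : GradSpace p a b η Ω, G =ᵐ[volume.restrict (regularSet p a b η Ω)] V := by
  have hp0 : 0 < p := by linarith [h.one_lt]
  have hmem : MemLp G (ENNReal.ofReal p) (gradMeasure p a b η Ω) := by
    refine ⟨hG.mono_ac gradMeasure_absolutelyContinuous, ?_⟩
    rw [eLpNorm_eq_lintegral_rpow_enorm_toReal (by simpa using hp0) ENNReal.ofReal_ne_top,
      ENNReal.toReal_ofReal hp0.le, h.lintegral_gradMeasure]
    exact ENNReal.rpow_lt_top_of_nonneg (by positivity) hfin.ne
  exact ⟨hmem.toLp G, h.absolutelyContinuous_gradMeasure.ae_le hmem.coeFn_toLp.symm⟩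

lemma lintegral_energy_congr {G G' : Space d → Space d}
    (hG : G =ᵐ[volume.restrict (regularSet p a b η Ω)] G') :
    ∫⁻ x in regularSet p a b η Ω, ‖G x‖ₑ ^ p * ENNReal.ofReal (η ‖x‖) =
      ∫⁻ x in regularSet p a b η Ω, ‖G' x‖ₑ ^ p * ENNReal.ofReal (η ‖x‖) :=
  lintegral_congr_ae (hG.mono fun x hx => by simp only [hx])

lemma weightedEnergy_eq {u : X p a b η Ω} {G : Space d → Space d}
    (hG : HasWeakGradientOn (regularSet p a b η Ω) u G) :
    weightedEnergy p a b η Ω u =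
      ∫⁻ x in regularSet p a b η Ω, ‖G x‖ₑ ^ p * ENNReal.ofReal (η ‖x‖) :=
  le_antisymm (iInf₂_le G hG) (le_iInf₂ fun _ hG' =>
    (h.lintegral_energy_congr (hG.ae_unique h.isOpen_regularSet hG')).le)

end Measures

section Graph

include h

variable [Fact (1 < p)]

lemma weightedEnergy_eq_of_mem {u : X p a b η Ω} {V : GradSpace p a b η Ω}
    (hV : (u, V) ∈ gradGraph p a b η Ω) : weightedEnergy p a b η Ω u = ENNReal.ofReal (‖V‖ ^ p) := by
  rw [h.weightedEnergy_eq hV, ← h.enorm_rpow_gradSpace, ← ofReal_norm,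
    ENNReal.ofReal_rpow_of_nonneg (norm_nonneg _) (by linarith [h.one_lt])]

lemma exists_mem_gradGraph {u : X p a b η Ω} {G : Space d → Space d}
    (hG : HasWeakGradientOn (regularSet p a b η Ω) u G)
    (hfin : ∫⁻ x in regularSet p a b η Ω, ‖G x‖ₑ ^ p * ENNReal.ofReal (η ‖x‖) < ⊤) :
    ∃ V, (u, V) ∈ gradGraph p a b η Ω ∧ G =ᵐ[volume.restrict (regularSet p a b η Ω)] V := by
  obtain ⟨V, hV⟩ := h.exists_gradSpace_ae_eq (hG.2.1.aestronglyMeasurable) hfin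
  exact ⟨V, hG.congr h.isOpen_regularSet (ae_eq_refl _) hV, hV⟩

lemma exists_mem_gradGraph_of_lt_top {u : X p a b η Ω} (hu : weightedEnergy p a b η Ω u < ⊤) :
    ∃ V, (u, V) ∈ gradGraph p a b η Ω := by
  simp only [weightedEnergy, iInf_lt_iff] at hu
  obtain ⟨G, hG, hfin⟩ := hu
  obtain ⟨V, hV, -⟩ := h.exists_mem_gradGraph hG hfin
  exact ⟨V, hV⟩

lemma mem_domBar_iff {u : X p a b η Ω} :
    u ∈ domBar p a b η Ω ↔ ∃ V, (u, V) ∈ gradGraph p a b η Ω := by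
  refine ⟨fun ⟨G, hG, hfin⟩ => ?_, fun ⟨V, hV⟩ => ⟨V, hV, ?_⟩⟩
  · obtain ⟨V, hV, -⟩ := h.exists_mem_gradGraph hG hfin
    exact ⟨V, hV⟩
  · rw [← h.weightedEnergy_eq hV, h.weightedEnergy_eq_of_mem hV]
    exact ENNReal.ofReal_lt_top

lemma gradGraph_unique (u : X p a b η Ω) (V V' : GradSpace p a b η Ω)
    (hV : (u, V) ∈ gradGraph p a b η Ω) (hV' : (u, V') ∈ gradGraph p a b η Ω) : V = V' :=
  Lp.ext (gradMeasure_absolutelyContinuous.ae_le (hV.ae_unique h.isOpen_regularSet hV'))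

lemma zero_mem_gradGraph : (0, 0) ∈ gradGraph p a b η Ω := by
  have h0 : HasWeakGradientOn (regularSet p a b η Ω) (fun _ => (0 : ℝ)) fun _ => (0 : Space d) :=
    ⟨locallyIntegrableOn_zero, locallyIntegrableOn_zero, fun φ _ _ _ e => by simp⟩
  exact h0.congr h.isOpen_regularSet
    (h.absolutelyContinuous_auxMeasure.ae_le (Lp.coeFn_zero _ _ _).symm)
    (h.absolutelyContinuous_gradMeasure.ae_le (Lp.coeFn_zero _ _ _).symm)

lemma midpoint_mem_gradGraph : ∀ x ∈ gradGraph p a b η Ω, ∀ y ∈ gradGraph p a b η Ω,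
    (1 / 2 : ℝ) • (x + y) ∈ gradGraph p a b η Ω := by
  rintro ⟨u, V⟩ hx ⟨u', V'⟩ hy
  refine ((hx.add hy).const_smul (1 / 2 : ℝ)).congr h.isOpen_regularSet ?_ ?_
  · refine h.absolutelyContinuous_auxMeasure.ae_le ?_
    filter_upwards [Lp.coeFn_smul (1 / 2 : ℝ) (u + u'), Lp.coeFn_add u u'] with x h1 h2
    simp only [Prod.mk_add_mk, Prod.smul_mk, h1, Pi.smul_apply, h2]
  · refine h.absolutelyContinuous_gradMeasure.ae_le ?_
    filter_upwards [Lp.coeFn_smul (1 / 2 : ℝ) (V + V'), Lp.coeFn_add V V'] with x h1 h2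
    simp only [Prod.mk_add_mk, Prod.smul_mk, h1, Pi.smul_apply, h2]

/-- Convergence in either weighted space implies convergence in L^1 on compact subsets of I_{Ω,w},
and weak gradients pass to such limits. -/
lemma isClosed_gradGraph : IsClosed (gradGraph p a b η Ω) := by
  refine IsSeqClosed.isClosed fun z w hz hw => ?_
  have h1 : Tendsto (fun n => ‖(z n).1 - w.1‖ₑ) atTop (𝓝 0) := by
    have := (((continuous_fst.tendsto w).comp hw).sub_const w.1).enorm
    simpa using this
  have h2 : Tendsto (fun n => ‖(z n).2 - w.2‖ₑ) atTop (𝓝 0) := by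
    have := (((continuous_snd.tendsto w).comp hw).sub_const w.2).enorm
    simpa using this
  refine HasWeakGradientOn.of_tendsto hz (h.locallyIntegrableOn_coeFn _)
    (h.locallyIntegrableOn_gradSpace _) (fun K hKS hK => ?_) fun K hKS hK => ?_
  · obtain ⟨C, hC, hle⟩ := h.exists_lintegral_enorm_le hK hKS
    have h3 := ENNReal.Tendsto.const_mul h1 (Or.inr hC)
    rw [mul_zero] at h3
    refine tendsto_of_tendsto_of_tendsto_of_le_of_le tendsto_const_nhds h3
      (fun _ => zero_le) fun n => ?_
    simp only
    rw [Lp.enorm_def]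
    refine le_trans (le_of_eq ?_) (hle _ (Lp.aestronglyMeasurable _))
    refine lintegral_congr_ae ?_
    filter_upwards [ae_restrict_of_ae_restrict_of_subset hKS
      (h.absolutelyContinuous_auxMeasure.ae_le (Lp.coeFn_sub (z n).1 w.1))] with x hx
    rw [hx, Pi.sub_apply]
  · obtain ⟨C, hC, hle⟩ := h.exists_lintegral_enorm_le_gradMeasure hK hKS
    have h3 := ENNReal.Tendsto.const_mul h2 (Or.inr hC)
    rw [mul_zero] at h3
    refine tendsto_of_tendsto_of_tendsto_of_le_of_le tendsto_const_nhds h3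
      (fun _ => zero_le) fun n => ?_
    simp only
    rw [Lp.enorm_def]
    refine le_trans (le_of_eq ?_) (hle _ (h.aestronglyMeasurable_gradSpace _))
    refine lintegral_congr_ae ?_
    filter_upwards [ae_restrict_of_ae_restrict_of_subset hKS
      (h.absolutelyContinuous_gradMeasure.ae_le (Lp.coeFn_sub (z n).2 w.2))] with x hx
    rw [hx, Pi.sub_apply]

/-- A sublevel set at a finite level consists of the u with a gradient V of bounded norm, and
`exists_mem_of_tendsto_of_norm_le` retains such a bound in the limit. -/
lemma lowerSemicontinuous_weightedEnergy :
    LowerSemicontinuous (weightedEnergy p a b η Ω) := by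
  have hp0 : 0 < p := by linarith [h.one_lt]
  rw [lowerSemicontinuous_iff_isClosed_preimage]
  intro c
  rcases eq_top_or_lt_top c with rfl | hc
  · simp
  refine IsSeqClosed.isClosed fun z u hz hzu => ?_
  have hc0 : 0 ≤ c.toReal := ENNReal.toReal_nonneg
  have hiff : ∀ {u : X p a b η Ω} {V : GradSpace p a b η Ω}, (u, V) ∈ gradGraph p a b η Ω →
      (weightedEnergy p a b η Ω u ≤ c ↔ ‖V‖ ≤ c.toReal ^ p⁻¹) := by
    intro u V hV
    rw [h.weightedEnergy_eq_of_mem hV, Real.le_rpow_inv_iff_of_pos (norm_nonneg _) hc0 hp0,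
      ENNReal.ofReal_le_iff_le_toReal hc.ne]
  obtain ⟨V, hV, hVR⟩ := exists_mem_of_tendsto_of_norm_le h.one_lt h.isClosed_gradGraph
    h.midpoint_mem_gradGraph (R := c.toReal ^ p⁻¹) hzu (Eventually.of_forall fun n => by
      obtain ⟨V, hV⟩ := h.exists_mem_gradGraph_of_lt_top ((hz n).trans_lt hc)
      exact ⟨V, hV, (hiff hV).1 (hz n)⟩)
  exact (hiff hV).2 hVR

end Graph

end Setting

end RadialWeight

/-! ### Radial energies and the radial minimizer -/

namespace RadialWeight

open Filter

namespace Setting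

variable {d : ℕ} {p a b : ℝ} {η : ℝ → ℝ} {Ω : Set (Space d)} (h : Setting d p a b η Ω)

include h

/-- The energy of a radial field in polar coordinates. -/
lemma lintegral_radial_energy {G : ℝ → ℝ}
    (hG : AEStronglyMeasurable G (volume.restrict (regularRadii p a b η))) {s : Set ℝ}
    (hs : MeasurableSet s) (hsI : s ⊆ regularRadii p a b η) :
    ∫⁻ x in {x : Space d | ‖x‖ ∈ s}, ‖G ‖x‖‖ₑ ^ p * ENNReal.ofReal (η ‖x‖) =
      (volume : Measure (Space d)).toSphere univ *
        ∫⁻ r in s, ENNReal.ofReal (r ^ (d - 1)) * ‖G r‖ₑ ^ p * ENNReal.ofReal (η r) := by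
  have := h.nontrivial_space
  have hs0 : s ⊆ Ioi 0 := hsI.trans h.regularRadii_subset_Ioi
  rw [setLIntegral_fun_norm_addHaar volume hs hs0
    (f := fun r => ‖G r‖ₑ ^ p * ENNReal.ofReal (η r)), h.finrank_space]
  · simp only [mul_assoc]
  · exact ((hG.mono_measure (Measure.restrict_mono_set _ hsI)).enorm.pow_const _).mul
      (h.aemeasurable.mono_measure (Measure.restrict_mono_set _ hs0)).ennreal_ofReal

lemma hasWeakGradientOn_comp_norm {v G : ℝ → ℝ}
    (hv : HasWeakGradientOn (regularRadii p a b η) v G) {u : Space d → ℝ}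
    (hu : u =ᵐ[volume.restrict (regularSet p a b η Ω)] fun x => v ‖x‖) :
    HasWeakGradientOn (regularSet p a b η Ω) u fun x => (G ‖x‖ / ‖x‖) • x := by
  have := h.nontrivial_space
  have h1 := hv.comp_norm (E := Space d) isOpen_regularRadii h.regularRadii_subset_Ioi
  rw [← h.regularSet_eq] at h1
  exact h1.congr h.isOpen_regularSet hu.symm (ae_eq_refl _)

lemma enorm_radialField {G : ℝ → ℝ} {x : Space d} (hx : x ∈ regularSet p a b η Ω) :
    ‖(G ‖x‖ / ‖x‖) • x‖ₑ = ‖G ‖x‖‖ₑ := by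
  have hx0 : x ≠ 0 := by
    rintro rfl
    have := h.regularRadii_subset_Ioi hx.2
    simp at this
  rw [← ofReal_norm, ← ofReal_norm, norm_div_norm_smul _ hx0]

/-- The energy of a radial function in terms of its profile. -/
lemma weightedEnergy_radial {u : X p a b η Ω} {v G : ℝ → ℝ}
    (hv : HasWeakGradientOn (regularRadii p a b η) v G)
    (hu : (u : Space d → ℝ) =ᵐ[volume.restrict (regularSet p a b η Ω)] fun x => v ‖x‖) :
    weightedEnergy p a b η Ω u =
      ∫⁻ x in regularSet p a b η Ω, ‖G ‖x‖‖ₑ ^ p * ENNReal.ofReal (η ‖x‖) := by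
  rw [h.weightedEnergy_eq (h.hasWeakGradientOn_comp_norm hv hu)]
  exact setLIntegral_congr_fun h.isOpen_regularSet.measurableSet fun x hx => by
    simp only [h.enorm_radialField hx]

lemma W_subset_domBar : W p a b η Ω ⊆ domBar p a b η Ω := by
  rintro u ⟨v, ⟨G, hv, hfin⟩, hu⟩
  refine ⟨_, h.hasWeakGradientOn_comp_norm hv hu, ?_⟩
  have := h.nontrivial_space
  rw [← h.weightedEnergy_eq (h.hasWeakGradientOn_comp_norm hv hu), h.weightedEnergy_radial hv hu,
    h.regularSet_eq, h.lintegral_radial_energy hv.2.1.aestronglyMeasurable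
      isOpen_regularRadii.measurableSet subset_rfl]
  exact ENNReal.mul_lt_top (toSphere_univ_ne_top _).lt_top hfin

/-- A radial function of finite energy belongs to `W`. -/
lemma mem_W_of_radial {u : X p a b η Ω} (hu : u ∈ domBar p a b η Ω) {v : ℝ → ℝ}
    (huv : (u : Space d → ℝ) =ᵐ[volume.restrict (regularSet p a b η Ω)] fun x => v ‖x‖) :
    u ∈ W p a b η Ω := by
  have := h.nontrivial_space
  obtain ⟨G, hG, hfin⟩ := hu
  have hG' := hG
  have huv' := huv
  rw [h.regularSet_eq] at hG' huv'
  obtain ⟨q, hq, hqG⟩ := hG'.exists_radial_profile isOpen_regularRadii h.regularRadii_subset_Ioi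
    huv'
  refine ⟨v, ⟨q, hq, ?_⟩, huv⟩
  have hp0 : 0 ≤ p := by linarith [h.one_lt]
  have h1 := h.lintegral_radial_energy hq.2.1.aestronglyMeasurable
      isOpen_regularRadii.measurableSet subset_rfl
  -- The sphere has positive measure, so infinite energy of the profile would make the energy of its
  -- radial lift infinite; but that is bounded by the finite energy of G.
  by_contra hne
  rw [not_lt, top_le_iff] at hne
  rw [hne, ENNReal.mul_top (toSphere_univ_ne_zero _)] at h1
  refine hfin.ne (eq_top_iff.2 ?_)
  rw [← h1, h.regularSet_eq]
  refine lintegral_mono_ae ?_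
  filter_upwards [hqG] with x hx
  gcongr
  exact enorm_le_iff_norm_le.2 hx

variable [Fact (1 < p)]

/-- The graph of the gradient is invariant under linear isometries. -/
lemma exists_mem_gradGraph_comp_isometry (R : Space d ≃ₗᵢ[ℝ] Space d) {u : X p a b η Ω}
    {V : GradSpace p a b η Ω} (hV : (u, V) ∈ gradGraph p a b η Ω) :
    ∃ V', (Lp.compMeasurePreserving R (h.measurePreserving_auxMeasure R) u, V') ∈
      gradGraph p a b η Ω ∧ ‖V'‖ = ‖V‖ := by
  have hp0 : 0 < p := by linarith [h.one_lt]
  have hS := h.isOpen_regularSet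
  have hemb : MeasurableEmbedding R := R.toHomeomorph.measurableEmbedding
  have hw := (HasWeakGradientOn.comp_isometry hS hV R (measurePreserving_isometry R)
    (h.preimage_isometry_regularSet R)).congr hS (h.absolutelyContinuous_auxMeasure.ae_le
      (Lp.coeFn_compMeasurePreserving u (h.measurePreserving_auxMeasure R)).symm) (ae_eq_refl _)
  have he : ∫⁻ x in regularSet p a b η Ω, ‖R.symm (V (R x))‖ₑ ^ p * ENNReal.ofReal (η ‖x‖) =
      ENNReal.ofReal (‖V‖ ^ p) := by
    rw [← h.weightedEnergy_eq_of_mem hV, h.weightedEnergy_eq hV]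
    have h1 := (measurePreserving_isometry R).setLIntegral_comp_preimage_emb hemb
      (fun x => ‖V x‖ₑ ^ p * ENNReal.ofReal (η ‖x‖)) (regularSet p a b η Ω)
    rw [h.preimage_isometry_regularSet R] at h1
    rw [← h1]
    refine lintegral_congr fun x => ?_
    rw [R.norm_map, ← ofReal_norm, R.symm.norm_map, ofReal_norm]
  obtain ⟨V', hV', -⟩ := h.exists_mem_gradGraph hw (by rw [he]; exact ENNReal.ofReal_lt_top)
  refine ⟨V', hV', ?_⟩
  have h2 := h.weightedEnergy_eq_of_mem hV'
  rw [h.weightedEnergy_eq hw, he, ENNReal.ofReal_eq_ofReal_iff (by positivity) (by positivity)] at h2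
  exact ((Real.rpow_left_inj (norm_nonneg _) (norm_nonneg _) hp0.ne').1 h2).symm

lemma radial_of_compMeasurePreserving_eq {u : X p a b η Ω}
    (hu : ∀ R : Space d ≃ₗᵢ[ℝ] Space d,
      Lp.compMeasurePreserving R (h.measurePreserving_auxMeasure R) u = u) :
    ∃ v : ℝ → ℝ, (u : Space d → ℝ) =ᵐ[volume.restrict (regularSet p a b η Ω)] fun x => v ‖x‖ := by
  have hm := h.aestronglyMeasurable_of_aux (Lp.aestronglyMeasurable u)
  have hinv : ∀ R : Space d ≃ₗᵢ[ℝ] Space d,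
      u ∘ R =ᵐ[volume.restrict (regularSet p a b η Ω)] u := fun R => by
    refine h.absolutelyContinuous_auxMeasure.ae_le ?_
    have := Lp.coeFn_compMeasurePreserving u (h.measurePreserving_auxMeasure R)
    rw [hu R] at this
    exact this.symm
  rw [h.regularSet_eq] at hm hinv ⊢
  exact exists_ae_eq_comp_norm isOpen_regularRadii.measurableSet hm hinv

lemma compMeasurePreserving_eq_of_radial {g : X p a b η Ω} {γ : ℝ → ℝ}
    (hg : (g : Space d → ℝ) =ᵐ[auxMeasure p a b η Ω] fun x => γ ‖x‖)
    (R : Space d ≃ₗᵢ[ℝ] Space d) :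
    Lp.compMeasurePreserving R (h.measurePreserving_auxMeasure R) g = g := by
  have hm := h.measurePreserving_auxMeasure R
  refine Lp.ext ?_
  filter_upwards [Lp.coeFn_compMeasurePreserving g hm, hg,
    hm.quasiMeasurePreserving.tendsto_ae.eventually hg] with x h1 h2 h3
  rw [h1, h2, Function.comp_apply, h3, R.norm_map]

/-- The functional `∫ |∇u|^p w dx + ‖u - g‖` has a minimizer, which is unique and radial. -/
lemma exists_unique_minimizer {g : X p a b η Ω} {γ : ℝ → ℝ}
    (hg : (g : Space d → ℝ) =ᵐ[auxMeasure p a b η Ω] fun x => γ ‖x‖) :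
    ∃ u₀ ∈ W p a b η Ω,
      (∀ z, weightedEnergy p a b η Ω u₀ + ‖u₀ - g‖ₑ ≤ weightedEnergy p a b η Ω z + ‖z - g‖ₑ) ∧
      ∀ u, weightedEnergy p a b η Ω u + ‖u - g‖ₑ ≤ weightedEnergy p a b η Ω u₀ + ‖u₀ - g‖ₑ →
        u = u₀ := by
  have hval : ∀ {u : X p a b η Ω} {V : GradSpace p a b η Ω}, (u, V) ∈ gradGraph p a b η Ω →
      weightedEnergy p a b η Ω u + ‖u - g‖ₑ = ENNReal.ofReal (‖V‖ ^ p + ‖u - g‖) := by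
    intro u V hV
    rw [h.weightedEnergy_eq_of_mem hV, ENNReal.ofReal_add (by positivity) (by positivity),
      ofReal_norm]
  obtain ⟨⟨u₀, V₀⟩, h0, hmin⟩ := exists_forall_norm_rpow_add_norm_sub_le h.one_lt
    h.isClosed_gradGraph ⟨_, h.zero_mem_gradGraph⟩ h.midpoint_mem_gradGraph h.gradGraph_unique g
  have hmin' : ∀ (z : X p a b η Ω) (V : GradSpace p a b η Ω), (z, V) ∈ gradGraph p a b η Ω →
      ‖V₀‖ ^ p + ‖u₀ - g‖ ≤ ‖V‖ ^ p + ‖z - g‖ := fun z V hV => hmin (z, V) hV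
  have huniq : ∀ (u : X p a b η Ω) (V : GradSpace p a b η Ω), (u, V) ∈ gradGraph p a b η Ω →
      ‖V‖ ^ p + ‖u - g‖ ≤ ‖V₀‖ ^ p + ‖u₀ - g‖ → u = u₀ := fun u V hV hle =>
    eq_of_forall_norm_rpow_add_norm_sub_le h.one_lt h.midpoint_mem_gradGraph g hV h0
      (fun y hy => hle.trans (hmin y hy)) hmin
  -- The rotated minimizer has the same energy and, g being invariant, the same distance to g. By
  -- uniqueness it equals u₀.
  obtain ⟨v, hv⟩ := h.radial_of_compMeasurePreserving_eq (u := u₀) fun R => by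
    obtain ⟨V', hV', hn⟩ := h.exists_mem_gradGraph_comp_isometry R h0
    refine huniq _ V' hV' ?_
    have h1 : ‖Lp.compMeasurePreserving R (h.measurePreserving_auxMeasure R) u₀ - g‖ = ‖u₀ - g‖ := by
      conv_lhs => rw [← h.compMeasurePreserving_eq_of_radial hg R]
      rw [← map_sub, Lp.norm_compMeasurePreserving]
    rw [hn, h1]
  refine ⟨u₀, h.mem_W_of_radial (h.mem_domBar_iff.2 ⟨V₀, h0⟩) hv, fun z => ?_, fun u hu => ?_⟩
  · rcases eq_or_ne (weightedEnergy p a b η Ω z) ⊤ with htop | hne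
    · simp [htop]
    · obtain ⟨V, hV⟩ := h.exists_mem_gradGraph_of_lt_top hne.lt_top
      rw [hval h0, hval hV]
      exact ENNReal.ofReal_le_ofReal (hmin' z V hV)
  · rw [hval h0] at hu
    obtain ⟨V, hV⟩ := h.exists_mem_gradGraph_of_lt_top
      ((le_self_add.trans hu).trans_lt ENNReal.ofReal_lt_top)
    rw [hval hV, ENNReal.ofReal_le_ofReal_iff (by positivity)] at hu
    exact huniq u V hV hu

end Setting

end RadialWeight

/-! ### The envelope and its lower bound by the energy -/

namespace RadialWeight

open Filter

section Envelope

variable {Y : Type*} [TopologicalSpace Y] {f g : Y → ℝ≥0∞}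

lemma lscEnvelope_le (y : Y) : lscEnvelope f y ≤ f y :=
  iSup_le fun _ => iSup₂_le fun _ hle => hle y

lemma le_lscEnvelope (hg : LowerSemicontinuous g) (hle : ∀ y, g y ≤ f y) (y : Y) :
    g y ≤ lscEnvelope f y :=
  le_iSup_of_le g (le_iSup₂_of_le hg hle le_rfl)

lemma lowerSemicontinuous_lscEnvelope : LowerSemicontinuous (lscEnvelope f) := by
  have : lscEnvelope f = fun y => ⨆ (h : Y → ℝ≥0∞) (_ : LowerSemicontinuous h ∧ ∀ z, h z ≤ f z),
      h y := by
    ext y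
    simp only [lscEnvelope, iSup_and]
  rw [this]
  exact lowerSemicontinuous_iSup fun h => lowerSemicontinuous_iSup fun hh => hh.1

lemma lscEnvelope_le_of_tendsto {y : ℕ → Y} {z : Y} (hy : Tendsto y atTop (𝓝 z)) {c : ℝ≥0∞}
    (hc : ∀ᶠ n in atTop, lscEnvelope f (y n) ≤ c) : lscEnvelope f z ≤ c := by
  have := (lowerSemicontinuous_iff_isClosed_preimage.1
    (lowerSemicontinuous_lscEnvelope (f := f)) c)
  exact this.mem_of_tendsto hy hc

end Envelope

namespace Setting

variable {d : ℕ} {p a b : ℝ} {η : ℝ → ℝ} {Ω : Set (Space d)} (h : Setting d p a b η Ω)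

include h

lemma ne_zero_of_mem_regularSet {x : Space d} (hx : x ∈ regularSet p a b η Ω) : x ≠ 0 := by
  rintro rfl
  have := h.regularRadii_subset_Ioi hx.2
  simp at this

/-- The pointwise gradient of a radial absolutely continuous function. -/
lemma ae_enorm_fderiv_comp_norm {v : ℝ → ℝ} (hv : AbsolutelyContinuousOnInterval v a b) :
    ∀ᵐ x ∂volume.restrict (regularSet p a b η Ω),
      ‖fderiv ℝ (fun y : Space d => v ‖y‖) x‖ₑ = ‖deriv v ‖x‖‖ₑ := by
  have h1 : ∀ᵐ r ∂volume.restrict (regularRadii p a b η), DifferentiableAt ℝ v r := by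
    rw [ae_restrict_iff' isOpen_regularRadii.measurableSet]
    filter_upwards [hv.ae_differentiableAt] with r hr hrI
    refine hr ?_
    rw [uIcc_of_le h.lt.le]
    exact Ioo_subset_Icc_self hrI.1
  have h2 := h.ae_regularSet h1
  filter_upwards [h2, ae_restrict_mem h.isOpen_regularSet.measurableSet] with x hx hxS
  have hx0 := h.ne_zero_of_mem_regularSet hxS
  rw [(hasFDerivAt_comp_norm hx0 hx.hasDerivAt).fderiv, ← ofReal_norm, ← ofReal_norm, norm_smul,
    innerSL_apply_norm, ← norm_smul, norm_div_norm_smul _ hx0]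

/-- The functional `F` dominates the energy of the weak gradient. -/
lemma weightedEnergy_le_F (u : X p a b η Ω) : weightedEnergy p a b η Ω u ≤ F p a b η Ω u := by
  refine le_iInf fun v => le_iInf₂ fun hv hu => ?_
  have h1 := (hasWeakGradientOn_of_absolutelyContinuous h.lt.le hv).mono
    (regularRadii_subset_Ioo (p := p) (η := η))
  rw [h.weightedEnergy_radial h1 hu]
  refine le_trans (le_of_eq ?_) (lintegral_mono_set h.regularSet_subset)
  refine lintegral_congr_ae ?_
  filter_upwards [h.ae_enorm_fderiv_comp_norm hv] with x hx
  rw [hx]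

lemma weightedEnergy_le_lscEnvelope [Fact (1 < p)] (u : X p a b η Ω) :
    weightedEnergy p a b η Ω u ≤ lscEnvelope (F p a b η Ω) u :=
  le_lscEnvelope h.lowerSemicontinuous_weightedEnergy h.weightedEnergy_le_F u

end Setting

end RadialWeight

/-! ### Cheap transitions at irregular radii -/

namespace RadialWeight

open Filter

/-- The measure `r^{d-1} η(r) dr` on `(a, b)`. -/
noncomputable def profileMeasure (d : ℕ) (a b : ℝ) (η : ℝ → ℝ) : Measure ℝ :=
  (volume.restrict (Ioo a b)).withDensity fun r =>
    ENNReal.ofReal (r ^ (d - 1)) * ENNReal.ofReal (η r)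

lemma profileMeasure_absolutelyContinuous (d : ℕ) (a b : ℝ) (η : ℝ → ℝ) :
    profileMeasure d a b η ≪ volume :=
  (withDensity_absolutelyContinuous _ _).trans Measure.absolutelyContinuous_restrict

namespace Setting

variable {d : ℕ} {p a b : ℝ} {η : ℝ → ℝ} {Ω : Set (Space d)} (h : Setting d p a b η Ω)

include h

lemma aemeasurable_volume : AEMeasurable η := by
  have h1 : (Ioi (0 : ℝ)).indicator η = η := by
    rw [indicator_eq_self]
    exact fun r hr => h.nonneg.trans_lt (h.support_subset hr).1
  rw [← h1]
  exact (aemeasurable_indicator_iff measurableSet_Ioi).2 h.aemeasurable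

lemma eLpNorm_profileMeasure_rpow (g : ℝ → ℝ) :
    eLpNorm g (ENNReal.ofReal p) (profileMeasure d a b η) ^ p =
      ∫⁻ r in Ioo a b, ENNReal.ofReal (r ^ (d - 1)) * ‖g r‖ₑ ^ p * ENNReal.ofReal (η r) := by
  have hp0 : 0 < p := by linarith [h.one_lt]
  rw [eLpNorm_eq_lintegral_rpow_enorm_toReal (by simpa using hp0) ENNReal.ofReal_ne_top,
    ENNReal.toReal_ofReal hp0.le, ← ENNReal.rpow_mul, one_div_mul_cancel hp0.ne', ENNReal.rpow_one,
    profileMeasure, lintegral_withDensity_eq_lintegral_mul_non_measurable₀]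
  · refine lintegral_congr fun r => ?_
    rw [Pi.mul_apply]
    ring
  · exact (by fun_prop : Measurable fun r : ℝ => ENNReal.ofReal (r ^ (d - 1))).aemeasurable.mul
      h.aemeasurable_volume.ennreal_ofReal.restrict
  · exact ae_of_all _ fun r => ENNReal.mul_lt_top ENNReal.ofReal_lt_top ENNReal.ofReal_lt_top

/-- Near a radius that is not regular, unit masses can be placed at arbitrarily small cost. -/
lemma exists_bump {c : ℝ} (hc : c ∉ regularRadii p a b η) {ε δ : ℝ} (hε : 0 < ε) (hδ : 0 < δ) :
    ∃ φ : ℝ → ℝ, Integrable φ ∧ (∀ r, 0 ≤ φ r) ∧ (∀ r, r ∉ Ioo (c - ε) (c + ε) → φ r = 0) ∧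
      ∫ r, φ r = 1 ∧
      eLpNorm φ (ENNReal.ofReal p) (profileMeasure d a b η) ≤ ENNReal.ofReal δ := by
  have hp := h.one_lt
  have hp0 : 0 < p := by linarith
  have hp1 : 0 < p - 1 := by linarith
  set J := Ioo (c - ε) (c + ε) with hJ
  -- The bump is k / M with k = min(η^{-1/(p-1)}, N) on the neighbourhood and M its integral, finite
  -- thanks to the truncation but arbitrarily large since the full mass is infinite.
  set k : ℕ → ℝ → ℝ≥0∞ := fun N r => min (invWeight p η r) N with hk
  have hiw : AEMeasurable (invWeight p η) := h.aemeasurable_volume.ennreal_ofReal.pow_const _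
  have hkm : ∀ N, AEMeasurable (k N) := fun N => hiw.min aemeasurable_const
  have hkN : ∀ N r, k N r ≤ N := fun N r => min_le_right _ _
  have hkt : ∀ N r, k N r < ⊤ := fun N r => (hkN N r).trans_lt (ENNReal.natCast_lt_top N)
  have hlim : Tendsto (fun N => ∫⁻ r in J, k N r) atTop (𝓝 ⊤) := by
    rw [← h.lintegral_invWeight_eq_top hc hε]
    refine lintegral_tendsto_of_tendsto_of_monotone (fun N => (hkm N).restrict)
      (ae_of_all _ fun r M N hMN => ?_) (ae_of_all _ fun r => ?_)
    · exact min_le_min le_rfl (by exact_mod_cast hMN)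
    · have := (tendsto_const_nhds (x := invWeight p η r)).min
        ENNReal.tendsto_nat_nhds_top
      simpa using this
  -- The p-th power of the norm of k / M is at most b^(d-1) M^{-p} ∫ k = b^(d-1) M^{1-p}; K says how
  -- large M must be.
  obtain ⟨K, hK⟩ : ∃ K : ℝ, ∀ M ≥ K, M ^ (-(p - 1)) * b ^ (d - 1) ≤ δ ^ p := by
    have h1 := (tendsto_rpow_neg_atTop hp1).mul_const (b ^ (d - 1))
    rw [zero_mul] at h1
    obtain ⟨K, hK⟩ := eventually_atTop.1 (h1.eventually (gt_mem_nhds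
      (show 0 < δ ^ p by positivity)))
    exact ⟨K, fun M hM => (hK M hM).le⟩
  obtain ⟨N, hN⟩ := (hlim.eventually (lt_mem_nhds (show ENNReal.ofReal (max K 1) < ⊤ from
    ENNReal.ofReal_lt_top))).exists
  set M := ∫⁻ r in J, k N r with hM
  have hMt : M ≠ ⊤ := by
    refine ((lintegral_mono fun r => hkN N r).trans_lt ?_).ne
    rw [setLIntegral_const, hJ, Real.volume_Ioo]
    exact ENNReal.mul_lt_top (ENNReal.natCast_lt_top N) ENNReal.ofReal_lt_top
  have hMr : max K 1 < M.toReal := (ENNReal.ofReal_lt_iff_lt_toReal (by positivity) hMt).1 hN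
  have hM0 : 0 < M.toReal := lt_of_lt_of_le one_pos ((le_max_right K 1).trans hMr.le)
  have hMne : M ≠ 0 := fun h0 => by simp [h0] at hM0
  set φ : ℝ → ℝ := J.indicator fun r => (k N r).toReal / M.toReal with hφ
  have hint : ∫ r in J, (k N r).toReal = M.toReal :=
    integral_toReal (hkm N).restrict (ae_of_all _ (hkt N))
  have hφi : Integrable φ := by
    rw [hφ, integrable_indicator_iff measurableSet_Ioo]
    exact (integrable_toReal_of_lintegral_ne_top (hkm N).restrict hMt).div_const _
  refine ⟨φ, hφi, fun r => indicator_nonneg (fun r _ => by positivity) r,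
    fun r hr => indicator_of_notMem hr _, ?_, ?_⟩
  · rw [hφ, integral_indicator measurableSet_Ioo, integral_div, hint, div_self hM0.ne']
  · rw [← ENNReal.rpow_le_rpow_iff hp0, h.eLpNorm_profileMeasure_rpow,
      ENNReal.ofReal_rpow_of_nonneg hδ.le hp0.le]
    have hen : ∀ r ∈ J, ‖φ r‖ₑ = k N r / M := by
      intro r hr
      rw [hφ, indicator_of_mem hr, ← ofReal_norm, Real.norm_of_nonneg (by positivity),
        ENNReal.ofReal_div_of_pos hM0, ENNReal.ofReal_toReal (hkt N r).ne,
        ENNReal.ofReal_toReal hMt]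
    have hptw : ∀ r ∈ Ioo a b, ENNReal.ofReal (r ^ (d - 1)) * ‖φ r‖ₑ ^ p * ENNReal.ofReal (η r) ≤
        J.indicator (fun r => ENNReal.ofReal (b ^ (d - 1)) * (M ^ p)⁻¹ * k N r) r := by
      intro r hr
      by_cases hrJ : r ∈ J
      · rw [indicator_of_mem hrJ, hen r hrJ, mul_assoc, mul_assoc]
        refine mul_le_mul' (ENNReal.ofReal_le_ofReal (pow_le_pow_left₀ (h.nonneg.trans hr.1.le)
          hr.2.le _)) ?_
        rw [ENNReal.div_rpow_of_nonneg _ _ hp0.le, div_eq_mul_inv, mul_comm (k N r ^ p), mul_assoc]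
        refine mul_le_mul' le_rfl ?_
        -- This is where the exponent enters: k^{p-1} ≤ η^{-1} where η > 0, so one factor k of k^p
        -- survives and integrates to M.
        have h1 : k N r ^ (p - 1) * ENNReal.ofReal (η r) ≤ 1 := by
          rcases eq_or_ne (ENNReal.ofReal (η r)) 0 with h0 | h0
          · simp [h0]
          · calc k N r ^ (p - 1) * ENNReal.ofReal (η r)
                ≤ invWeight p η r ^ (p - 1) * ENNReal.ofReal (η r) := by
                  gcongr
                  exact min_le_left _ _
              _ = 1 := by
                  rw [invWeight, ← ENNReal.rpow_mul, neg_mul, one_div_mul_cancel hp1.ne',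
                    ENNReal.rpow_neg_one, ENNReal.inv_mul_cancel h0 ENNReal.ofReal_ne_top]
        calc k N r ^ p * ENNReal.ofReal (η r)
            = k N r * (k N r ^ (p - 1) * ENNReal.ofReal (η r)) := by
              rw [← mul_assoc]
              congr 1
              rcases eq_or_ne (k N r) 0 with h0 | h0
              · rw [h0, zero_mul, ENNReal.zero_rpow_of_pos hp0]
              · conv_rhs => rw [← ENNReal.rpow_one (k N r), ← ENNReal.rpow_mul, one_mul,
                  ← ENNReal.rpow_add _ _ h0 (hkt N r).ne]
                congr 1
                ring
          _ ≤ k N r * 1 := by gcongr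
          _ = k N r := mul_one _
      · rw [indicator_of_notMem hrJ, hφ, indicator_of_notMem hrJ, enorm_zero,
          ENNReal.zero_rpow_of_pos hp0, mul_zero, zero_mul]
    calc ∫⁻ r in Ioo a b, ENNReal.ofReal (r ^ (d - 1)) * ‖φ r‖ₑ ^ p * ENNReal.ofReal (η r)
        ≤ ∫⁻ r in Ioo a b, J.indicator
            (fun r => ENNReal.ofReal (b ^ (d - 1)) * (M ^ p)⁻¹ * k N r) r :=
          setLIntegral_mono' measurableSet_Ioo hptw
      _ ≤ ∫⁻ r, J.indicator (fun r => ENNReal.ofReal (b ^ (d - 1)) * (M ^ p)⁻¹ * k N r) r :=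
          setLIntegral_le_lintegral _ _
      _ = ENNReal.ofReal (b ^ (d - 1)) * (M ^ p)⁻¹ * M := by
          rw [lintegral_indicator measurableSet_Ioo, lintegral_const_mul'' _ (hkm N).restrict]
      _ = ENNReal.ofReal (M.toReal ^ (-(p - 1)) * b ^ (d - 1)) := by
          rw [ENNReal.ofReal_mul (by positivity), mul_assoc, mul_comm,
            ← ENNReal.ofReal_rpow_of_pos hM0, ENNReal.ofReal_toReal hMt, ← ENNReal.rpow_neg]
          congr 1
          conv_lhs => rw [← ENNReal.rpow_one M, ← ENNReal.rpow_mul, one_mul,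
            ← ENNReal.rpow_add _ _ hMne hMt]
          congr 1
          ring
      _ ≤ ENNReal.ofReal (δ ^ p) :=
          ENNReal.ofReal_le_ofReal (hK _ ((le_max_left K 1).trans hMr.le))

/-- The functional `F` on the primitive of an integrable function. -/
lemma F_le_of_primitive {g : ℝ → ℝ} (hg : Integrable g) {u : X p a b η Ω}
    (hu : (u : Space d → ℝ) =ᵐ[volume.restrict (regularSet p a b η Ω)]
      fun x => ∫ t in (a - 1)..‖x‖, g t) :
    F p a b η Ω u ≤ (volume : Measure (Space d)).toSphere univ *
      eLpNorm g (ENNReal.ofReal p) (profileMeasure d a b η) ^ p := by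
  have := h.nontrivial_space
  have hp0 : 0 < p := by linarith [h.one_lt]
  have hab := h.lt
  set V : ℝ → ℝ := fun r => ∫ t in (a - 1)..r, g t with hV
  have hgi : IntervalIntegrable g volume (a - 1) b := hg.intervalIntegrable
  have hVac : AbsolutelyContinuousOnInterval V a b :=
    (hgi.absolutelyContinuousOnInterval_intervalIntegral left_mem_uIcc).mono (by
      rw [uIcc_of_le hab.le, uIcc_of_le (by linarith)]
      exact Icc_subset_Icc_left (by linarith))
  have hder : ∀ᵐ x : Space d, ‖x‖ ∈ Ioo a b → HasDerivAt V (g ‖x‖) ‖x‖ := by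
    refine h.ae_norm (P := fun r => r ∈ Ioo a b → HasDerivAt V (g r) r) (ae_restrict_of_ae ?_)
    filter_upwards [hgi.ae_hasDerivAt_integral] with r hr hrab
    refine hr ?_ _ left_mem_uIcc
    rw [uIcc_of_le (by linarith)]
    exact ⟨by linarith [hrab.1], hrab.2.le⟩
  refine (iInf_le_of_le V (iInf₂_le hVac hu)).trans ?_
  rw [h.eLpNorm_profileMeasure_rpow]
  have h1 : ∫⁻ x in {x : Space d | ‖x‖ ∈ Ioo a b}, ‖g ‖x‖‖ₑ ^ p * ENNReal.ofReal (η ‖x‖) =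
      (volume : Measure (Space d)).toSphere univ *
        ∫⁻ r in Ioo a b, ENNReal.ofReal (r ^ (d - 1)) * ‖g r‖ₑ ^ p * ENNReal.ofReal (η r) := by
    rw [setLIntegral_fun_norm_addHaar volume measurableSet_Ioo
      (fun r hr => h.nonneg.trans_lt hr.1) (f := fun r => ‖g r‖ₑ ^ p * ENNReal.ofReal (η r)),
      h.finrank_space]
    · simp only [mul_assoc]
    · exact (hg.aestronglyMeasurable.restrict.enorm.pow_const _).mul
        h.aemeasurable_volume.ennreal_ofReal.restrict
  have hms : MeasurableSet {x : Space d | ‖x‖ ∈ Ioo a b} := measurable_norm measurableSet_Ioo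
  rw [← h1, ← lintegral_indicator hms]
  refine (lintegral_mono_ae (g := {x : Space d | ‖x‖ ∈ Ioo a b}.indicator
    fun x => ‖g ‖x‖‖ₑ ^ p * ENNReal.ofReal (η ‖x‖)) ?_).trans (setLIntegral_le_lintegral _ _)
  refine ae_restrict_of_ae ?_
  filter_upwards [hder] with x hx
  by_cases hxab : ‖x‖ ∈ Ioo a b
  · have hx0 : x ≠ 0 := by
      rintro rfl
      rw [norm_zero] at hxab
      exact absurd hxab.1 (not_lt.2 h.nonneg)
    rw [indicator_of_mem (show x ∈ {x : Space d | ‖x‖ ∈ Ioo a b} from hxab),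
      (hasFDerivAt_comp_norm hx0 (hx hxab)).fderiv, ← ofReal_norm, ← ofReal_norm, norm_smul,
      innerSL_apply_norm, ← norm_smul, norm_div_norm_smul _ hx0]
  -- If Ω is the full ball it also contains points with |x| ≤ a; the weight vanishes there.
  · have : η ‖x‖ = 0 := by
      by_contra hne
      exact hxab (h.support_subset hne)
    rw [this, ENNReal.ofReal_zero, mul_zero]
    exact zero_le

end Setting

end RadialWeight

/-! ### Recovery sequences for truncated profiles -/

open Filter

lemma Lp_tendsto_of_dominated {α : Type*} [MeasurableSpace α] {μ : Measure α} {p : ℝ} (hp : 1 < p)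
    [Fact (1 ≤ ENNReal.ofReal p)] {u : ℕ → Lp ℝ (ENNReal.ofReal p) μ}
    {l : Lp ℝ (ENNReal.ofReal p) μ} {B : α → ℝ} (hB : MemLp B (ENNReal.ofReal p) μ)
    (hle : ∀ n, ∀ᵐ x ∂μ, ‖u n x - l x‖ ≤ B x)
    (hlim : ∀ᵐ x ∂μ, Tendsto (fun n => u n x) atTop (𝓝 (l x))) : Tendsto u atTop (𝓝 l) := by
  have hp0 : 0 < p := by linarith
  rw [Lp.tendsto_Lp_iff_tendsto_eLpNorm']
  simp_rw [eLpNorm_eq_lintegral_rpow_enorm_toReal (show ENNReal.ofReal p ≠ 0 by simpa using hp0)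
    ENNReal.ofReal_ne_top, ENNReal.toReal_ofReal hp0.le, Pi.sub_apply]
  have h1 : Tendsto (fun n => ∫⁻ x, ‖u n x - l x‖ₑ ^ p ∂μ) atTop (𝓝 (∫⁻ _, 0 ∂μ)) := by
    refine tendsto_lintegral_of_dominated_convergence' (fun x => ‖B x‖ₑ ^ p)
      (fun n => ((Lp.aestronglyMeasurable (u n)).sub
        (Lp.aestronglyMeasurable l)).enorm.pow_const _) (fun n => ?_) ?_ ?_
    · filter_upwards [hle n] with x hx
      gcongr
      exact enorm_le_iff_norm_le.2 (hx.trans (le_abs_self _))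
    · have := hB.eLpNorm_lt_top
      rw [eLpNorm_eq_lintegral_rpow_enorm_toReal (by simpa using hp0) ENNReal.ofReal_ne_top,
        ENNReal.toReal_ofReal hp0.le, ENNReal.rpow_lt_top_iff_of_pos (by positivity)] at this
      exact this.ne
    · filter_upwards [hlim] with x hx
      have h2 := ((hx.sub_const (l x)).enorm).ennrpow_const p
      simpa [ENNReal.zero_rpow_of_pos hp0] using h2
  have h2 := h1.ennrpow_const (1 / p)
  simpa [ENNReal.zero_rpow_of_pos (inv_pos.2 hp0)] using h2

/-- The primitive of a function cut off to `(s, t]`. -/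
lemma intervalIntegral_indicator_Ioc {G : ℝ → ℝ} {c s t r : ℝ} (hcs : c ≤ s) (hcr : c ≤ r) :
    ∫ x in c..r, (Ioc s t).indicator G x = ∫ x in s..max s (min r t), G x := by
  rw [intervalIntegral.integral_of_le hcr, intervalIntegral.integral_of_le (le_max_left _ _),
    setIntegral_indicator measurableSet_Ioc, Ioc_inter_Ioc, max_eq_right hcs]
  rcases le_total s (min r t) with hle | hle
  · rw [max_eq_right hle]
  · rw [max_eq_left hle, Ioc_eq_empty (not_lt.2 hle), Ioc_self]

section Bump

variable {φ : ℝ → ℝ} {c ε e r : ℝ}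

lemma intervalIntegral_bump_nonneg (hφ0 : ∀ r, 0 ≤ φ r) (he : e ≤ r) : 0 ≤ ∫ t in e..r, φ t :=
  intervalIntegral.integral_nonneg he fun _ _ => hφ0 _

lemma intervalIntegral_bump_le_one (hφ : Integrable φ) (hφ0 : ∀ r, 0 ≤ φ r) (hφ1 : ∫ r, φ r = 1)
    (he : e ≤ r) : ∫ t in e..r, φ t ≤ 1 := by
  rw [intervalIntegral.integral_of_le he, ← hφ1]
  exact setIntegral_le_integral hφ (ae_of_all _ hφ0)

lemma intervalIntegral_bump_eq_zero (hsupp : ∀ r, r ∉ Ioo (c - ε) (c + ε) → φ r = 0)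
    (he : e ≤ r) (hr : r ≤ c - ε) : ∫ t in e..r, φ t = 0 := by
  rw [intervalIntegral.integral_of_le he]
  refine setIntegral_eq_zero_of_forall_eq_zero fun x hx => hsupp x fun hx' => ?_
  linarith [hx.2, hx'.1]

lemma intervalIntegral_bump_eq_one (hsupp : ∀ r, r ∉ Ioo (c - ε) (c + ε) → φ r = 0)
    (hφ1 : ∫ r, φ r = 1) (he : e ≤ c - ε) (hr : c + ε ≤ r) (her : e ≤ r) :
    ∫ t in e..r, φ t = 1 := by
  rw [intervalIntegral.integral_of_le her, ← hφ1]
  refine setIntegral_eq_integral_of_forall_compl_eq_zero fun x hx => hsupp x fun hx' => hx ?_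
  exact ⟨by linarith [hx'.1], by linarith [hx'.2]⟩

end Bump

namespace RadialWeight

lemma lscEnvelope_le_of_tendsto_of_tendsto {Y : Type*} [TopologicalSpace Y] {f : Y → ℝ≥0∞}
    {y : ℕ → Y} {z : Y} (hy : Tendsto y atTop (𝓝 z)) {c : ℕ → ℝ≥0∞} {l : ℝ≥0∞}
    (hc : ∀ n, lscEnvelope f (y n) ≤ c n) (hl : Tendsto c atTop (𝓝 l)) : lscEnvelope f z ≤ l := by
  refine le_of_forall_gt_imp_ge_of_dense fun e he => ?_
  exact lscEnvelope_le_of_tendsto hy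
    ((hl.eventually (gt_mem_nhds he)).mono fun n hn => (hc n).trans hn.le)

/-- On each interval `z ∈ T` the function `w z`, continued by constants outside
`[s z, t z]`. -/
noncomputable def truncation (T : Finset (ℝ × ℝ)) (w : ℝ × ℝ → ℝ → ℝ) (s t : ℝ × ℝ → ℝ) (r : ℝ) :
    ℝ :=
  ∑ z ∈ T, (Ioo z.1 z.2).indicator (fun r => w z (max (s z) (min r (t z)))) r

lemma max_min_mem_Icc {s t r : ℝ} (hst : s ≤ t) : max s (min r t) ∈ Icc s t :=
  ⟨le_max_left _ _, max_le hst (min_le_right _ _)⟩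

end RadialWeight

namespace RadialWeight

open Filter

/-- A family of primitives `w z` of `G` on the intervals `z ∈ T`, with cuts
`z.1 < s z ≤ t z < z.2`. -/
structure TruncationData (I : Set ℝ) (T : Finset (ℝ × ℝ)) (G : ℝ → ℝ) (w : ℝ × ℝ → ℝ → ℝ)
    (s t : ℝ × ℝ → ℝ) : Prop where
  left_notMem : ∀ z ∈ T, z.1 ∉ I
  right_notMem : ∀ z ∈ T, z.2 ∉ I
  subset : ∀ z ∈ T, Ioo z.1 z.2 ⊆ I
  left_lt : ∀ z ∈ T, z.1 < s z
  le : ∀ z ∈ T, s z ≤ t z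
  lt_right : ∀ z ∈ T, t z < z.2
  sub_eq : ∀ z ∈ T, ∀ x ∈ Ioo z.1 z.2, ∀ y ∈ Ioo z.1 z.2, w z y - w z x = ∫ r in x..y, G r
  locallyIntegrableOn : LocallyIntegrableOn G I

namespace TruncationData

variable {I : Set ℝ} {T : Finset (ℝ × ℝ)} {G : ℝ → ℝ} {w : ℝ × ℝ → ℝ → ℝ} {s t : ℝ × ℝ → ℝ}
  (D : TruncationData I T G w s t)

include D

lemma Icc_subset {z : ℝ × ℝ} (hz : z ∈ T) : Icc (s z) (t z) ⊆ Ioo z.1 z.2 :=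
  Icc_subset_Ioo (D.left_lt z hz) (D.lt_right z hz)

lemma clamp_mem {z : ℝ × ℝ} (hz : z ∈ T) (r : ℝ) : max (s z) (min r (t z)) ∈ Ioo z.1 z.2 :=
  D.Icc_subset hz (max_min_mem_Icc (D.le z hz))

lemma integrable_indicator {z : ℝ × ℝ} (hz : z ∈ T) :
    Integrable ((Ioc (s z) (t z)).indicator G) := by
  rw [integrable_indicator_iff measurableSet_Ioc]
  exact (D.locallyIntegrableOn.integrableOn_compact_subset
    ((D.Icc_subset hz).trans (D.subset z hz)) isCompact_Icc).mono_set Ioc_subset_Icc_self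

lemma integral_indicator {z : ℝ × ℝ} (hz : z ∈ T) {e r : ℝ} (he : e ≤ s z) (her : e ≤ r) :
    ∫ x in e..r, (Ioc (s z) (t z)).indicator G x =
      w z (max (s z) (min r (t z))) - w z (s z) := by
  rw [intervalIntegral_indicator_Ioc he her, D.sub_eq z hz _
    (D.Icc_subset hz (left_mem_Icc.2 (D.le z hz))) _ (D.clamp_mem hz r)]

/-- Only increments of w z inside the interval are prescribed. The clamped function is nevertheless
a constant plus a primitive of an integrable function, composed with the continuous clamp. -/
lemma continuous_clamp {z : ℝ × ℝ} (hz : z ∈ T) :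
    Continuous fun r => w z (max (s z) (min r (t z))) := by
  have h1 : (fun r => w z (max (s z) (min r (t z)))) = fun r => w z (s z) +
      ∫ x in (min (s z) (s z - 1))..max (s z) (min r (t z)), (Ioc (s z) (t z)).indicator G x := by
    ext r
    have hle : min (s z) (s z - 1) ≤ s z := min_le_left _ _
    rw [D.integral_indicator hz hle (hle.trans (le_max_left _ _))]
    have : max (s z) (min (max (s z) (min r (t z))) (t z)) = max (s z) (min r (t z)) := by
      have h2 := max_min_mem_Icc (r := r) (D.le z hz)
      rw [min_eq_left h2.2, max_eq_right h2.1]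
    rw [this]
    ring
  rw [h1]
  exact continuous_const.add ((intervalIntegral.continuous_primitive
    (fun _ _ => (D.integrable_indicator hz).intervalIntegrable) _).comp
    (continuous_const.max (continuous_id.min continuous_const)))

lemma exists_clamp_bound : ∃ M : ℝ, 0 ≤ M ∧ ∀ z ∈ T, ∀ r, |w z (max (s z) (min r (t z)))| ≤ M := by
  have key : ∀ z ∈ T, ∃ M : ℝ, ∀ r, |w z (max (s z) (min r (t z)))| ≤ M := by
    intro z hz
    obtain ⟨M, hM⟩ := isCompact_Icc.exists_bound_of_continuousOn
      (D.continuous_clamp hz).continuousOn (s := Icc (s z) (t z))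
    refine ⟨M, fun r => ?_⟩
    have h2 := max_min_mem_Icc (r := r) (D.le z hz)
    have := hM _ h2
    rwa [min_eq_left h2.2, max_eq_right h2.1, Real.norm_eq_abs] at this
  choose! M hM using key
  refine ⟨∑ z ∈ T, |M z|, Finset.sum_nonneg fun _ _ => abs_nonneg _, fun z hz r => ?_⟩
  exact ((hM z hz r).trans (le_abs_self _)).trans
    (Finset.single_le_sum (f := fun z => |M z|) (fun _ _ => abs_nonneg _) hz)

lemma measurable_truncation : Measurable (truncation T w s t) := by
  unfold truncation
  exact Finset.measurable_fun_sum _ fun z hz =>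
    (D.continuous_clamp hz).measurable.indicator measurableSet_Ioo

lemma exists_truncation_bound : ∃ M : ℝ, ∀ r, ‖truncation T w s t r‖ ≤ M := by
  obtain ⟨M, hM0, hM⟩ := D.exists_clamp_bound
  refine ⟨∑ _z ∈ T, M, fun r => (norm_sum_le _ _).trans (Finset.sum_le_sum fun z hz => ?_)⟩
  rw [norm_indicator_eq_indicator_norm]
  exact indicator_apply_le' (fun _ => hM z hz r) fun _ => hM0

lemma truncation_eq {z : ℝ × ℝ} (hz : z ∈ T) {r : ℝ} (hr : r ∈ Ioo z.1 z.2) :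
    truncation T w s t r = w z (max (s z) (min r (t z))) := by
  rw [truncation, Finset.sum_eq_single z]
  · rw [indicator_of_mem hr]
  · intro z' hz' hne
    refine indicator_of_notMem (fun hr' => hne ?_) _
    exact Setting.eq_of_mem_Ioo_of_notMem hr' hr (D.left_notMem z' hz') (D.right_notMem z' hz')
      (D.left_notMem z hz) (D.right_notMem z hz) (D.subset z' hz') (D.subset z hz)
  · exact fun hz' => absurd hz hz'

/-- The intervals in T are disjoint, so at most one summand is nonzero at r. -/
lemma norm_sum_indicator_le (r : ℝ) :
    ‖∑ z ∈ T, (Ioc (s z) (t z)).indicator G r‖ ≤ ‖I.indicator G r‖ := by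
  by_cases hex : ∃ z ∈ T, r ∈ Ioc (s z) (t z)
  · obtain ⟨z, hz, hr⟩ := hex
    have hrz := D.Icc_subset hz (Ioc_subset_Icc_self hr)
    rw [Finset.sum_eq_single z, indicator_of_mem hr, indicator_of_mem (D.subset z hz hrz)]
    · intro z' hz' hne
      refine indicator_of_notMem (fun hr' => hne ?_) _
      exact Setting.eq_of_mem_Ioo_of_notMem (D.Icc_subset hz' (Ioc_subset_Icc_self hr')) hrz
        (D.left_notMem z' hz') (D.right_notMem z' hz') (D.left_notMem z hz) (D.right_notMem z hz)
        (D.subset z' hz') (D.subset z hz)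
    · exact fun hz' => absurd hz hz'
  · rw [Finset.sum_eq_zero, norm_zero]
    · exact norm_nonneg _
    · exact fun z hz => indicator_of_notMem (fun hr => hex ⟨z, hz, hr⟩) _

end TruncationData

namespace Setting

variable {d : ℕ} {p a b : ℝ} {η : ℝ → ℝ} {Ω : Set (Space d)} (h : Setting d p a b η Ω)

include h

variable [Fact (1 < p)]

/-- A measurable bounded radial function is an element of `X`. -/
lemma exists_eq_comp_norm {V : ℝ → ℝ} (hV : Measurable V) {M : ℝ}
    (hM : ∀ r ∈ Ioo a b, ‖V r‖ ≤ M) :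
    ∃ u : X p a b η Ω, (u : Space d → ℝ) =ᵐ[auxMeasure p a b η Ω] fun x => V ‖x‖ := by
  have := h.isFiniteMeasure_auxMeasure
  have hmem : MemLp (fun x : Space d => V ‖x‖) (ENNReal.ofReal p) (auxMeasure p a b η Ω) := by
    refine MemLp.of_bound (hV.comp measurable_norm).aestronglyMeasurable M ?_
    rw [h.ae_auxMeasure_iff]
    filter_upwards [ae_restrict_mem h.isOpen_regularSet.measurableSet] with x hx
    exact hM _ hx.2.1
  exact ⟨hmem.toLp _, hmem.coeFn_toLp⟩

/-- Truncations are limits of absolutely continuous functions obtained by moving the boundary values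
of each interval to the nearby irregular endpoints, at negligible cost. -/
lemma lscEnvelope_truncation_le {T : Finset (ℝ × ℝ)} {G : ℝ → ℝ} {w : ℝ × ℝ → ℝ → ℝ}
    {s t : ℝ × ℝ → ℝ} (D : TruncationData (regularRadii p a b η) T G w s t) {u : X p a b η Ω}
    (hu : (u : Space d → ℝ) =ᵐ[auxMeasure p a b η Ω] fun x => truncation T w s t ‖x‖) :
    lscEnvelope (F p a b η Ω) u ≤ (volume : Measure (Space d)).toSphere univ *
      eLpNorm ((regularRadii p a b η).indicator G) (ENNReal.ofReal p)
        (profileMeasure d a b η) ^ p := by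
  have := h.nontrivial_space
  have := h.isFiniteMeasure_auxMeasure
  have hp0 : 0 < p := by linarith [h.one_lt]
  set I := regularRadii p a b η with hI
  set ν := profileMeasure d a b η with hν
  have hpos : ∀ n : ℕ, (0 : ℝ) < 1 / ((n : ℝ) + 1) := fun n => by positivity
  have hle1 : ∀ n : ℕ, 1 / ((n : ℝ) + 1) ≤ 1 := fun n => by
    rw [div_le_one (by positivity)]; linarith [n.cast_nonneg (α := ℝ)]
  have hex := fun (n : ℕ) (c : ℝ) (hc : c ∉ I) => h.exists_bump hc (hpos n) (hpos n)
  choose! φ hφi hφ0 hφs hφ1 hφe using hex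
  have hends : ∀ z ∈ T, a ≤ z.1 := fun z hz => by
    by_contra! hlt
    have hz12 : z.1 < z.2 := (D.left_lt z hz).trans_le ((D.le z hz).trans (D.lt_right z hz).le)
    have hm : (z.1 + min z.2 a) / 2 ∈ Ioo z.1 z.2 := by
      have h1 : z.1 < min z.2 a := lt_min hz12 hlt
      exact ⟨by linarith, by linarith [min_le_left z.2 a]⟩
    have h2 := (D.subset z hz hm).1.1
    have h1 : z.1 < min z.2 a := lt_min hz12 hlt
    linarith [min_le_right z.2 a]
  have hs : ∀ z ∈ T, a - 1 ≤ s z := fun z hz => by linarith [hends z hz, D.left_lt z hz]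
  have hz2 : ∀ z ∈ T, a ≤ z.2 := fun z hz => by
    linarith [hends z hz, D.left_lt z hz, D.le z hz, D.lt_right z hz]
  -- On each interval the primitive of g n rises from 0 to w(s) near the left endpoint, follows w
  -- between the cuts, and returns to 0 near the right endpoint, the transitions being scaled bumps
  -- of radius 1/(n+1).
  set g : ℕ → ℝ → ℝ := fun n r => ∑ z ∈ T, ((Ioc (s z) (t z)).indicator G r +
    (w z (s z) * φ n z.1 r - w z (t z) * φ n z.2 r)) with hg
  have hgi1 : ∀ n, ∀ z ∈ T, Integrable fun r => (Ioc (s z) (t z)).indicator G r +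
      (w z (s z) * φ n z.1 r - w z (t z) * φ n z.2 r) := fun n z hz =>
    (D.integrable_indicator hz).add (((hφi n z.1 (D.left_notMem z hz)).const_mul _).sub
      ((hφi n z.2 (D.right_notMem z hz)).const_mul _))
  have hgi : ∀ n, Integrable (g n) := fun n => integrable_finsetSum _ (hgi1 n)
  -- The base point a - 1 lies to the left of all bumps, since their centres are at least a and
  -- their radii at most 1. No mass is lost.
  set V : ℕ → ℝ → ℝ := fun n r => ∫ x in (a - 1)..r, g n x with hV
  set τ : ℕ → ℝ × ℝ → ℝ → ℝ := fun n z r => w z (max (s z) (min r (t z))) - w z (s z) +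
    (w z (s z) * (∫ x in (a - 1)..r, φ n z.1 x) - w z (t z) * ∫ x in (a - 1)..r, φ n z.2 x) with hτ
  have hVτ : ∀ n r, a - 1 ≤ r → V n r = ∑ z ∈ T, τ n z r := by
    intro n r hr
    simp only [hV, hg]
    rw [intervalIntegral.integral_finsetSum fun z hz => (hgi1 n z hz).intervalIntegrable]
    refine Finset.sum_congr rfl fun z hz => ?_
    have i1 := (hφi n z.1 (D.left_notMem z hz)).intervalIntegrable (a := a - 1) (b := r)
    have i2 := (hφi n z.2 (D.right_notMem z hz)).intervalIntegrable (a := a - 1) (b := r)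
    rw [intervalIntegral.integral_add (D.integrable_indicator hz).intervalIntegrable
      ((i1.const_mul _).sub (i2.const_mul _)),
      intervalIntegral.integral_sub (i1.const_mul _) (i2.const_mul _),
      intervalIntegral.integral_const_mul, intervalIntegral.integral_const_mul,
      D.integral_indicator hz (hs z hz) hr]
  obtain ⟨M, hM0, hM⟩ := D.exists_clamp_bound
  have hMs : ∀ z ∈ T, |w z (s z)| ≤ M := fun z hz => by
    have := hM z hz (s z)
    rwa [min_eq_left (D.le z hz), max_self] at this
  have hMt : ∀ z ∈ T, |w z (t z)| ≤ M := fun z hz => by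
    have := hM z hz (t z)
    rwa [min_self, max_eq_right (D.le z hz)] at this
  obtain ⟨K, hVb⟩ : ∃ K, ∀ n, ∀ r ∈ Ioo a b, ‖V n r‖ ≤ K := by
    -- Each τ consists of four terms bounded by M, because the integrals of a bump lie in [0, 1].
    refine ⟨∑ _z ∈ T, (4 * M), fun n r hr => ?_⟩
    have har : a - 1 ≤ r := by linarith [hr.1]
    rw [hVτ n r har]
    refine (norm_sum_le _ _).trans (Finset.sum_le_sum fun z hz => ?_)
    have hmul : ∀ x y : ℝ, |x| ≤ M → 0 ≤ y → y ≤ 1 → |x * y| ≤ M := by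
      intro x y hx hy0 hy1
      rw [abs_mul, abs_of_nonneg hy0]
      nlinarith [abs_nonneg x]
    have b1 := hmul _ _ (hMs z hz)
      (intervalIntegral_bump_nonneg (hφ0 n z.1 (D.left_notMem z hz)) har)
      (intervalIntegral_bump_le_one (hφi n z.1 (D.left_notMem z hz))
        (hφ0 n z.1 (D.left_notMem z hz)) (hφ1 n z.1 (D.left_notMem z hz)) har)
    have b2 := hmul _ _ (hMt z hz)
      (intervalIntegral_bump_nonneg (hφ0 n z.2 (D.right_notMem z hz)) har)
      (intervalIntegral_bump_le_one (hφi n z.2 (D.right_notMem z hz))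
        (hφ0 n z.2 (D.right_notMem z hz)) (hφ1 n z.2 (D.right_notMem z hz)) har)
    have b3 := hM z hz r
    have b4 := hMs z hz
    rw [abs_le] at b1 b2 b3 b4
    rw [Real.norm_eq_abs, abs_le]
    simp only [hτ]
    constructor <;> linarith [b1.1, b1.2, b2.1, b2.2, b3.1, b3.2, b4.1, b4.2]
  have hVm : ∀ n, Measurable (V n) := fun n =>
    (intervalIntegral.continuous_primitive (fun _ _ => (hgi n).intervalIntegrable) _).measurable
  choose y hy using fun n => h.exists_eq_comp_norm (hVm n) (hVb n)
  have hlim : ∀ r ∈ I, Tendsto (fun n => V n r) atTop (𝓝 (truncation T w s t r)) := by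
    intro r hr
    have har : a - 1 ≤ r := by linarith [hr.1.1]
    simp only [hVτ _ r har, truncation]
    refine tendsto_finsetSum _ fun z hz => ?_
    have hsmall : ∀ δ : ℝ, 0 < δ → ∀ᶠ n : ℕ in atTop, 1 / ((n : ℝ) + 1) < δ := fun δ hδ =>
      tendsto_one_div_add_atTop_nhds_zero_nat.eventually (gt_mem_nhds hδ)
    have hne1 : r ≠ z.1 := fun he => D.left_notMem z hz (he ▸ hr)
    have hne2 : r ≠ z.2 := fun he => D.right_notMem z hz (he ▸ hr)
    -- A regular radius differs from every endpoint, so once 1/(n+1) is below the distance the bump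
    -- lies entirely on one side of r.
    have hstep : ∀ c, c ∉ I → a ≤ c → r ≠ c → ∀ᶠ n : ℕ in atTop,
        ∫ x in (a - 1)..r, φ n c x = if c < r then 1 else 0 := by
      intro c hc hac hne
      filter_upwards [hsmall _ (abs_pos.2 (sub_ne_zero.2 hne))] with n hn
      split_ifs with hlt
      · rw [abs_of_pos (by linarith)] at hn
        exact intervalIntegral_bump_eq_one (hφs n c hc) (hφ1 n c hc) (by linarith [hle1 n])
          (by linarith) har
      · have : r < c := lt_of_le_of_ne (not_lt.1 hlt) hne
        rw [abs_of_neg (by linarith)] at hn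
        exact intervalIntegral_bump_eq_zero (hφs n c hc) har (by linarith)
    refine tendsto_const_nhds.congr' ?_
    filter_upwards [hstep z.1 (D.left_notMem z hz) (hends z hz) hne1,
      hstep z.2 (D.right_notMem z hz) (hz2 z hz) hne2] with n h1 h2
    simp only [hτ, h1, h2]
    -- To the left of the interval no transition has happened, inside it only the first one, and to
    -- the right both have and cancel the accumulated increment.
    rcases lt_or_gt_of_ne hne1 with hlt | hlt
    · have h3 : r ≤ s z := hlt.le.trans (D.left_lt z hz).le
      rw [indicator_of_notMem fun hr' => absurd hr'.1 (not_lt.2 hlt.le), if_neg (not_lt.2 hlt.le),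
        if_neg (not_lt.2 (h3.trans ((D.le z hz).trans (D.lt_right z hz).le))),
        min_eq_left (h3.trans (D.le z hz)), max_eq_left h3]
      ring
    · rcases lt_or_gt_of_ne hne2 with hlt' | hlt'
      · rw [indicator_of_mem (show r ∈ Ioo z.1 z.2 from ⟨hlt, hlt'⟩), if_pos hlt,
          if_neg (not_lt.2 hlt'.le)]
        ring
      · rw [indicator_of_notMem fun hr' => absurd hr'.2 (not_lt.2 hlt'.le), if_pos hlt,
          if_pos hlt', min_eq_right ((D.lt_right z hz).le.trans hlt'.le),
          max_eq_right (D.le z hz)]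
        ring
  have hyu : Tendsto y atTop (𝓝 u) := by
    have hB : MemLp (fun x => K + ‖u x‖) (ENNReal.ofReal p) (auxMeasure p a b η Ω) :=
      MemLp.add (memLp_const K) (MemLp.norm (Lp.memLp u))
    refine Lp_tendsto_of_dominated h.one_lt hB (fun n => ?_) ?_
    · have hreg : ∀ᵐ x ∂auxMeasure p a b η Ω, x ∈ regularSet p a b η Ω :=
        h.ae_auxMeasure_iff.2 (ae_restrict_mem h.isOpen_regularSet.measurableSet)
      filter_upwards [hreg, hy n] with x hx hyx
      refine (norm_sub_le _ _).trans ?_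
      rw [hyx]
      linarith [hVb n _ hx.2.1]
    · have hreg : ∀ᵐ x ∂auxMeasure p a b η Ω, x ∈ regularSet p a b η Ω :=
        h.ae_auxMeasure_iff.2 (ae_restrict_mem h.isOpen_regularSet.measurableSet)
      filter_upwards [hreg, ae_all_iff.2 hy, hu] with x hx hyx hux
      simp only [hyx, hux]
      exact hlim _ hx.2
  set A := eLpNorm (I.indicator G) (ENNReal.ofReal p) ν with hA
  set C := ∑ z ∈ T, (‖w z (s z)‖ₑ + ‖w z (t z)‖ₑ) with hC
  have hCt : C ≠ ⊤ := ENNReal.sum_ne_top.2 fun z _ => by simp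
  -- By Minkowski the transitions add at most C/(n+1) to the norm of the derivative, where C sums
  -- the absolute boundary values over finitely many intervals.
  have hge : ∀ n, eLpNorm (g n) (ENNReal.ofReal p) ν ≤
      A + C * ENNReal.ofReal (1 / ((n : ℝ) + 1)) := by
    intro n
    have hac := profileMeasure_absolutelyContinuous d a b η
    have hm1 : ∀ z ∈ T, AEStronglyMeasurable ((Ioc (s z) (t z)).indicator G) ν := fun z hz =>
      (D.integrable_indicator hz).aestronglyMeasurable.mono_ac hac
    have hm2 : ∀ c ∉ I, AEStronglyMeasurable (φ n c) ν := fun c hc =>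
      (hφi n c hc).aestronglyMeasurable.mono_ac hac
    have hsplit : g n = (∑ z ∈ T, (Ioc (s z) (t z)).indicator G) +
        ∑ z ∈ T, (w z (s z) • φ n z.1 - w z (t z) • φ n z.2) := by
      ext r
      simp only [hg, Pi.add_apply, Finset.sum_apply, Pi.sub_apply, Pi.smul_apply, smul_eq_mul,
        Finset.sum_add_distrib]
    have hm3 : ∀ z ∈ T, AEStronglyMeasurable (w z (s z) • φ n z.1 - w z (t z) • φ n z.2) ν :=
      fun z hz => ((hm2 _ (D.left_notMem z hz)).const_smul _).sub
        ((hm2 _ (D.right_notMem z hz)).const_smul _)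
    rw [hsplit]
    refine (eLpNorm_add_le (Finset.aestronglyMeasurable_sum _ hm1)
      (Finset.aestronglyMeasurable_sum _ hm3) h.one_le_ofReal).trans (add_le_add ?_ ?_)
    · refine eLpNorm_mono_ae (ae_of_all _ fun r => ?_)
      rw [Finset.sum_apply]
      exact D.norm_sum_indicator_le r
    · refine (eLpNorm_sum_le hm3 h.one_le_ofReal).trans ?_
      rw [hC, Finset.sum_mul]
      refine Finset.sum_le_sum fun z hz => ?_
      refine (eLpNorm_sub_le ((hm2 _ (D.left_notMem z hz)).const_smul _)
        ((hm2 _ (D.right_notMem z hz)).const_smul _) h.one_le_ofReal).trans ?_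
      rw [eLpNorm_const_smul, eLpNorm_const_smul, add_mul]
      exact add_le_add (mul_le_mul' le_rfl (hφe n _ (D.left_notMem z hz)))
        (mul_le_mul' le_rfl (hφe n _ (D.right_notMem z hz)))
  refine lscEnvelope_le_of_tendsto_of_tendsto hyu
    (c := fun n => (volume : Measure (Space d)).toSphere univ *
      (A + C * ENNReal.ofReal (1 / ((n : ℝ) + 1))) ^ p) (fun n => ?_) ?_
  · refine (lscEnvelope_le _).trans ((h.F_le_of_primitive (hgi n)
      (h.absolutelyContinuous_auxMeasure.ae_le (hy n))).trans ?_)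
    gcongr
    exact hge n
  · have h1 : Tendsto (fun n : ℕ => ENNReal.ofReal (1 / ((n : ℝ) + 1))) atTop (𝓝 0) := by
      have := ENNReal.tendsto_ofReal (tendsto_one_div_add_atTop_nhds_zero_nat (𝕜 := ℝ))
      rwa [ENNReal.ofReal_zero] at this
    have h2 := ENNReal.Tendsto.const_mul h1 (Or.inr hCt)
    rw [mul_zero] at h2
    have h3 := (tendsto_const_nhds (x := A)).add h2
    rw [add_zero] at h3
    exact ENNReal.Tendsto.const_mul (h3.ennrpow_const p) (Or.inr (toSphere_univ_ne_top _))

end Setting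

end RadialWeight

/-! ### Convergence of truncations and identification of the relaxed functional -/

open Filter

/-- Take an s at which |f| is within 1 of its infimum over (α, δ). Freezing f at the value f(s) to
the left of s then stays below |f| + 1, the domination needed even if f is unbounded near α. -/
lemma exists_left_cut (f : ℝ → ℝ) {α δ : ℝ} (hαδ : α < δ) :
    ∃ s ∈ Ioo α δ, ∀ r ∈ Ioc α s, |f s| ≤ |f r| + 1 := by
  have hne : ((fun r => |f r|) '' Ioo α δ).Nonempty := (nonempty_Ioo.2 hαδ).image _
  have hbdd : BddBelow ((fun r => |f r|) '' Ioo α δ) :=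
    ⟨0, by rintro _ ⟨r, -, rfl⟩; exact abs_nonneg _⟩
  obtain ⟨_, ⟨s, hs, rfl⟩, hlt⟩ := exists_lt_of_csInf_lt hne (lt_add_one _)
  refine ⟨s, hs, fun r hr => ?_⟩
  have := csInf_le hbdd ⟨r, ⟨hr.1, hr.2.trans_lt hs.2⟩, rfl⟩
  simp only at this hlt
  linarith

lemma exists_right_cut (f : ℝ → ℝ) {γ β : ℝ} (hγβ : γ < β) :
    ∃ t ∈ Ioo γ β, ∀ r ∈ Ico t β, |f t| ≤ |f r| + 1 := by
  obtain ⟨s, hs, hle⟩ := exists_left_cut (fun r => f (-r)) (neg_lt_neg hγβ)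
  refine ⟨-s, ⟨by linarith [hs.2], by linarith [hs.1]⟩, fun r hr => ?_⟩
  have := hle (-r) ⟨by linarith [hr.2], by linarith [hr.1]⟩
  rwa [neg_neg] at this

namespace RadialWeight

namespace Setting

variable {d : ℕ} {p a b : ℝ} {η : ℝ → ℝ} {Ω : Set (Space d)} (h : Setting d p a b η Ω)

include h

lemma weightedEnergy_radial_eq_eLpNorm {u : X p a b η Ω} {v G : ℝ → ℝ}
    (hv : HasWeakGradientOn (regularRadii p a b η) v G)
    (hu : (u : Space d → ℝ) =ᵐ[volume.restrict (regularSet p a b η Ω)] fun x => v ‖x‖) :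
    weightedEnergy p a b η Ω u = (volume : Measure (Space d)).toSphere univ *
      eLpNorm ((regularRadii p a b η).indicator G) (ENNReal.ofReal p)
        (profileMeasure d a b η) ^ p := by
  have hp0 : 0 < p := by linarith [h.one_lt]
  rw [h.weightedEnergy_radial hv hu, h.regularSet_eq,
    h.lintegral_radial_energy hv.2.1.aestronglyMeasurable isOpen_regularRadii.measurableSet
      subset_rfl, h.eLpNorm_profileMeasure_rpow]
  congr 1
  have h1 : ∀ r, ENNReal.ofReal (r ^ (d - 1)) * ‖(regularRadii p a b η).indicator G r‖ₑ ^ p *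
      ENNReal.ofReal (η r) = (regularRadii p a b η).indicator (fun r =>
        ENNReal.ofReal (r ^ (d - 1)) * ‖G r‖ₑ ^ p * ENNReal.ofReal (η r)) r := by
    intro r
    by_cases hr : r ∈ regularRadii p a b η
    · rw [indicator_of_mem hr, indicator_of_mem hr]
    · rw [indicator_of_notMem hr, indicator_of_notMem hr, enorm_zero,
        ENNReal.zero_rpow_of_pos hp0, mul_zero, zero_mul]
  simp only [h1]
  rw [setLIntegral_indicator isOpen_regularRadii.measurableSet,
    inter_eq_left.2 regularRadii_subset_Ioo]

omit h in
/-- A profile coincides a.e. with a primitive of its derivative on each component. -/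
lemma exists_primitive {v G : ℝ → ℝ} (hv : HasWeakGradientOn (regularRadii p a b η) v G)
    {z : ℝ × ℝ} (hz : z.1 < z.2) (hsub : Ioo z.1 z.2 ⊆ regularRadii p a b η) :
    ∃ w : ℝ → ℝ, (∀ x ∈ Ioo z.1 z.2, ∀ y ∈ Ioo z.1 z.2, w y - w x = ∫ r in x..y, G r) ∧
      ∀ᵐ r, r ∈ Ioo z.1 z.2 → v r = w r := by
  have hm : (z.1 + z.2) / 2 ∈ Ioo z.1 z.2 := ⟨by linarith, by linarith⟩
  obtain ⟨c, hc⟩ := (hv.mono hsub).exists_ae_eq_primitive hm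
  have hG : ∀ x ∈ Ioo z.1 z.2, ∀ y ∈ Ioo z.1 z.2, IntervalIntegrable G volume x y := by
    intro x hx y hy
    rw [intervalIntegrable_iff']
    exact hv.2.1.integrableOn_compact_subset
      ((ordConnected_Ioo.uIcc_subset hx hy).trans hsub) isCompact_uIcc
  refine ⟨fun r => c + ∫ t in ((z.1 + z.2) / 2)..r, G t, fun x hx y hy => ?_, ?_⟩
  · simp only
    rw [← intervalIntegral.integral_interval_sub_left (hG _ hm y hy) (hG _ hm x hx)]
    ring
  · rwa [ae_restrict_iff' measurableSet_Ioo] at hc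

variable [Fact (1 < p)]

/-- Freeze the profile near the ends of each component. Freezing only removes derivative, so the
bound for the envelope at each truncation is already the energy of u. The truncations converge to u
in X by domination, and the envelope is lower semicontinuous. -/
lemma lscEnvelope_le_weightedEnergy {u : X p a b η Ω} (hu : u ∈ W p a b η Ω) :
    lscEnvelope (F p a b η Ω) u ≤ weightedEnergy p a b η Ω u := by
  have := h.isFiniteMeasure_auxMeasure
  obtain ⟨v, ⟨G, hv, -⟩, huv⟩ := hu
  rw [h.weightedEnergy_radial_eq_eLpNorm hv huv]
  obtain ⟨T, hT, hcover⟩ := h.exists_finset_components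
  choose! w hw hvw using fun (z : ℝ × ℝ) (hz : z ∈ T) =>
    exists_primitive hv (hT z hz).1 (hT z hz).2.2.2
  have hleft : ∀ (n : ℕ) (z : ℝ × ℝ), z ∈ T → ∃ s : ℝ,
      -- The cut is within 1/(n+1) of the endpoint, so every fixed radius is eventually unaffected,
      -- and the midpoint separates it from the right cut.
      s ∈ Ioo z.1 (min (z.1 + 1 / ((n : ℝ) + 1)) ((z.1 + z.2) / 2)) ∧
        ∀ r ∈ Ioc z.1 s, |w z s| ≤ |w z r| + 1 := fun n z hz => by
    have h1 : (0 : ℝ) < 1 / ((n : ℝ) + 1) := by positivity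
    have h2 := (hT z hz).1
    exact exists_left_cut (w z) (lt_min (by linarith) (by linarith))
  have hright : ∀ (n : ℕ) (z : ℝ × ℝ), z ∈ T → ∃ t : ℝ,
      t ∈ Ioo (max (z.2 - 1 / ((n : ℝ) + 1)) ((z.1 + z.2) / 2)) z.2 ∧
        ∀ r ∈ Ico t z.2, |w z t| ≤ |w z r| + 1 := fun n z hz => by
    have h1 : (0 : ℝ) < 1 / ((n : ℝ) + 1) := by positivity
    have h2 := (hT z hz).1
    exact exists_right_cut (w z) (max_lt (by linarith) (by linarith))
  choose! s hs hsle using hleft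
  choose! t ht htle using hright
  have D : ∀ n, TruncationData (regularRadii p a b η) T G w (s n) (t n) := fun n =>
    { left_notMem := fun z hz => (hT z hz).2.1
      right_notMem := fun z hz => (hT z hz).2.2.1
      subset := fun z hz => (hT z hz).2.2.2
      left_lt := fun z hz => (hs n z hz).1
      le := fun z hz => ((hs n z hz).2.trans_le (min_le_right _ _)).le.trans
        ((le_max_right _ _).trans (ht n z hz).1.le)
      lt_right := fun z hz => (ht n z hz).2
      sub_eq := hw
      locallyIntegrableOn := hv.2.1 }
  have hy : ∀ n, ∃ y : X p a b η Ω,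
      (y : Space d → ℝ) =ᵐ[auxMeasure p a b η Ω] fun x => truncation T w (s n) (t n) ‖x‖ :=
    fun n => by
      obtain ⟨M, hM⟩ := (D n).exists_truncation_bound
      exact h.exists_eq_comp_norm (D n).measurable_truncation fun r _ => hM r
  choose y hy using hy
  have hvw' : ∀ᵐ x ∂auxMeasure p a b η Ω, ∃ z ∈ T, ‖x‖ ∈ Ioo z.1 z.2 ∧ u x = w z ‖x‖ := by
    have h1 : ∀ᵐ r ∂volume.restrict (regularRadii p a b η), ∀ z ∈ T, r ∈ Ioo z.1 z.2 →
        v r = w z r := ae_restrict_of_ae ((ae_ball_iff T.countable_toSet).2 hvw)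
    rw [h.ae_auxMeasure_iff]
    filter_upwards [h.ae_regularSet h1, huv, ae_restrict_mem h.isOpen_regularSet.measurableSet]
      with x hx hux hxS
    have hmem := hcover _ hxS.2
    exact ⟨_, hmem, mem_Ioo_ends hxS.2, hux.trans (hx _ hmem (mem_Ioo_ends hxS.2))⟩
  have hyu : Tendsto y atTop (𝓝 u) := by
    -- The choice of cuts bounds the truncations by 1 + |u|, and the difference from u by 1 + 2|u|.
    -- The constant 1 lies in X because the auxiliary measure is finite.
    have hB : MemLp (fun x => 1 + (‖u x‖ + ‖u x‖)) (ENNReal.ofReal p) (auxMeasure p a b η Ω) :=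
      MemLp.add (memLp_const 1) (MemLp.add (MemLp.norm (Lp.memLp u)) (MemLp.norm (Lp.memLp u)))
    refine Lp_tendsto_of_dominated h.one_lt hB (fun n => ?_) ?_
    · filter_upwards [hy n, hvw'] with x hyx ⟨z, hz, hxz, hux⟩
      refine (norm_sub_le _ _).trans ?_
      rw [← add_assoc]
      refine add_le_add ?_ le_rfl
      rw [hyx, (D n).truncation_eq hz hxz, hux, Real.norm_eq_abs, Real.norm_eq_abs, add_comm]
      have hst := (D n).le z hz
      rcases le_total ‖x‖ (s n z) with h1 | h1
      · rw [min_eq_left (h1.trans hst), max_eq_left h1]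
        exact hsle n z hz _ ⟨hxz.1, h1⟩
      · rcases le_total ‖x‖ (t n z) with h2 | h2
        · rw [min_eq_left h2, max_eq_right h1]
          linarith
        · rw [min_eq_right h2, max_eq_right hst]
          exact htle n z hz _ ⟨h2, hxz.2⟩
    · filter_upwards [ae_all_iff.2 hy, hvw'] with x hyx ⟨z, hz, hxz, hux⟩
      have hsmall : ∀ δ : ℝ, 0 < δ → ∀ᶠ n : ℕ in atTop, 1 / ((n : ℝ) + 1) < δ := fun δ hδ =>
        tendsto_one_div_add_atTop_nhds_zero_nat.eventually (gt_mem_nhds hδ)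
      refine tendsto_const_nhds.congr' ?_
      filter_upwards [hsmall _ (sub_pos.2 hxz.1), hsmall _ (sub_pos.2 hxz.2)] with n h1 h2
      have h3 : s n z ≤ ‖x‖ := by
        linarith [(hs n z hz).2.trans_le (min_le_left _ _)]
      have h4 : ‖x‖ ≤ t n z := by
        linarith [(le_max_left _ _).trans_lt (ht n z hz).1]
      rw [hyx, (D n).truncation_eq hz hxz, hux, min_eq_left h4, max_eq_right h3]
  exact lscEnvelope_le_of_tendsto_of_tendsto hyu (fun n => h.lscEnvelope_truncation_le (D n) (hy n))
    tendsto_const_nhds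

/-- The relaxed functional is the energy. -/
lemma FBar_eq_weightedEnergy (u : X p a b η Ω) :
    FBar p a b η Ω u = weightedEnergy p a b η Ω u := by
  rw [FBar]
  split_ifs with hu
  · exact le_antisymm (h.lscEnvelope_le_weightedEnergy hu) (h.weightedEnergy_le_lscEnvelope u)
  · rfl

end Setting

end RadialWeight

theorem theorem5p2 (d : ℕ) (hd : 1 ≤ d) (p : ℝ) [Fact (1 < p)] (a b : ℝ) (ha : 0 ≤ a) (hab : a < b)
    (η : ℝ → ℝ)
    (hη_nonneg : ∀ᵐ r ∂(volume.restrict (Ici (0 : ℝ))), 0 ≤ η r)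
    (hη_int : LocallyIntegrableOn η (Ici (0 : ℝ)))
    (hη_supp : Function.support η ⊆ Ioo a b)
    (hη_deg : RadialWeight.FinitelyDegenerate p a b η)
    (Ω : Set (RadialWeight.Space d))
    (hΩ : Ω = {x | ‖x‖ < b} ∨ Ω = {x | a < ‖x‖ ∧ ‖x‖ < b})
    (g : RadialWeight.X p a b η Ω)
    (hg : ∃ γ : ℝ → ℝ, (g : RadialWeight.Space d → ℝ)
      =ᵐ[RadialWeight.auxMeasure p a b η Ω] fun x => γ ‖x‖) :
    ∃ u₀ ∈ RadialWeight.W p a b η Ω,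
      -- the radial function `u₀` is the unique minimizer of `H` over `W`
      (∀ z ∈ RadialWeight.W p a b η Ω,
        RadialWeight.H p a b η Ω g u₀ ≤ RadialWeight.H p a b η Ω g z) ∧
      (∀ u ∈ RadialWeight.W p a b η Ω,
        (∀ z ∈ RadialWeight.W p a b η Ω,
          RadialWeight.H p a b η Ω g u ≤ RadialWeight.H p a b η Ω g z) → u = u₀) ∧
      -- it is also the unique minimizer among all, possibly non-radial, competitors
      u₀ ∈ RadialWeight.domBar p a b η Ω ∧
      (∀ z ∈ RadialWeight.domBar p a b η Ω,
        RadialWeight.H p a b η Ω g u₀ ≤ RadialWeight.H p a b η Ω g z) ∧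
      (∀ u ∈ RadialWeight.domBar p a b η Ω,
        (∀ z ∈ RadialWeight.domBar p a b η Ω,
          RadialWeight.H p a b η Ω g u ≤ RadialWeight.H p a b η Ω g z) → u = u₀) := by
  have h : RadialWeight.Setting d p a b η Ω :=
    { one_le := hd
      one_lt := Fact.out
      nonneg := ha
      lt := hab
      aemeasurable := (hη_int.mono_set Ioi_subset_Ici_self).aestronglyMeasurable.aemeasurable
      support_subset := hη_supp
      degenerate := hη_deg
      domain := hΩ }
  obtain ⟨γ, hγ⟩ := hg
  obtain ⟨u₀, hu₀, hmin, huniq⟩ := h.exists_unique_minimizer hγ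
  have hu₀' := h.W_subset_domBar hu₀
  -- After this replacement u₀ is the unique minimizer of H over all of X. As it belongs to both W
  -- and the larger class, all assertions are restrictions of this one.
  simp only [RadialWeight.H, h.FBar_eq_weightedEnergy]
  exact ⟨u₀, hu₀, fun z _ => hmin z, fun u _ hu => huniq u (hu u₀ hu₀), hu₀', fun z _ => hmin z,
    fun u _ hu => huniq u (hu u₀ hu₀')⟩
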